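/- **Setting.** Let $Q=Q(d,d_0)$ be a compact connected two-point homogeneous space: either the sphere $S^d$, $d\ge 1$ (with $d_0=d$), or a projective space $\mathbb{F}P^n$, $n\ge 2$, with $\mathbb{F}=\mathbb{R},\mathbb{C},\mathbb{H}$ and $d_0=\dim_{\mathbb R}\mathbb{F}\in\{1,2,4\}$, $d=nd_0$, or the octonionic projective plane $\mathbb{O}P^2$ ($d_0=8$, $d=16$). Let $\theta$ be the geodesic metric on $Q$ normalized so that its diameter is $\pi$, and let $\mu$ be the invariant Riemannian measure normalized by $\mu(Q)=1$. For $r\in[0,\pi]$ and $y\in Q$ put $B_r(y)=\{x\in Q:\theta(x,y)<r\}$, $v_r(y)=\mu(B_r(y))$ and $\Lambda(B_r(y),x)=\chi(B_r(y),x)-v_r(y)$, where $\chi(E,\cdot)$ is the characteristic function of $E$. For $y_1,y_2\in Q$ put $$\lambda_r(y_1,y_2)=\int_Q\Lambda(B_r(y),y_1)\Lambda(B_r(y),y_2)\,d\mu(y),\qquad \theta^\Delta_r(y_1,y_2)=\tfrac12\,\mu\big(B_r(y_1)\,\Delta\,B_r(y_2)\big),$$ and, for a weight function $\eta\ge 0$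 on $[0,\pi]$, $$\lambda(\eta,y_1,y_2)=\int_0^\pi\lambda_r(y_1,y_2)\eta(r)\,dr,\qquad \theta^\Delta(\eta,y_1,y_2)=\int_0^\pi\theta^\Delta_r(y_1,y_2)\eta(r)\,dr .$$ For an $N$-point distribution $D=(x_1,\dots,x_N)$ in $Q$ (the points need not be different) put $\lambda_r[D]=\int_Q\big(\sum_i\Lambda(B_r(y),x_i)\big)^2d\mu(y)$ and $\lambda[\eta,D]=\int_0^\pi\lambda_r[D]\eta(r)\,dr$, and, for $\rho:Q\times Q\to\mathbb R$, $\rho[D]=\sum_{i,j}\rho(x_i,x_j)$ and $\langle\rho\rangle=\iint_{Q\times Q}\rho\,d\mu\,d\mu$. Put $\lambda_N(\eta)=\inf_D\lambda[\eta,D]$ and $\rho_N=\sup_D\rho[D]$, over all $N$-point distributions $D$; we write $\theta^\Delta_N(\eta)$ for $\rho_N$ with $\rho=\theta^\Delta(\eta)$. For integers $a,b\ge1$ let $W(a,b)$ be the class of weight functions $\eta\ge0$ on $[0,\pi]$ with $$\|\eta\|_{a,b}=\int_0^\pi\big(\sin\tfrac r2\big)^{a-1}\big(\cos\tfrac r2\big)^{b-1}\eta(r)\,dr<\infty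 .$$ **Lemma 2.1.** There is a constant $C>0$, depending only on $d$ and $d_0$, such that the following hold for $Q=Q(d,d_0)$ and all $y_1,y_2\in Q$. (i) For all $r\in[0,\pi]$, $$|\lambda_r(y_1,y_2)|\le C\big(\sin\tfrac r2\big)^{d}\big(\cos\tfrac r2\big)^{d_0},\qquad \theta^\Delta_r(y_1,y_2)\le C\big(\sin\tfrac r2\big)^{d}\big(\cos\tfrac r2\big)^{d_0}.$$ If $\eta\in W(d+1,d_0+1)$, then the integrals $\lambda(\eta,y_1,y_2)$ and $\theta^\Delta(\eta,y_1,y_2)$ converge absolutely and $$|\lambda(\eta,y_1,y_2)|\le C\|\eta\|_{d+1,d_0+1},\qquad \theta^\Delta(\eta,y_1,y_2)\le C\|\eta\|_{d+1,d_0+1}.$$ (ii) For all $r\in[0,\pi]$, $$\theta^\Delta_r(y_1,y_2)\le C\big(\sin\tfrac r2\big)^{d-1}\big(\cos\tfrac r2\big)^{d_0-1}\theta(y_1,y_2).$$ If $\eta\in W(d,d_0)$, then the integral $\theta^\Delta(\eta,y_1,y_2)$ converges and $$\theta^\Delta(\eta,y_1,y_2)\le C\|\eta\|_{d,d_0}\,\theta(y_1,y_2).$$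 Moreover, for every $\eta\in W(d+1,d_0+1)$ the integrals over $[0,\pi]$ of $\langle\theta^\Delta_r\rangle\eta(r)$ and of $\lambda_r[D]\eta(r)$ converge, and the $L_1$-invariance principles hold: for all $y_1,y_2\in Q$, all $N$ and all $N$-point distributions $D$ in $Q$, $$\lambda(\eta,y_1,y_2)+\theta^\Delta(\eta,y_1,y_2)=\langle\theta^\Delta(\eta)\rangle,$$ $$\lambda[\eta,D]+\theta^\Delta(\eta)[D]=\langle\theta^\Delta(\eta)\rangle N^2,\qquad \lambda_N(\eta)+\theta^\Delta_N(\eta)=\langle\theta^\Delta(\eta)\rangle N^2 .$$ -/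

import Mathlib

open MeasureTheory
open scoped Quaternion

noncomputable section

/-! ### The octonions -/

/-- The octonions, as pairs of quaternions, with the Euclidean norm of `ℝ⁸`. -/
def Octonion : Type := WithLp 2 (ℍ[ℝ] × ℍ[ℝ])

namespace Octonion

instance : NormedAddCommGroup Octonion :=
  inferInstanceAs (NormedAddCommGroup (WithLp 2 (ℍ[ℝ] × ℍ[ℝ])))

instance : InnerProductSpace ℝ Octonion :=
  inferInstanceAs (InnerProductSpace ℝ (WithLp 2 (ℍ[ℝ] × ℍ[ℝ])))

/-- The octonion with the given pair of quaternionic components. -/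
def mk (a b : ℍ[ℝ]) : Octonion := WithLp.toLp 2 (a, b)

/-- The first quaternionic component. -/
def left (x : Octonion) : ℍ[ℝ] := (WithLp.ofLp x).1

/-- The second quaternionic component. -/
def right (x : Octonion) : ℍ[ℝ] := (WithLp.ofLp x).2

instance : One Octonion := ⟨mk 1 0⟩

/-- The Cayley-Dickson product. -/
instance : Mul Octonion :=
  ⟨fun x y => mk (x.left * y.left - star y.right * x.right)
    (y.right * x.left + x.right * star y.left)⟩

/-- The conjugation. -/
instance : Star Octonion := ⟨fun x => mk (star x.left) (-x.right)⟩

end Octonion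

/-! ### Projective spaces in the projector model -/

section Projective

variable (F : Type) [NormedAddCommGroup F] [InnerProductSpace ℝ F] [Mul F] [One F] [Star F]

/-- The projective space `F Pⁿ`, as the set of Hermitian idempotent matrices of size `n + 1` and
trace one with entries in `F`. For `F = ℝ, ℂ, ℍ` these are the orthogonal projectors onto the
lines of `F ^ (n + 1)`; for the octonions and `n = 2` this is the Cayley plane. -/
def ProjectiveSpaceModel (n : ℕ) : Type :=
  {P : Matrix (Fin (n + 1)) (Fin (n + 1)) F // P.IsHermitian ∧ P * P = P ∧ P.trace = 1}

variable {F}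

/-- The Euclidean metric `‖P - P'‖ = (∑ |p i j - p' i j| ^ 2) ^ (1/2)`. It is used only for the
topology and for the volume; the geodesic metric is `ProjectiveSpaceModel.theta`. -/
instance (n : ℕ) : MetricSpace (ProjectiveSpaceModel F n) :=
  letI : NormedAddCommGroup (Matrix (Fin (n + 1)) (Fin (n + 1)) F) :=
    Matrix.frobeniusNormedAddCommGroup
  inferInstanceAs (MetricSpace {P : Matrix (Fin (n + 1)) (Fin (n + 1)) F //
    P.IsHermitian ∧ P * P = P ∧ P.trace = 1})

/-- The inner product `⟨P, P'⟩ = Re Tr (P P') = Re ∑ p i j * conj (p' i j)`. For the projectors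
onto the lines spanned by unit vectors `a`, `b` it is equal to `|(a, b)| ^ 2`. -/
def ProjectiveSpaceModel.innerProd {n : ℕ} (P P' : ProjectiveSpaceModel F n) : ℝ :=
  ∑ i, ∑ j, inner ℝ (P.1 i j) (P'.1 i j)

/-- The geodesic metric, normalized to have diameter `π`: `cos (θ / 2) = |(a, b)|` for the lines
spanned by unit vectors `a`, `b`, that is, `cos (θ / 2) = ⟨P, P'⟩ ^ (1/2)`. -/
def ProjectiveSpaceModel.theta {n : ℕ} (P P' : ProjectiveSpaceModel F n) : ℝ :=
  2 * Real.arccos (Real.sqrt (P.innerProd P'))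

end Projective

/-! ### The compact connected two-point homogeneous spaces -/

/-- The list of the compact connected two-point homogeneous spaces. -/
inductive TwoPointSpace : Type
  | sphere (d : ℕ) (hd : 1 ≤ d)
  | realProj (n : ℕ) (hn : 2 ≤ n)
  | complexProj (n : ℕ) (hn : 2 ≤ n)
  | quaternionProj (n : ℕ) (hn : 2 ≤ n)
  | octonionPlane

namespace TwoPointSpace

/-- The real dimension `d`. -/
def dim : TwoPointSpace → ℕ
  | sphere d _ => d
  | realProj n _ => n
  | complexProj n _ => n * 2
  | quaternionProj n _ => n * 4
  | octonionPlane => 2 * 8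

/-- The number `d₀`: the dimension of the algebra `F` for `F Pⁿ`, and `d₀ = d` for spheres. -/
def dim₀ : TwoPointSpace → ℕ
  | sphere d _ => d
  | realProj _ _ => 1
  | complexProj _ _ => 2
  | quaternionProj _ _ => 4
  | octonionPlane => 8

/-- The set of points. -/
def Carrier : TwoPointSpace → Type
  | sphere d _ => Metric.sphere (0 : EuclideanSpace ℝ (Fin (d + 1))) 1
  | realProj n _ => ProjectiveSpaceModel ℝ n
  | complexProj n _ => ProjectiveSpaceModel ℂ n
  | quaternionProj n _ => ProjectiveSpaceModel ℍ[ℝ] n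
  | octonionPlane => ProjectiveSpaceModel Octonion 2

instance : CoeSort TwoPointSpace Type := ⟨Carrier⟩

/-- The Euclidean metric of the ambient space (used only for the topology and for the volume). -/
instance : (Q : TwoPointSpace) → MetricSpace Q
  | sphere d _ =>
      inferInstanceAs (MetricSpace (Metric.sphere (0 : EuclideanSpace ℝ (Fin (d + 1))) 1))
  | realProj n _ => inferInstanceAs (MetricSpace (ProjectiveSpaceModel ℝ n))
  | complexProj n _ => inferInstanceAs (MetricSpace (ProjectiveSpaceModel ℂ n))
  | quaternionProj n _ => inferInstanceAs (MetricSpace (ProjectiveSpaceModel ℍ[ℝ] n))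
  | octonionPlane => inferInstanceAs (MetricSpace (ProjectiveSpaceModel Octonion 2))

instance (Q : TwoPointSpace) : MeasurableSpace Q := borel Q

instance (Q : TwoPointSpace) : BorelSpace Q := ⟨rfl⟩

/-- The geodesic metric `θ`, normalized to have diameter `π`. On the sphere it is the great circle
metric `cos θ(x, y) = (x, y)`. -/
def theta : (Q : TwoPointSpace) → Q → Q → ℝ
  | sphere d _ => fun (x y : Metric.sphere (0 : EuclideanSpace ℝ (Fin (d + 1))) 1) =>
      InnerProductGeometry.angle (x : EuclideanSpace ℝ (Fin (d + 1)))
        (y : EuclideanSpace ℝ (Fin (d + 1)))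
  | realProj _ _ => ProjectiveSpaceModel.theta (F := ℝ)
  | complexProj _ _ => ProjectiveSpaceModel.theta (F := ℂ)
  | quaternionProj _ _ => ProjectiveSpaceModel.theta (F := ℍ[ℝ])
  | octonionPlane => ProjectiveSpaceModel.theta (F := Octonion)

/-- The normalized Riemannian measure. The space is a compact smooth `d`-dimensional submanifold
of a Euclidean space, and its Riemannian distance is locally a constant times the Euclidean one up
to higher order, so its Riemannian measure is, up to a constant factor, the `d`-dimensional
Hausdorff measure. -/
def mu (Q : TwoPointSpace) : Measure Q :=
  (Measure.hausdorffMeasure (Q.dim : ℝ) (Set.univ : Set Q))⁻¹ •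
    Measure.hausdorffMeasure (Q.dim : ℝ)

end TwoPointSpace

/-! ### Discrepancies and symmetric difference metrics -/

section Discrepancy

variable {X : Type} [MeasurableSpace X] (θ : X → X → ℝ) (μ : Measure X)

/-- The open ball `B_r(y)`. -/
def thetaBall (r : ℝ) (y : X) : Set X := {x | θ x y < r}

/-- The volume `v_r(y)` of the ball `B_r(y)`. -/
def ballVolume (r : ℝ) (y : X) : ℝ := μ.real (thetaBall θ r y)

/-- The local discrepancy `Λ(B_r(y), x) = χ(B_r(y), x) - v_r(y)` of one point. -/
def localDiscrepancy (r : ℝ) (y x : X) : ℝ :=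
  (thetaBall θ r y).indicator (fun _ => (1 : ℝ)) x - ballVolume θ μ r y

/-- The kernel `λ_r(y₁, y₂) = ∫ Λ(B_r(y), y₁) Λ(B_r(y), y₂) dμ(y)`. -/
def discKernel (r : ℝ) (y₁ y₂ : X) : ℝ :=
  ∫ y, localDiscrepancy θ μ r y y₁ * localDiscrepancy θ μ r y y₂ ∂μ

/-- The kernel `λ(η, y₁, y₂)`. -/
def weightedDiscKernel (η : ℝ → ℝ) (y₁ y₂ : X) : ℝ :=
  ∫ r in (0 : ℝ)..Real.pi, discKernel θ μ r y₁ y₂ * η r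

/-- The symmetric difference metric `θ^Δ_r(y₁, y₂) = μ(B_r(y₁) Δ B_r(y₂)) / 2`. -/
def symmDiffMetric (r : ℝ) (y₁ y₂ : X) : ℝ :=
  1 / 2 * μ.real (symmDiff (thetaBall θ r y₁) (thetaBall θ r y₂))

/-- The symmetric difference metric `θ^Δ(η, y₁, y₂)`. -/
def weightedSymmDiffMetric (η : ℝ → ℝ) (y₁ y₂ : X) : ℝ :=
  ∫ r in (0 : ℝ)..Real.pi, symmDiffMetric θ μ r y₁ y₂ * η r

/-- The quadratic discrepancy `λ_r[D] = ∫ Λ[B_r(y), D] ^ 2 dμ(y)` of an `N`-point distribution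
(the points are not necessarily different). -/
def quadDiscrepancy (r : ℝ) {N : ℕ} (D : Fin N → X) : ℝ :=
  ∫ y, (∑ i, localDiscrepancy θ μ r y (D i)) ^ 2 ∂μ

/-- The quadratic discrepancy `λ[η, D]`. -/
def weightedQuadDiscrepancy (η : ℝ → ℝ) {N : ℕ} (D : Fin N → X) : ℝ :=
  ∫ r in (0 : ℝ)..Real.pi, quadDiscrepancy θ μ r D * η r

/-- The extremal discrepancy `λ_N(η) = inf λ[η, D]` over all `N`-point distributions. -/
def extremalDiscrepancy (η : ℝ → ℝ) (N : ℕ) : ℝ :=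
  ⨅ D : Fin N → X, weightedQuadDiscrepancy θ μ η D

/-- The sum of pairwise distances `ρ[D]`. -/
def distanceSum (ρ : X → X → ℝ) {N : ℕ} (D : Fin N → X) : ℝ :=
  ∑ i, ∑ j, ρ (D i) (D j)

/-- The extremal sum of distances `ρ_N = sup ρ[D]` over all `N`-point distributions. -/
def extremalDistanceSum (ρ : X → X → ℝ) (N : ℕ) : ℝ :=
  ⨆ D : Fin N → X, distanceSum ρ D

/-- The average value `⟨ρ⟩`. -/
def averageValue (ρ : X → X → ℝ) : ℝ :=
  ∫ y₁, ∫ y₂, ρ y₁ y₂ ∂μ ∂μ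

end Discrepancy

/-! ### Weight functions -/

/-- The density `(sin (r / 2)) ^ (a - 1) (cos (r / 2)) ^ (b - 1)`, for `a, b ≥ 1`. -/
def weightDensity (a b : ℕ) (r : ℝ) : ℝ :=
  Real.sin (r / 2) ^ (a - 1) * Real.cos (r / 2) ^ (b - 1)

/-- The norm `‖η‖_{a,b}`, for `a, b ≥ 1`. -/
def weightNorm (a b : ℕ) (η : ℝ → ℝ) : ℝ :=
  ∫ r in (0 : ℝ)..Real.pi, weightDensity a b r * η r

/-- The class `W(a, b)`, for `a, b ≥ 1`, of the nonnegative weight functions on `[0, π]` whose norm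
`‖η‖_{a,b}` is finite. -/
def WeightClass (a b : ℕ) : Set (ℝ → ℝ) :=
  {η | (∀ r ∈ Set.Icc 0 Real.pi, 0 ≤ η r) ∧
    IntervalIntegrable (fun r => weightDensity a b r * η r) volume 0 Real.pi}

end

set_option linter.unusedSectionVars false

/-! All balls of radius `r` have the same volume `v`. Put `m = μ(B_r(y₁) ∩ B_r(y₂))`. As `θ` is
symmetric, `λ_r = m - v²` and `θ^Δ_r = v - m`, so their sum `v - v²` does not depend on the points,
and by Tonelli it is also the average of `θ^Δ_r`. Integration against `η` and summation over pairs
give the invariance principles (`HasShellBounds.weightedDiscKernel_add`,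
`HasShellBounds.extremalDiscrepancy_add`). Since `max(0, 2v - 1) ≤ m ≤ v`, both kernels are at most
`min(v, 1 - v)` in absolute value. By the triangle inequality, either half of the symmetric
difference lies in a shell of width `θ(y₁, y₂)`. Hence every bound reduces to the measure of shells
`a ≤ θ(x, y) ≤ b`: it is `O(sin(b/2)^(d-1) (b-a))` when `b ≤ π/2` and `O(cos(a/2)^(d₀-1) (b-a))`
when `a ≥ π/2`.

Hausdorff measure is invariant under isometries, and these act transitively, so one centre is
enough. Near it there is a Lipschitz chart with `sin(θ/2) = ‖v‖`. Far from it finitely many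
Lipschitz charts have `cos(θ/2) = ‖p v‖`, where `p` is a linear projection onto a space of dimension
`d₀`. A Lipschitz map multiplies Hausdorff measure by at most a constant, and a shell becomes a set
cut out by an annulus in a Euclidean space (`hausdorffMeasure_annulus_le`).

The geometry needed is the triangle inequality and transitivity. For projective spaces both are
derived over a composition algebra, whose norm identities stand in for associativity. Transitivity
comes from real orthogonal conjugations together with multiplication of entries by units; over the
octonions the latter preserves idempotents by the Moufang identities. The triangle inequality at the
base point is the fact that `|(a, b)|` dominates the real part of `(a, b)`
(`IsCompAlg.sq_sum_inner_le_of_assoc`, `IsCompAlg.sq_sum_inner_le_of_two`). -/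

/-! ### Composition algebras -/

/-- A unital composition algebra over `ℝ` with definite norm, not necessarily associative. -/
class IsCompAlg (F : Type) [NormedAddCommGroup F] [InnerProductSpace ℝ F] [Mul F] [One F]
    [Star F] : Prop where
  protected mul_add : ∀ x y z : F, x * (y + z) = x * y + x * z
  protected add_mul : ∀ x y z : F, (x + y) * z = x * z + y * z
  protected smul_mul : ∀ (a : ℝ) (x y : F), (a • x) * y = a • (x * y)
  protected mul_smul : ∀ (a : ℝ) (x y : F), x * (a • y) = a • (x * y)
  protected one_mul : ∀ x : F, 1 * x = x
  protected mul_one : ∀ x : F, x * 1 = x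
  protected norm_mul : ∀ x y : F, ‖x * y‖ = ‖x‖ * ‖y‖
  protected norm_one : ‖(1 : F)‖ = 1
  protected star_eq : ∀ x : F, star x = (2 * inner ℝ 1 x) • (1 : F) - x

namespace IsCompAlg

variable {F : Type} [NormedAddCommGroup F] [InnerProductSpace ℝ F] [Mul F] [One F] [Star F]
  [IsCompAlg F]

variable (F) in
/-- The multiplication as a bilinear map. -/
def mulL : F →ₗ[ℝ] F →ₗ[ℝ] F :=
  LinearMap.mk₂ ℝ (fun x y => x * y) IsCompAlg.add_mul IsCompAlg.smul_mul IsCompAlg.mul_add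
    IsCompAlg.mul_smul

theorem mulL_apply (x y : F) : mulL F x y = x * y := rfl

protected theorem mul_zero (x : F) : x * 0 = 0 := by
  simp only [← mulL_apply, map_zero]

protected theorem zero_mul (x : F) : 0 * x = 0 := by
  simp only [← mulL_apply, map_zero, LinearMap.zero_apply]

protected theorem mul_sub (x y z : F) : x * (y - z) = x * y - x * z := by
  simp only [← mulL_apply, map_sub]

protected theorem sub_mul (x y z : F) : (x - y) * z = x * z - y * z := by
  simp only [← mulL_apply, map_sub, LinearMap.sub_apply]

theorem inner_one_one : inner ℝ (1 : F) 1 = 1 := by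
  rw [real_inner_self_eq_norm_sq, IsCompAlg.norm_one, one_pow]

/-- Polarization of `‖xy‖ = ‖x‖‖y‖` in the left factor. -/
theorem inner_mul_self_right (a b c : F) : inner ℝ (a * b) (c * b) = inner ℝ a c * ‖b‖ ^ 2 := by
  have h : ‖(a + c) * b‖ ^ 2 = ‖a + c‖ ^ 2 * ‖b‖ ^ 2 := by rw [IsCompAlg.norm_mul, mul_pow]
  rw [IsCompAlg.add_mul, norm_add_sq_real, norm_add_sq_real, IsCompAlg.norm_mul,
    IsCompAlg.norm_mul] at h
  linarith [h]

/-- Full polarization of the norm identity. The adjunctions, the cancellation laws and the Moufang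
identities below are all instances of it, tested against an arbitrary vector `z`. -/
theorem inner_mul_mul_add (a b c e : F) :
    inner ℝ (a * b) (c * e) + inner ℝ (a * e) (c * b) = 2 * inner ℝ a c * inner ℝ b e := by
  have h := inner_mul_self_right a (b + e) c
  rw [IsCompAlg.mul_add, IsCompAlg.mul_add, inner_add_left, inner_add_right, inner_add_right,
    inner_mul_self_right, inner_mul_self_right, norm_add_sq_real] at h
  linarith [h]

theorem inner_mul_left (x y z : F) : inner ℝ (x * y) z = inner ℝ y (star x * z) := by
  have h := inner_mul_mul_add x y 1 z
  rw [IsCompAlg.one_mul, IsCompAlg.one_mul] at h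
  rw [IsCompAlg.star_eq, IsCompAlg.sub_mul, IsCompAlg.smul_mul, IsCompAlg.one_mul, inner_sub_right,
    inner_smul_right, real_inner_comm x 1]
  rw [real_inner_comm (x * z) y]
  linarith

theorem inner_mul_right (x y z : F) : inner ℝ (x * y) z = inner ℝ x (z * star y) := by
  have h := inner_mul_mul_add x y z 1
  rw [IsCompAlg.mul_one, IsCompAlg.mul_one] at h
  rw [IsCompAlg.star_eq, IsCompAlg.mul_sub, IsCompAlg.mul_smul, IsCompAlg.mul_one, inner_sub_right,
    inner_smul_right, real_inner_comm y 1]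
  linarith

theorem star_add' (x y : F) : star (x + y) = star x + star y := by
  simp only [IsCompAlg.star_eq, inner_add_right, mul_add, add_smul]
  abel

theorem star_smul' (a : ℝ) (x : F) : star (a • x) = a • star x := by
  simp only [IsCompAlg.star_eq, inner_smul_right, smul_sub, smul_smul]
  ring_nf

variable (F) in
/-- The conjugation as a linear map. -/
def starL : F →ₗ[ℝ] F where
  toFun := star
  map_add' := star_add'
  map_smul' := star_smul'

theorem starL_apply (x : F) : starL F x = star x := rfl

theorem star_sum' {ι : Type*} (s : Finset ι) (f : ι → F) :
    star (∑ i ∈ s, f i) = ∑ i ∈ s, star (f i) := by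
  simp only [← starL_apply, map_sum]

theorem star_zero' : star (0 : F) = 0 := by
  simp only [← starL_apply, map_zero]

theorem star_one' : star (1 : F) = 1 := by
  rw [IsCompAlg.star_eq, inner_one_one, mul_one, two_smul, add_sub_cancel_right]

theorem star_star' (x : F) : star (star x) = x := by
  simp only [IsCompAlg.star_eq (star x)]
  simp only [IsCompAlg.star_eq, inner_sub_right, inner_smul_right, inner_one_one]
  have : (2 : ℝ) * (2 * inner ℝ 1 x * 1 - inner ℝ 1 x) - 2 * inner ℝ 1 x = 0 := by ring
  rw [sub_sub_eq_add_sub, add_sub_right_comm, ← sub_smul, this, zero_smul, zero_add]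

theorem inner_star_star (x y : F) : inner ℝ (star x) (star y) = inner ℝ x y := by
  simp only [IsCompAlg.star_eq, inner_sub_left, inner_sub_right, inner_smul_left,
    inner_smul_right, inner_one_one, real_inner_comm x 1]
  simp
  ring

theorem inner_star_left (x y : F) : inner ℝ (star x) y = inner ℝ x (star y) := by
  rw [← inner_star_star, star_star']

theorem norm_star' (x : F) : ‖star x‖ = ‖x‖ := by
  rw [norm_eq_sqrt_real_inner, inner_star_star, ← norm_eq_sqrt_real_inner]

theorem star_mul' (x y : F) : star (x * y) = star y * star x := by
  refine ext_inner_right ℝ fun z => ?_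
  rw [inner_mul_left, star_star', inner_star_left, inner_mul_left, real_inner_comm,
    inner_mul_right, star_star']

/-- The exchange identity with both left factors equal to `x`. This and its three variants are the
cancellation rules used where associativity is unavailable. -/
theorem star_mul_mul (x y : F) : star x * (x * y) = ‖x‖ ^ 2 • y := by
  refine ext_inner_right ℝ fun z => ?_
  rw [inner_mul_left, star_star', real_inner_smul_left]
  have h := inner_mul_mul_add x y x z
  rw [real_inner_comm (x * y) (x * z), real_inner_self_eq_norm_sq] at h
  linarith

theorem mul_star_mul (x y : F) : x * (star x * y) = ‖x‖ ^ 2 • y := by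
  have := star_mul_mul (star x) y
  rwa [star_star', norm_star'] at this

theorem mul_mul_star (x y : F) : (y * x) * star x = ‖x‖ ^ 2 • y := by
  refine ext_inner_right ℝ fun z => ?_
  rw [inner_mul_right, star_star', real_inner_smul_left, inner_mul_self_right, mul_comm]

theorem mul_star_mul_right (x y : F) : (y * star x) * x = ‖x‖ ^ 2 • y := by
  have := mul_mul_star (star x) y
  rwa [star_star', norm_star'] at this

theorem mul_star_self' (x : F) : x * star x = ‖x‖ ^ 2 • (1 : F) := by
  have := mul_mul_star x 1
  rwa [IsCompAlg.one_mul] at this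

theorem star_mul_self' (x : F) : star x * x = ‖x‖ ^ 2 • (1 : F) := by
  have := mul_star_self' (star x)
  rwa [star_star', norm_star'] at this

theorem inner_one_mul (x y : F) : inner ℝ 1 (x * y) = inner ℝ (star x) y := by
  rw [real_inner_comm, inner_mul_left, IsCompAlg.mul_one, real_inner_comm]

theorem eq_smul_one_of_star_eq {x : F} (h : star x = x) : x = inner ℝ 1 x • (1 : F) := by
  have := IsCompAlg.star_eq x
  rw [h, eq_sub_iff_add_eq, ← two_smul ℝ, mul_smul] at this
  exact smul_right_injective F (two_ne_zero (α := ℝ)) this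

/-- In the exchange identity the fourth entry is `star u`, so that one of the products, `u * star
u`, is a scalar. -/
theorem mul_mul_self (u w : F) :
    (u * w) * u = (2 * inner ℝ w (star u)) • u - ‖u‖ ^ 2 • star w := by
  refine ext_inner_right ℝ fun z => ?_
  have h := inner_mul_mul_add u w z (star u)
  rw [mul_star_self', real_inner_smul_left] at h
  have h1 : inner ℝ 1 (z * w) = inner ℝ (star w) z := by
    rw [real_inner_comm, inner_mul_right, IsCompAlg.one_mul, real_inner_comm]
  rw [h1] at h
  rw [inner_mul_right, inner_sub_left, real_inner_smul_left, real_inner_smul_left]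
  linarith

/-- The middle Moufang identity. -/
theorem moufang_middle (u x y : F) : (u * x) * (y * u) = (u * (x * y)) * u := by
  refine ext_inner_right ℝ fun z => ?_
  have h := inner_mul_mul_add u x z (star u * star y)
  rw [mul_star_mul, real_inner_smul_left, ← star_mul' y u] at h
  rw [inner_mul_right, mul_mul_self, inner_sub_left, real_inner_smul_left, real_inner_smul_left]
  have h1 : inner ℝ x (star (y * u)) = inner ℝ (x * y) (star u) := by
    rw [star_mul', inner_mul_right]
  have h2 : inner ℝ (star y) (z * x) = inner ℝ (star (x * y)) z := by
    rw [star_mul', inner_mul_right, star_star']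
  rw [h1, h2] at h
  linarith

/-- The right Moufang identity. -/
theorem moufang_right (u w y : F) : ((y * u) * w) * u = y * ((u * w) * u) := by
  refine ext_inner_right ℝ fun z => ?_
  have h := inner_mul_mul_add (y * u) w z (star u)
  rw [mul_mul_star, real_inner_smul_left] at h
  have h1 : inner ℝ y (z * w) = inner ℝ (y * star w) z := by
    rw [inner_mul_right, star_star']
  rw [inner_mul_right, mul_mul_self, IsCompAlg.mul_sub, IsCompAlg.mul_smul, IsCompAlg.mul_smul,
    inner_sub_left, real_inner_smul_left, real_inner_smul_left, ← h1]
  linarith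

theorem flexible (u w : F) : (u * w) * u = u * (w * u) := by
  have := moufang_middle u 1 w
  rwa [IsCompAlg.one_mul, IsCompAlg.mul_one, eq_comm] at this

/-- The left Moufang identity. -/
theorem moufang_left (u w y : F) : u * (w * (u * y)) = ((u * w) * u) * y := by
  have h := congrArg star (moufang_right (star u) (star w) (star y))
  rw [flexible]
  simpa only [star_mul', star_star'] using h

theorem inner_mul_self_left (a b c : F) : inner ℝ (b * a) (b * c) = ‖b‖ ^ 2 * inner ℝ a c := by
  rw [inner_mul_left, star_mul_mul, real_inner_smul_right]

/-- The unit is the normalized conjugate; it serves to turn a matrix entry into a nonnegative real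
number. -/
theorem exists_unit_mul_eq (x : F) : ∃ u : F, ‖u‖ = 1 ∧ u * x = ‖x‖ • (1 : F) := by
  by_cases h : x = 0
  · exact ⟨1, IsCompAlg.norm_one, by simp [h, IsCompAlg.one_mul]⟩
  · have hx : ‖x‖ ≠ 0 := norm_ne_zero_iff.2 h
    refine ⟨‖x‖⁻¹ • star x, ?_, ?_⟩
    · rw [norm_smul, norm_star', norm_inv, norm_norm, inv_mul_cancel₀ hx]
    · rw [IsCompAlg.smul_mul, star_mul_self', smul_smul]
      congr 1
      field_simp

end IsCompAlg

instance : IsCompAlg ℝ where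
  mul_add := mul_add
  add_mul := add_mul
  smul_mul := smul_mul_assoc
  mul_smul a x y := mul_smul_comm a x y
  one_mul := one_mul
  mul_one := mul_one
  norm_mul := norm_mul
  norm_one := norm_one
  star_eq x := by simp; ring

instance : IsCompAlg ℂ where
  mul_add := mul_add
  add_mul := add_mul
  smul_mul := smul_mul_assoc
  mul_smul a x y := mul_smul_comm a x y
  one_mul := one_mul
  mul_one := mul_one
  norm_mul := norm_mul
  norm_one := norm_one
  star_eq x := by
    apply Complex.ext <;> simp [Complex.inner]; ring

instance : IsCompAlg ℍ[ℝ] where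
  mul_add := mul_add
  add_mul := add_mul
  smul_mul := smul_mul_assoc
  mul_smul a x y := mul_smul_comm a x y
  one_mul := one_mul
  mul_one := mul_one
  norm_mul := norm_mul
  norm_one := norm_one
  star_eq x := by
    ext <;> simp [Quaternion.inner_def]; ring

/-! ### The octonions form a composition algebra -/

namespace Octonion

theorem ext' {x y : Octonion} (h : x.left = y.left) (h' : x.right = y.right) : x = y :=
  (WithLp.ofLp_injective 2) (Prod.ext h h')

theorem left_add (x y : Octonion) : (x + y).left = x.left + y.left := rfl
theorem right_add (x y : Octonion) : (x + y).right = x.right + y.right := rfl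
theorem left_sub (x y : Octonion) : (x - y).left = x.left - y.left := rfl
theorem right_sub (x y : Octonion) : (x - y).right = x.right - y.right := rfl
theorem left_smul (a : ℝ) (x : Octonion) : (a • x).left = a • x.left := rfl
theorem right_smul (a : ℝ) (x : Octonion) : (a • x).right = a • x.right := rfl
theorem left_one : (1 : Octonion).left = 1 := rfl
theorem right_one : (1 : Octonion).right = 0 := rfl
theorem left_mul (x y : Octonion) :
    (x * y).left = x.left * y.left - star y.right * x.right := rfl
theorem right_mul (x y : Octonion) :
    (x * y).right = y.right * x.left + x.right * star y.left := rfl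
theorem left_star (x : Octonion) : (star x).left = star x.left := rfl
theorem right_star (x : Octonion) : (star x).right = -x.right := rfl

theorem inner_eq (x y : Octonion) :
    inner ℝ x y = inner ℝ x.left y.left + inner ℝ x.right y.right :=
  WithLp.prod_inner_apply x y

theorem norm_sq_eq (x : Octonion) : ‖x‖ ^ 2 = ‖x.left‖ ^ 2 + ‖x.right‖ ^ 2 := by
  rw [← real_inner_self_eq_norm_sq, inner_eq, real_inner_self_eq_norm_sq,
    real_inner_self_eq_norm_sq]

instance : IsCompAlg Octonion where
  mul_add x y z := by
    apply ext' <;> simp only [left_mul, right_mul, left_add, right_add, star_add, mul_add,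
      add_mul] <;> abel
  add_mul x y z := by
    apply ext' <;> simp only [left_mul, right_mul, left_add, right_add, mul_add,
      add_mul] <;> abel
  smul_mul a x y := by
    apply ext' <;> simp only [left_mul, right_mul, left_smul, right_smul, smul_add,
      smul_sub, smul_mul_assoc, mul_smul_comm]
  mul_smul a x y := by
    apply ext' <;> simp only [left_mul, right_mul, left_smul, right_smul, smul_add,
      smul_sub, smul_mul_assoc, mul_smul_comm, Quaternion.star_smul]
  one_mul x := by
    apply ext' <;> simp [left_mul, right_mul, left_one, right_one]
  mul_one x := by
    apply ext' <;> simp [left_mul, right_mul, left_one, right_one]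
  norm_mul x y := by
    rw [← sq_eq_sq₀ (norm_nonneg _) (by positivity), mul_pow, norm_sq_eq, norm_sq_eq, norm_sq_eq,
      left_mul, right_mul, norm_sub_sq_real, norm_add_sq_real]
    -- The cross terms of the two components cancel. This is where associativity of the quaternions
    -- is needed.
    have h : inner ℝ (x.left * y.left) (star y.right * x.right)
        = inner ℝ (y.right * x.left) (x.right * star y.left) := by
      rw [← IsCompAlg.inner_mul_left, ← IsCompAlg.inner_mul_right, mul_assoc]
    rw [h]
    simp only [norm_mul, norm_star]
    ring
  norm_one := by
    have h := norm_sq_eq 1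
    rw [left_one, right_one] at h
    rw [← sq_eq_sq₀ (norm_nonneg _) zero_le_one, h]
    simp
  star_eq x := by
    rw [inner_eq]
    apply ext'
    · rw [left_sub, left_smul, left_star, left_one, right_one, IsCompAlg.star_eq x.left]
      simp
    · rw [right_sub, right_smul, right_star, right_one]
      simp

instance : FiniteDimensional ℝ Octonion :=
  inferInstanceAs (FiniteDimensional ℝ (WithLp 2 (ℍ[ℝ] × ℍ[ℝ])))

theorem finrank_eq : Module.finrank ℝ Octonion = 8 := by
  change Module.finrank ℝ (WithLp 2 (ℍ[ℝ] × ℍ[ℝ])) = 8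
  rw [(WithLp.linearEquiv 2 ℝ (ℍ[ℝ] × ℍ[ℝ])).finrank_eq, Module.finrank_prod,
    Quaternion.finrank_eq_four]

end Octonion

/-! ### The structure of the points of a projective space -/


namespace ProjectiveSpaceModel

variable {F : Type} [NormedAddCommGroup F] [InnerProductSpace ℝ F] [Mul F] [One F] [Star F]
  {n : ℕ}

/-- The real number on the diagonal of a projector. -/
def diag (P : ProjectiveSpaceModel F n) (i : Fin (n + 1)) : ℝ := inner ℝ 1 (P.1 i i)

theorem ext_apply {P P' : ProjectiveSpaceModel F n} (h : ∀ i j, P.1 i j = P'.1 i j) : P = P' :=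
  Subtype.ext (Matrix.ext h)

theorem star_apply (P : ProjectiveSpaceModel F n) (i j : Fin (n + 1)) :
    star (P.1 i j) = P.1 j i :=
  P.2.1.apply j i

theorem sum_mul_apply (P : ProjectiveSpaceModel F n) (i j : Fin (n + 1)) :
    ∑ k, P.1 i k * P.1 k j = P.1 i j := by
  rw [← Matrix.mul_apply, P.2.2.1]

theorem dist_sq (P P' : ProjectiveSpaceModel F n) :
    dist P P' ^ 2 = ∑ i, ∑ j, ‖P.1 i j - P'.1 i j‖ ^ 2 := by
  let _ : NormedAddCommGroup (Matrix (Fin (n + 1)) (Fin (n + 1)) F) :=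
    Matrix.frobeniusNormedAddCommGroup
  have h : dist P P' = (∑ i, ∑ j, ‖(P.1 - P'.1) i j‖ ^ (2 : ℝ)) ^ (1 / 2 : ℝ) :=
    (dist_eq_norm P.1 P'.1).trans (Matrix.frobenius_norm_def (P.1 - P'.1))
  rw [h, ← Real.sqrt_eq_rpow, Real.sq_sqrt (by positivity)]
  simp only [Matrix.sub_apply, Real.rpow_two]

theorem innerProd_comm (P P' : ProjectiveSpaceModel F n) : P.innerProd P' = P'.innerProd P := by
  simp only [innerProd]
  exact Finset.sum_congr rfl fun i _ => Finset.sum_congr rfl fun j _ => real_inner_comm _ _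

variable [IsCompAlg F]

theorem apply_self (P : ProjectiveSpaceModel F n) (i : Fin (n + 1)) :
    P.1 i i = P.diag i • (1 : F) :=
  IsCompAlg.eq_smul_one_of_star_eq (P.star_apply i i)

theorem diag_eq_of_apply_self {P : ProjectiveSpaceModel F n} {i : Fin (n + 1)} {a : ℝ}
    (h : P.1 i i = a • (1 : F)) : P.diag i = a := by
  rw [diag, h, inner_smul_right, IsCompAlg.inner_one_one, mul_one]

theorem sum_norm_sq (P : ProjectiveSpaceModel F n) (i : Fin (n + 1)) :
    ∑ k, ‖P.1 i k‖ ^ 2 = P.diag i := by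
  have h := P.sum_mul_apply i i
  rw [P.apply_self i] at h
  have h' : ∀ k, P.1 i k * P.1 k i = ‖P.1 i k‖ ^ 2 • (1 : F) := fun k => by
    rw [← P.star_apply i k, IsCompAlg.mul_star_self']
  simp only [h'] at h
  rw [← Finset.sum_smul] at h
  have h2 := congrArg (fun x : F => inner ℝ 1 x) h
  simpa only [inner_smul_right, IsCompAlg.inner_one_one, mul_one] using h2

theorem norm_apply_comm (P : ProjectiveSpaceModel F n) (i j : Fin (n + 1)) :
    ‖P.1 i j‖ = ‖P.1 j i‖ := by
  rw [← P.star_apply i j, IsCompAlg.norm_star']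

theorem sum_norm_sq' (P : ProjectiveSpaceModel F n) (j : Fin (n + 1)) :
    ∑ k, ‖P.1 k j‖ ^ 2 = P.diag j := by
  rw [← P.sum_norm_sq j]
  exact Finset.sum_congr rfl fun k _ => by rw [P.norm_apply_comm]

theorem diag_nonneg (P : ProjectiveSpaceModel F n) (i : Fin (n + 1)) : 0 ≤ P.diag i := by
  rw [← P.sum_norm_sq i]
  positivity

theorem sum_diag (P : ProjectiveSpaceModel F n) : ∑ i, P.diag i = 1 := by
  have h := P.2.2.2
  rw [Matrix.trace] at h
  simp only [Matrix.diag_apply, P.apply_self] at h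
  rw [← Finset.sum_smul] at h
  have h2 := congrArg (fun x : F => inner ℝ 1 x) h
  simpa only [inner_smul_right, IsCompAlg.inner_one_one, mul_one] using h2

theorem diag_le_one (P : ProjectiveSpaceModel F n) (i : Fin (n + 1)) : P.diag i ≤ 1 := by
  rw [← P.sum_diag]
  exact Finset.single_le_sum (fun j _ => P.diag_nonneg j) (Finset.mem_univ i)

theorem norm_sq_apply_le (P : ProjectiveSpaceModel F n) (i j : Fin (n + 1)) :
    ‖P.1 i j‖ ^ 2 ≤ P.diag i * P.diag j := by
  have h1 : ‖P.1 i j‖ ≤ ∑ k, ‖P.1 i k‖ * ‖P.1 k j‖ := by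
    rw [← P.sum_mul_apply i j]
    refine (norm_sum_le _ _).trans_eq ?_
    simp only [IsCompAlg.norm_mul]
  calc ‖P.1 i j‖ ^ 2 ≤ (∑ k, ‖P.1 i k‖ * ‖P.1 k j‖) ^ 2 := by gcongr
    _ ≤ _ := Finset.sum_mul_sq_le_sq_mul_sq _ _ _
    _ = _ := by rw [P.sum_norm_sq, P.sum_norm_sq']

/-- The defects in the Cauchy-Schwarz bound are nonnegative and add up to `(Tr P)² - ‖P‖² = 1 - 1 =
0`, so each of them vanishes. -/
theorem norm_sq_apply (P : ProjectiveSpaceModel F n) (i j : Fin (n + 1)) :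
    ‖P.1 i j‖ ^ 2 = P.diag i * P.diag j := by
  have h : ∑ i, ∑ j, (P.diag i * P.diag j - ‖P.1 i j‖ ^ 2) = 0 := by
    simp only [Finset.sum_sub_distrib, P.sum_norm_sq, ← Finset.mul_sum, P.sum_diag, mul_one,
      sub_self, Finset.sum_const_zero]
  have h0 : ∀ i j, 0 ≤ P.diag i * P.diag j - ‖P.1 i j‖ ^ 2 := fun i j =>
    sub_nonneg.2 (P.norm_sq_apply_le i j)
  rw [Finset.sum_eq_zero_iff_of_nonneg fun i _ => Finset.sum_nonneg fun j _ => h0 i j] at h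
  have h1 := h i (Finset.mem_univ i)
  rw [Finset.sum_eq_zero_iff_of_nonneg fun j _ => h0 i j] at h1
  linarith [h1 j (Finset.mem_univ j)]

theorem norm_apply (P : ProjectiveSpaceModel F n) (i j : Fin (n + 1)) :
    ‖P.1 i j‖ = √(P.diag i * P.diag j) := by
  rw [← P.norm_sq_apply, Real.sqrt_sq (norm_nonneg _)]

/-- The projectors have rank one. -/
theorem mul_apply_apply (P : ProjectiveSpaceModel F n) (i k j : Fin (n + 1)) :
    P.1 i k * P.1 k j = P.diag k • P.1 i j := by
  have hn : ∀ k, ‖P.1 i k * P.1 k j‖ = P.diag k * ‖P.1 i j‖ := fun k => by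
    rw [IsCompAlg.norm_mul, ← sq_eq_sq₀ (by positivity)
      (mul_nonneg (P.diag_nonneg k) (norm_nonneg _)), mul_pow, mul_pow, P.norm_sq_apply,
      P.norm_sq_apply, P.norm_sq_apply]
    ring
  -- The products over `k` sum to `P.1 i j`, and their norms sum to its norm. Equality in
  -- Cauchy-Schwarz, term by term, makes each of them a nonnegative multiple of it.
  have hle : ∀ k ∈ Finset.univ, inner ℝ (P.1 i k * P.1 k j) (P.1 i j)
      ≤ P.diag k * ‖P.1 i j‖ ^ 2 := fun k _ =>
    (real_inner_le_norm _ _).trans_eq (by rw [hn k]; ring)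
  have hs : ∑ k, inner ℝ (P.1 i k * P.1 k j) (P.1 i j) = ∑ k, P.diag k * ‖P.1 i j‖ ^ 2 := by
    rw [← sum_inner, P.sum_mul_apply, ← Finset.sum_mul, P.sum_diag, one_mul,
      real_inner_self_eq_norm_sq]
  have he := (Finset.sum_eq_sum_iff_of_le hle).1 hs k (Finset.mem_univ k)
  rw [← sub_eq_zero, ← norm_eq_zero, ← sq_eq_zero_iff, norm_sub_sq_real, inner_smul_right, he,
    norm_smul, hn, Real.norm_of_nonneg (P.diag_nonneg k)]
  ring

theorem innerProd_self (P : ProjectiveSpaceModel F n) : P.innerProd P = 1 := by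
  simp only [innerProd, real_inner_self_eq_norm_sq, P.sum_norm_sq, P.sum_diag]

theorem dist_sq_eq (P P' : ProjectiveSpaceModel F n) :
    dist P P' ^ 2 = 2 - 2 * P.innerProd P' := by
  have h : ∀ i j, ‖P.1 i j - P'.1 i j‖ ^ 2
      = inner ℝ (P.1 i j) (P.1 i j) - 2 * inner ℝ (P.1 i j) (P'.1 i j)
        + inner ℝ (P'.1 i j) (P'.1 i j) := fun i j => by
    rw [norm_sub_sq_real, real_inner_self_eq_norm_sq, real_inner_self_eq_norm_sq]
  rw [dist_sq]
  simp only [h, Finset.sum_add_distrib, Finset.sum_sub_distrib, ← Finset.mul_sum]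
  have h1 := P.innerProd_self
  have h2 := P'.innerProd_self
  simp only [innerProd] at h1 h2 ⊢
  linarith

theorem innerProd_eq (P P' : ProjectiveSpaceModel F n) :
    P.innerProd P' = 1 - dist P P' ^ 2 / 2 := by
  rw [dist_sq_eq]
  ring

/-- `θ` is a function of the Euclidean distance, so isometries of the ambient metric preserve it. -/
theorem theta_eq_of_dist_eq {P P' R R' : ProjectiveSpaceModel F n}
    (h : dist P P' = dist R R') : P.theta P' = R.theta R' := by
  rw [theta, theta, innerProd_eq, innerProd_eq, h]

theorem apply_eq_zero_left (P : ProjectiveSpaceModel F n) {i : Fin (n + 1)} (h : P.diag i = 0)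
    (j : Fin (n + 1)) : P.1 i j = 0 := by
  have := P.norm_sq_apply i j
  rwa [h, zero_mul, sq_eq_zero_iff, norm_eq_zero] at this

theorem apply_eq_zero_right (P : ProjectiveSpaceModel F n) {i : Fin (n + 1)} (h : P.diag i = 0)
    (j : Fin (n + 1)) : P.1 j i = 0 := by
  rw [← P.star_apply, P.apply_eq_zero_left h, IsCompAlg.star_zero']

theorem exists_diag_pos (P : ProjectiveSpaceModel F n) : ∃ i, 0 < P.diag i := by
  by_contra! h
  have := P.sum_diag
  rw [Finset.sum_eq_zero fun i _ => le_antisymm (h i) (P.diag_nonneg i)] at this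
  exact zero_ne_one this

variable (F n) in
/-- The projector onto the first coordinate line. -/
def basePoint : ProjectiveSpaceModel F n :=
  ⟨Matrix.of fun i j => if i = 0 ∧ j = 0 then 1 else 0, by
    refine ⟨?_, ?_, ?_⟩
    · ext i j
      by_cases hi : i = 0 <;> by_cases hj : j = 0 <;>
        simp [hi, hj, IsCompAlg.star_one', IsCompAlg.star_zero']
    · ext i j
      rw [Matrix.mul_apply, Fintype.sum_eq_single 0]
      · by_cases hi : i = 0 <;> by_cases hj : j = 0 <;>
          simp [hi, hj, IsCompAlg.one_mul, IsCompAlg.zero_mul, IsCompAlg.mul_zero]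
      · intro k hk
        simp [hk, IsCompAlg.mul_zero]
    · rw [Matrix.trace, Fintype.sum_eq_single 0]
      · simp
      · intro k hk
        simp [hk]⟩

theorem basePoint_apply (i j : Fin (n + 1)) :
    (basePoint F n).1 i j = if i = 0 ∧ j = 0 then 1 else 0 := rfl

theorem eq_basePoint_of_diag {P : ProjectiveSpaceModel F n} (h : P.diag 0 = 1) :
    P = basePoint F n := by
  have h0 : ∀ i, i ≠ 0 → P.diag i = 0 := by
    have hs := P.sum_diag
    rw [← Finset.add_sum_erase _ _ (Finset.mem_univ 0), h, add_eq_left,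
      Finset.sum_eq_zero_iff_of_nonneg fun i _ => P.diag_nonneg i] at hs
    exact fun i hi => hs i (Finset.mem_erase.2 ⟨hi, Finset.mem_univ i⟩)
  refine ext_apply fun i j => ?_
  rw [basePoint_apply]
  split_ifs with hij
  · rw [hij.1, hij.2, P.apply_self, h, one_smul]
  · by_cases hi : i = 0
    · exact P.apply_eq_zero_right (h0 j fun hj => hij ⟨hi, hj⟩) i
    · exact P.apply_eq_zero_left (h0 i hi) j

theorem innerProd_basePoint (P : ProjectiveSpaceModel F n) :
    P.innerProd (basePoint F n) = P.diag 0 := by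
  rw [innerProd, Fintype.sum_eq_single 0, Fintype.sum_eq_single 0, basePoint_apply, diag]
  · simp [real_inner_comm]
  · intro j hj
    simp [basePoint_apply, hj]
  · intro i hi
    simp [basePoint_apply, hi]

theorem theta_basePoint (P : ProjectiveSpaceModel F n) :
    P.theta (basePoint F n) = 2 * Real.arccos √(P.diag 0) := by
  rw [theta, innerProd_basePoint]

end ProjectiveSpaceModel

/-! ### Homogeneity of the projective spaces -/

section OrthogonalMatrices

variable {ι F G : Type*} [Fintype ι] [DecidableEq ι] [AddCommGroup F] [Module ℝ F]
  [AddCommGroup G] [Module ℝ G] {g : Matrix ι ι ℝ}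

theorem Matrix.sum_mul_of_transpose_mul_self (hg : g.transpose * g = 1) (k l : ι) :
    ∑ m, g m k * g m l = if k = l then 1 else 0 := by
  have h := congrFun (congrFun hg k) l
  simpa only [Matrix.mul_apply, Matrix.transpose_apply, Matrix.one_apply] using h

/-- Stated for an arbitrary bilinear map because it is applied both to the multiplication
(idempotence is preserved) and to the inner product (distances are preserved). -/
theorem LinearMap.sum_apply_orthogonal (hg : g.transpose * g = 1) (B : F →ₗ[ℝ] F →ₗ[ℝ] G)
    (x y : ι → F) :
    ∑ m, B (∑ l, g m l • x l) (∑ k, g m k • y k) = ∑ l, B (x l) (y l) := by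
  simp only [map_sum, LinearMap.sum_apply, map_smul, LinearMap.smul_apply, Finset.smul_sum,
    smul_smul]
  rw [Finset.sum_comm]
  calc _ = ∑ k, ∑ l, ∑ m, (g m k * g m l) • B (x l) (y k) :=
        Finset.sum_congr rfl fun k _ => Finset.sum_comm
    _ = ∑ k, ∑ l, (if k = l then (1 : ℝ) else 0) • B (x l) (y k) := by
        simp only [← Finset.sum_smul, Matrix.sum_mul_of_transpose_mul_self hg]
    _ = _ := by simp

theorem sum_smul_sum_smul_orthogonal (hg : g * g.transpose = 1) (x : ι → F) (i : ι) :
    ∑ k, g i k • ∑ l, g.transpose k l • x l = x i := by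
  simp only [Finset.smul_sum, smul_smul]
  rw [Finset.sum_comm]
  simp only [← Finset.sum_smul, ← Matrix.mul_apply, hg, Matrix.one_apply]
  simp

theorem exists_orthogonal_row_eq (b : ι → ℝ) (hb : ∑ k, b k ^ 2 = 1) (i : ι) :
    ∃ g : Matrix ι ι ℝ, g * g.transpose = 1 ∧ g.transpose * g = 1 ∧ ∀ k, g i k = b k := by
  have hv : Orthonormal ℝ (({i} : Set ι).domRestrict fun _ => WithLp.toLp 2 b) := by
    refine ⟨fun j => ?_, fun j k hjk => (hjk (Subsingleton.elim _ _)).elim⟩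
    change ‖(WithLp.toLp 2 b : EuclideanSpace ℝ ι)‖ = 1
    simp [EuclideanSpace.norm_eq, hb]
  obtain ⟨e, he⟩ := hv.exists_orthonormalBasis_extension_of_card_eq
    (E := EuclideanSpace ℝ ι) (by simp)
  have hg : (Matrix.of fun j k => e j k) * (Matrix.of fun j k => e j k).transpose = 1 := by
    ext j k
    have := orthonormal_iff_ite.1 e.orthonormal j k
    simp only [PiLp.inner_apply] at this
    simp only [Matrix.mul_apply, Matrix.transpose_apply, Matrix.of_apply, Matrix.one_apply,
      ← this]
    exact Finset.sum_congr rfl fun l _ => by simp [mul_comm]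
  exact ⟨_, hg, mul_eq_one_comm.1 hg, fun k => by simp [he i rfl]⟩

end OrthogonalMatrices

namespace ProjectiveSpaceModel

variable {F : Type} [NormedAddCommGroup F] [InnerProductSpace ℝ F] [Mul F] [One F] [Star F]
  [IsCompAlg F] {n : ℕ}

/-- Two points are congruent if an isometry takes the first one to the second one. -/
def Congruent (P P' : ProjectiveSpaceModel F n) : Prop :=
  ∃ e : ProjectiveSpaceModel F n ≃ᵢ ProjectiveSpaceModel F n, e P = P'

theorem Congruent.trans {P P' P'' : ProjectiveSpaceModel F n} (h : Congruent P P')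
    (h' : Congruent P' P'') : Congruent P P'' := by
  obtain ⟨e, rfl⟩ := h
  obtain ⟨e', rfl⟩ := h'
  exact ⟨e.trans e', rfl⟩

theorem congruent_of_innerProd {f f' : ProjectiveSpaceModel F n → ProjectiveSpaceModel F n}
    (h : ∀ P, f (f' P) = P) (h' : ∀ P, f' (f P) = P)
    (hi : ∀ P P', (f P).innerProd (f P') = P.innerProd P') (P : ProjectiveSpaceModel F n) :
    Congruent P (f P) :=
  ⟨⟨⟨f, f', h', h⟩, Isometry.of_dist_eq fun x y => by
    change dist (f x) (f y) = _
    rw [← sq_eq_sq₀ dist_nonneg dist_nonneg, dist_sq_eq, dist_sq_eq, hi]⟩, rfl⟩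

/-- Conjugation by a real orthogonal matrix. -/
def orthogonalConj (g : Matrix (Fin (n + 1)) (Fin (n + 1)) ℝ) (hg : g.transpose * g = 1)
    (P : ProjectiveSpaceModel F n) : ProjectiveSpaceModel F n :=
  ⟨Matrix.of fun i j => ∑ l, g j l • ∑ k, g i k • P.1 k l, by
    refine ⟨?_, ?_, ?_⟩
    · ext i j
      simp only [Matrix.conjTranspose_apply, Matrix.of_apply, IsCompAlg.star_sum',
        IsCompAlg.star_smul', star_apply, Finset.smul_sum, smul_smul]
      rw [Finset.sum_comm]
      simp only [mul_comm]
    · ext i j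
      simp only [Matrix.mul_apply, Matrix.of_apply]
      have h : ∀ m, ∑ l, g j l • ∑ k, g m k • P.1 k l = ∑ k, g m k • ∑ l, g j l • P.1 k l := by
        intro m
        simp only [Finset.smul_sum, smul_smul]
        rw [Finset.sum_comm]
        simp only [mul_comm]
      -- The coefficients are real, so orthogonality contracts the middle index by bilinearity
      -- alone; associativity of `F` plays no role.
      simp only [h, ← IsCompAlg.mulL_apply]
      rw [← h, LinearMap.sum_apply_orthogonal hg]
      simp only [map_sum, LinearMap.sum_apply, map_smul, LinearMap.smul_apply,
        IsCompAlg.mulL_apply]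
      rw [Finset.sum_comm]
      refine Finset.sum_congr rfl fun l _ => ?_
      simp only [Finset.smul_sum]
      rw [Finset.sum_comm]
      refine Finset.sum_congr rfl fun k _ => ?_
      rw [← P.sum_mul_apply k l, Finset.smul_sum, Finset.smul_sum]
    · simp only [Matrix.trace, Matrix.diag_apply, Matrix.of_apply, Finset.smul_sum, smul_smul]
      calc _ = ∑ l, ∑ i, ∑ k, (g i l * g i k) • P.1 k l := Finset.sum_comm
        _ = ∑ l, ∑ k, ∑ i, (g i l * g i k) • P.1 k l :=
          Finset.sum_congr rfl fun k _ => Finset.sum_comm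
        _ = P.1.trace := by
          simp only [← Finset.sum_smul, Matrix.sum_mul_of_transpose_mul_self hg]
          simp [Matrix.trace]
        _ = 1 := P.2.2.2⟩

theorem orthogonalConj_apply (g : Matrix (Fin (n + 1)) (Fin (n + 1)) ℝ)
    (hg : g.transpose * g = 1) (P : ProjectiveSpaceModel F n) (i j : Fin (n + 1)) :
    (orthogonalConj g hg P).1 i j = ∑ l, g j l • ∑ k, g i k • P.1 k l := rfl

theorem innerProd_orthogonalConj (g : Matrix (Fin (n + 1)) (Fin (n + 1)) ℝ)
    (hg : g.transpose * g = 1) (P P' : ProjectiveSpaceModel F n) :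
    (orthogonalConj g hg P).innerProd (orthogonalConj g hg P') = P.innerProd P' := by
  have h := fun x y : Fin (n + 1) → F => LinearMap.sum_apply_orthogonal hg (innerₗ F) x y
  simp only [innerₗ_apply_apply] at h
  simp only [innerProd, orthogonalConj_apply, h]
  rw [Finset.sum_comm, Finset.sum_comm (f := fun i j => inner ℝ (P.1 i j) (P'.1 i j))]
  simp only [h]

theorem orthogonalConj_orthogonalConj (g : Matrix (Fin (n + 1)) (Fin (n + 1)) ℝ)
    (hg : g.transpose * g = 1) (hg' : g.transpose.transpose * g.transpose = 1)
    (P : ProjectiveSpaceModel F n) :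
    orthogonalConj g hg (orthogonalConj g.transpose hg' P) = P := by
  rw [Matrix.transpose_transpose] at hg'
  refine ext_apply fun i j => ?_
  simp only [orthogonalConj_apply]
  have h : ∀ l, ∑ k, g i k • ∑ l', g.transpose l l' • ∑ k', g.transpose k k' • P.1 k' l'
      = ∑ l', g.transpose l l' • P.1 i l' := fun l => by
    rw [← Finset.sum_congr rfl fun l' _ => congrArg (g.transpose l l' • ·)
      (sum_smul_sum_smul_orthogonal hg' (fun k' => P.1 k' l') i)]
    simp only [Finset.smul_sum (r := g i _)]
    rw [Finset.sum_comm]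
    simp only [Finset.smul_sum, smul_smul]
    refine Finset.sum_congr rfl fun _ _ => Finset.sum_congr rfl fun _ _ =>
      Finset.sum_congr rfl fun _ _ => ?_
    congr 1
    ring
  simp only [h]
  exact sum_smul_sum_smul_orthogonal hg' (fun l => P.1 i l) j

theorem congruent_orthogonalConj (g : Matrix (Fin (n + 1)) (Fin (n + 1)) ℝ)
    (hg : g.transpose * g = 1) (P : ProjectiveSpaceModel F n) :
    Congruent P (orthogonalConj g hg P) := by
  have hg' : g.transpose.transpose * g.transpose = 1 := by
    rw [Matrix.transpose_transpose]
    exact mul_eq_one_comm.1 hg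
  refine congruent_of_innerProd (f' := orthogonalConj g.transpose hg')
    (orthogonalConj_orthogonalConj g hg hg') (fun P => ?_) (innerProd_orthogonalConj g hg) P
  have := orthogonalConj_orthogonalConj g.transpose hg' (by simpa using hg) P
  simpa using this

/-- A point from its matrix entries. -/
def ofRankOne (M : Matrix (Fin (n + 1)) (Fin (n + 1)) F) (a : Fin (n + 1) → ℝ)
    (hs : ∀ i j, star (M i j) = M j i) (hd : ∀ i, M i i = a i • 1)
    (hn : ∀ i j, ‖M i j‖ ^ 2 = a i * a j) (ha : ∑ i, a i = 1)
    (hm : ∀ i j k, i ≠ j → i ≠ k → j ≠ k → M i k * M k j = a k • M i j) :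
    ProjectiveSpaceModel F n :=
  ⟨M, by
    refine ⟨Matrix.ext fun i j => hs j i, Matrix.ext fun i j => ?_, ?_⟩
    -- When two of the indices coincide, the relation follows from `hd`, `hs` and `hn`; only
    -- distinct indices need `hm`.
    · have h : ∀ k, M i k * M k j = a k • M i j := fun k => by
        by_cases hik : i = k
        · rw [← hik, hd, IsCompAlg.smul_mul, IsCompAlg.one_mul]
        by_cases hjk : j = k
        · rw [← hjk, hd, IsCompAlg.mul_smul, IsCompAlg.mul_one]
        by_cases hij : i = j
        · rw [← hij, ← hs i k, IsCompAlg.mul_star_self', hn, hd, smul_smul, mul_comm]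
        · exact hm i j k hij hik hjk
      rw [Matrix.mul_apply, Finset.sum_congr rfl fun k _ => h k, ← Finset.sum_smul, ha, one_smul]
    · simp only [Matrix.trace, Matrix.diag_apply, hd]
      rw [← Finset.sum_smul, ha, one_smul]⟩

/-- Conjugation by a diagonal matrix of units. -/
def diagConj (hF : ∀ x y z : F, x * y * z = x * (y * z)) (u : Fin (n + 1) → F)
    (hu : ∀ i, ‖u i‖ = 1) (P : ProjectiveSpaceModel F n) : ProjectiveSpaceModel F n :=
  ofRankOne (Matrix.of fun i j => u i * (P.1 i j * star (u j))) P.diag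
    (fun i j => by
      simp only [Matrix.of_apply, IsCompAlg.star_mul', IsCompAlg.star_star', star_apply, hF])
    (fun i => by
      simp only [Matrix.of_apply]
      rw [apply_self, IsCompAlg.smul_mul, IsCompAlg.one_mul, IsCompAlg.mul_smul,
        IsCompAlg.mul_star_self', hu, one_pow, one_smul])
    (fun i j => by
      simp only [Matrix.of_apply, IsCompAlg.norm_mul, IsCompAlg.norm_star', hu, one_mul, mul_one,
        norm_sq_apply])
    P.sum_diag
    (fun i j k _ _ _ => by
      simp only [Matrix.of_apply]
      rw [hF, hF, IsCompAlg.star_mul_mul, hu, one_pow, one_smul, ← hF (P.1 i k),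
        P.mul_apply_apply, IsCompAlg.smul_mul, IsCompAlg.mul_smul])

theorem diagConj_apply (hF : ∀ x y z : F, x * y * z = x * (y * z)) (u : Fin (n + 1) → F)
    (hu : ∀ i, ‖u i‖ = 1) (P : ProjectiveSpaceModel F n) (i j : Fin (n + 1)) :
    (diagConj hF u hu P).1 i j = u i * (P.1 i j * star (u j)) := rfl

theorem congruent_diagConj (hF : ∀ x y z : F, x * y * z = x * (y * z)) (u : Fin (n + 1) → F)
    (hu : ∀ i, ‖u i‖ = 1) (P : ProjectiveSpaceModel F n) : Congruent P (diagConj hF u hu P) := by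
  refine congruent_of_innerProd (f' := diagConj hF (fun i => star (u i))
    fun i => (IsCompAlg.norm_star' _).trans (hu i)) (fun P => ?_) (fun P => ?_)
    (fun P P' => ?_) P
  · refine ext_apply fun i j => ?_
    simp only [diagConj_apply, IsCompAlg.star_star']
    rw [hF, IsCompAlg.mul_star_mul, IsCompAlg.mul_mul_star]
    simp [hu]
  · refine ext_apply fun i j => ?_
    simp only [diagConj_apply, IsCompAlg.star_star']
    rw [hF, IsCompAlg.star_mul_mul, IsCompAlg.mul_star_mul_right]
    simp [hu]
  · simp only [innerProd, diagConj_apply, IsCompAlg.inner_mul_self_left,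
      IsCompAlg.inner_mul_self_right, IsCompAlg.norm_star', hu, one_pow, mul_one, one_mul]

/-- Such a point projects onto the line of the real unit vector `b`. An orthogonal matrix with first
row `b` takes `b` to the first basis vector. -/
theorem congruent_basePoint_of_real {P : ProjectiveSpaceModel F n} (b : Fin (n + 1) → ℝ)
    (hb : ∀ i j, P.1 i j = (b i * b j) • (1 : F)) : Congruent P (basePoint F n) := by
  have hs : ∑ i, b i ^ 2 = 1 := by
    rw [← P.sum_diag]
    exact Finset.sum_congr rfl fun i _ => by rw [diag_eq_of_apply_self (hb i i), sq]
  obtain ⟨g, -, hg, hrow⟩ := exists_orthogonal_row_eq b hs 0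
  rw [← eq_basePoint_of_diag (P := orthogonalConj g hg P)]
  · exact congruent_orthogonalConj g hg P
  · refine diag_eq_of_apply_self ?_
    simp only [orthogonalConj_apply, hrow, hb, smul_smul, ← Finset.sum_smul]
    congr 1
    have : ∀ l, b l * ∑ k, b k * (b k * b l) = b l ^ 2 := fun l => by
      rw [← one_mul (b l ^ 2), ← hs, Finset.mul_sum, Finset.sum_mul]
      exact Finset.sum_congr rfl fun k _ => by ring
    simp only [Finset.mul_sum] at this
    simp only [Finset.mul_sum, this, hs]

theorem congruent_basePoint_of_assoc (hF : ∀ x y z : F, x * y * z = x * (y * z))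
    (P : ProjectiveSpaceModel F n) : Congruent P (basePoint F n) := by
  obtain ⟨j, hj⟩ := P.exists_diag_pos
  -- These units make column `j` real. Since `P` has rank one, every entry is a product from column
  -- `j` and row `j` divided by the diagonal entry, so all entries become real together.
  choose u hu hux using fun k => IsCompAlg.exists_unit_mul_eq (P.1 k j)
  refine (congruent_diagConj hF u hu P).trans
    (congruent_basePoint_of_real (fun i => √(P.diag i)) fun k l => ?_)
  have h : P.1 k l = (P.diag j)⁻¹ • (P.1 k j * P.1 j l) := by
    rw [mul_apply_apply, smul_smul, inv_mul_cancel₀ hj.ne', one_smul]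
  have hl : P.1 j l * star (u l) = ‖P.1 l j‖ • (1 : F) := by
    rw [← P.star_apply l j, ← IsCompAlg.star_mul', hux, IsCompAlg.star_smul', IsCompAlg.star_one']
  rw [diagConj_apply, h, IsCompAlg.smul_mul, IsCompAlg.mul_smul, hF, hl, ← hF, hux,
    IsCompAlg.smul_mul, IsCompAlg.one_mul, smul_smul, smul_smul, norm_apply, norm_apply,
    Real.sqrt_mul (P.diag_nonneg k), Real.sqrt_mul (P.diag_nonneg l)]
  congr 1
  have := Real.mul_self_sqrt hj.le
  field_simp
  linear_combination √(P.diag k) * √(P.diag l) * this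

/-- The isometry of the plane that multiplies the entry `(0, 1)` by the unit `u`. -/
def moufangConj (u : F) (hu : ‖u‖ = 1) (P : ProjectiveSpaceModel F 2) :
    ProjectiveSpaceModel F 2 :=
  ofRankOne !![P.1 0 0, u * P.1 0 1, u * P.1 0 2 * u; P.1 1 0 * star u, P.1 1 1, P.1 1 2 * u;
      star u * P.1 2 0 * star u, star u * P.1 2 1, P.1 2 2] P.diag
    (fun i j => by
      fin_cases i <;> fin_cases j <;>
        simp [IsCompAlg.star_mul', IsCompAlg.star_star', star_apply, IsCompAlg.flexible])
    (fun i => by fin_cases i <;> simp [apply_self])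
    (fun i j => by
      rw [← norm_sq_apply]
      fin_cases i <;> fin_cases j <;>
        simp [IsCompAlg.norm_mul, IsCompAlg.norm_star', hu])
    P.sum_diag
    (fun i j k hij hik hjk => by
      have hu1 : star u * u = 1 := by
        rw [IsCompAlg.star_mul_self', hu, one_pow, one_smul]
      -- There are six triples of distinct indices, and each needs one of `h1` to `h6`: `h1`, `h4`
      -- are middle, `h2`, `h6` right and `h3`, `h5` left Moufang identities.
      have h1 : ∀ x y : F, (u * x) * (y * u) = u * (x * y) * u := IsCompAlg.moufang_middle u
      have h2 : ∀ x y : F, x * u * (star u * y * star u) = x * y * star u := fun x y => by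
        have h := IsCompAlg.moufang_right u (star u * y * star u) x
        have h' : u * (star u * y * star u) * u = y := by
          rw [IsCompAlg.flexible (star u), IsCompAlg.mul_star_mul, hu, one_pow, one_smul,
            IsCompAlg.mul_star_mul_right, hu, one_pow, one_smul]
        rw [h'] at h
        rw [← h, IsCompAlg.mul_mul_star, hu, one_pow, one_smul]
      have h3 : ∀ x y : F, (star u * x * star u) * (u * y) = star u * (x * y) := fun x y => by
        rw [← IsCompAlg.moufang_left, IsCompAlg.star_mul_mul, hu, one_pow, one_smul]
      have h4 : ∀ x y : F, (star u * x) * (y * star u) = star u * (x * y) * star u :=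
        IsCompAlg.moufang_middle (star u)
      have h5 : ∀ x y : F, (u * y * u) * (star u * x) = u * (y * x) := fun x y => by
        rw [← IsCompAlg.moufang_left, IsCompAlg.mul_star_mul, hu, one_pow, one_smul]
      have h6 : ∀ x y : F, x * star u * (u * y * u) = x * y * u := fun x y => by
        have h := IsCompAlg.moufang_right (star u) (u * y * u) x
        have h' : star u * (u * y * u) * star u = y := by
          rw [IsCompAlg.flexible u, IsCompAlg.star_mul_mul, hu, one_pow, one_smul,
            IsCompAlg.mul_mul_star, hu, one_pow, one_smul]
        rw [h'] at h
        rw [← h, IsCompAlg.mul_star_mul_right, hu, one_pow, one_smul]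
      fin_cases i <;> fin_cases j <;> fin_cases k <;> first
        | exact (hij rfl).elim
        | exact (hik rfl).elim
        | exact (hjk rfl).elim
        | simp [h1, h2, h3, h4, h5, h6, mul_apply_apply, IsCompAlg.mul_smul, IsCompAlg.smul_mul])

theorem diag_moufangConj (u : F) (hu : ‖u‖ = 1) (P : ProjectiveSpaceModel F 2) (i : Fin 3) :
    (moufangConj u hu P).diag i = P.diag i := by
  fin_cases i <;> rfl

theorem congruent_moufangConj (u : F) (hu : ‖u‖ = 1) (P : ProjectiveSpaceModel F 2) :
    Congruent P (moufangConj u hu P) := by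
  refine congruent_of_innerProd (f' := moufangConj (star u)
    ((IsCompAlg.norm_star' _).trans hu)) (fun P => ?_) (fun P => ?_)
    (fun P P' => ?_) P
  · refine ext_apply fun i j => ?_
    fin_cases i <;> fin_cases j <;>
      simp [moufangConj, ofRankOne, IsCompAlg.star_star', IsCompAlg.flexible,
        IsCompAlg.mul_star_mul, IsCompAlg.star_mul_mul, IsCompAlg.mul_mul_star,
        IsCompAlg.mul_star_mul_right, hu]
  · refine ext_apply fun i j => ?_
    fin_cases i <;> fin_cases j <;>
      simp [moufangConj, ofRankOne, IsCompAlg.star_star', IsCompAlg.flexible,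
        IsCompAlg.mul_star_mul, IsCompAlg.star_mul_mul, IsCompAlg.mul_mul_star,
        IsCompAlg.mul_star_mul_right, hu]
  · simp [innerProd, Fin.sum_univ_three, moufangConj, ofRankOne, IsCompAlg.inner_mul_self_left,
      IsCompAlg.inner_mul_self_right, IsCompAlg.norm_star', hu]

theorem exists_congruent_real_zero_one (P : ProjectiveSpaceModel F 2) :
    ∃ P' : ProjectiveSpaceModel F 2, Congruent P P' ∧
      P'.1 0 1 = (√(P'.diag 0) * √(P'.diag 1)) • (1 : F) ∧ ∀ i, P'.diag i = P.diag i := by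
  obtain ⟨u, hu, hux⟩ := IsCompAlg.exists_unit_mul_eq (P.1 0 1)
  refine ⟨_, congruent_moufangConj u hu P, ?_, diag_moufangConj u hu P⟩
  rw [diag_moufangConj, diag_moufangConj, ← Real.sqrt_mul (P.diag_nonneg 0), ← norm_apply, ← hux]
  rfl

/-- The upper left block is the real matrix with rows `(s², st)` and `(st, t²)`, which is singular.
A unit null vector of it, taken as the last row of an orthogonal matrix, kills the last diagonal
entry. -/
theorem exists_congruent_diag_two_eq_zero {P : ProjectiveSpaceModel F 2}
    (hP : P.1 0 1 = (√(P.diag 0) * √(P.diag 1)) • (1 : F)) :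
    ∃ P' : ProjectiveSpaceModel F 2, Congruent P P' ∧ P'.diag 2 = 0 := by
  have hP' : P.1 1 0 = (√(P.diag 0) * √(P.diag 1)) • (1 : F) := by
    rw [← P.star_apply 0 1, hP, IsCompAlg.star_smul', IsCompAlg.star_one']
  have h0 := Real.sq_sqrt (P.diag_nonneg 0)
  have h1 := Real.sq_sqrt (P.diag_nonneg 1)
  set s := √(P.diag 0)
  set t := √(P.diag 1)
  obtain ⟨w, hw, hw0⟩ : ∃ w : Fin 3 → ℝ, ∑ k, w k ^ 2 = 1 ∧
      ∑ l, w l • ∑ k, w k • P.1 k l = 0 := by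
    by_cases hst : s ^ 2 + t ^ 2 = 0
    -- If the block vanishes, a coordinate vector is a null vector.
    · have ht : t = 0 := by nlinarith [sq_nonneg s, sq_nonneg t]
      have hd : P.1 1 1 = 0 := by rw [P.apply_self, ← h1, ht]; simp
      refine ⟨![0, 1, 0], by simp [Fin.sum_univ_three], ?_⟩
      simp [Fin.sum_univ_three, hd]
    · have hpos : 0 < s ^ 2 + t ^ 2 := lt_of_le_of_ne (by positivity) (Ne.symm hst)
      have hr := Real.sq_sqrt hpos.le
      have hr0 := Real.sqrt_pos.2 hpos
      set r := √(s ^ 2 + t ^ 2)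
      refine ⟨![-t / r, s / r, 0], ?_, ?_⟩
      · simp [Fin.sum_univ_three]
        field_simp
        linarith
      · simp only [Fin.sum_univ_three, hP, hP', P.apply_self, ← h0, ← h1]
        simp only [Matrix.cons_val_zero, Matrix.cons_val_one, Matrix.cons_val, zero_smul,
          add_zero, smul_smul, ← add_smul]
        refine (congrArg (· • (1 : F)) ?_).trans (zero_smul ℝ 1)
        field_simp
        ring
  obtain ⟨g, -, hg, hrow⟩ := exists_orthogonal_row_eq w hw 2
  refine ⟨_, congruent_orthogonalConj g hg P, diag_eq_of_apply_self ?_⟩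
  simp only [orthogonalConj_apply, hrow, hw0, zero_smul]

/-- Make the entry `(0, 1)` real, rotate the third diagonal entry away, and make `(0, 1)` real
again. The last move keeps the diagonal, so the third row and column remain zero and the whole
matrix is real. -/
theorem congruent_basePoint_of_plane (P : ProjectiveSpaceModel F 2) :
    Congruent P (basePoint F 2) := by
  obtain ⟨P₁, h₁, hr₁, -⟩ := P.exists_congruent_real_zero_one
  obtain ⟨P₂, h₂, hd₂⟩ := exists_congruent_diag_two_eq_zero hr₁
  obtain ⟨P₃, h₃, hr₃, hd₃⟩ := P₂.exists_congruent_real_zero_one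
  have hd : P₃.diag 2 = 0 := (hd₃ 2).trans hd₂
  have hr₃' : P₃.1 1 0 = (√(P₃.diag 1) * √(P₃.diag 0)) • (1 : F) := by
    rw [← P₃.star_apply 0 1, hr₃, IsCompAlg.star_smul', IsCompAlg.star_one', mul_comm]
  refine (h₁.trans h₂).trans (h₃.trans
    (congruent_basePoint_of_real (fun i => √(P₃.diag i)) fun i j => ?_))
  by_cases hij : i = j
  · rw [hij, P₃.apply_self, Real.mul_self_sqrt (P₃.diag_nonneg j)]
  by_cases hi : i = 2
  · rw [hi, P₃.apply_eq_zero_left hd, hd]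
    simp
  by_cases hj : j = 2
  · rw [hj, P₃.apply_eq_zero_right hd, hd]
    simp
  fin_cases i <;> fin_cases j <;> first
    | exact (hij rfl).elim
    | exact (hi rfl).elim
    | exact (hj rfl).elim
    | exact hr₃
    | exact hr₃'

end ProjectiveSpaceModel

/-! ### The geodesic metric of the projective spaces -/

theorem abs_sum_inner_le {ι E : Type*} [Fintype ι] [NormedAddCommGroup E] [InnerProductSpace ℝ E]
    (x y : ι → E) :
    |∑ i, inner ℝ (x i) (y i)| ≤ √(∑ i, ‖x i‖ ^ 2) * √(∑ i, ‖y i‖ ^ 2) := by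
  rw [← Real.sqrt_mul (by positivity)]
  refine Real.le_sqrt_of_sq_le ?_
  calc |∑ i, inner ℝ (x i) (y i)| ^ 2 ≤ (∑ i, ‖x i‖ * ‖y i‖) ^ 2 := by
        gcongr
        exact (Finset.abs_sum_le_sum_abs _ _).trans
          (Finset.sum_le_sum fun i _ => abs_real_inner_le_norm _ _)
    _ ≤ _ := Finset.sum_mul_sq_le_sq_mul_sq _ _ _

namespace IsCompAlg

variable {F : Type} [NormedAddCommGroup F] [InnerProductSpace ℝ F] [Mul F] [One F] [Star F]
  [IsCompAlg F]

/-- By associativity the right side is `‖S‖²` with `S = ∑ star (x i) * y i`, and the left side is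
the square of the real part of `S`. -/
theorem sq_sum_inner_le_of_assoc (hF : ∀ x y z : F, x * y * z = x * (y * z)) {n : ℕ}
    (x y : Fin n → F) :
    (∑ i, inner ℝ (x i) (y i)) ^ 2
      ≤ ∑ i, ∑ k, inner ℝ (x i * star (x k)) (y i * star (y k)) := by
  have h1 : ∀ i k, inner ℝ (x i * star (x k)) (y i * star (y k))
      = inner ℝ (star (x k) * y k) (star (x i) * y i) := fun i k => by
    rw [inner_mul_left, ← hF, ← inner_mul_right]
  have h2 : ∀ i, inner ℝ (x i) (y i) = inner ℝ 1 (star (x i) * y i) := fun i => by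
    rw [inner_one_mul, star_star']
  simp only [h1, h2, ← inner_sum, ← sum_inner]
  rw [real_inner_self_eq_norm_sq, ← sq_abs]
  gcongr
  simpa [IsCompAlg.norm_one] using
    abs_real_inner_le_norm (1 : F) (∑ i, star (x i) * y i)

/-- The form of the preceding inequality that survives without associativity; two coordinates are
what the plane requires. -/
theorem sq_sum_inner_le_of_two (x y : Fin 2 → F) :
    (∑ i, inner ℝ (x i) (y i)) ^ 2
      ≤ ∑ i, ∑ k, inner ℝ (x i * star (x k)) (y i * star (y k)) := by
  simp only [Fin.sum_univ_two, mul_star_self', inner_smul_left, inner_smul_right, inner_one_one]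
  obtain ⟨a, ha⟩ : ∃ a, a = x 0 := ⟨_, rfl⟩
  obtain ⟨b, hb⟩ : ∃ b, b = x 1 := ⟨_, rfl⟩
  obtain ⟨c, hc⟩ : ∃ c, c = y 0 := ⟨_, rfl⟩
  obtain ⟨e, he⟩ : ∃ e, e = y 1 := ⟨_, rfl⟩
  rw [← ha, ← hb, ← hc, ← he]
  have hsymm : inner ℝ (b * star a) (e * star c) = inner ℝ (a * star b) (c * star e) := by
    rw [← inner_star_star, star_mul', star_mul', star_star', star_star']
  rw [hsymm]
  simp only [RCLike.conj_to_real, mul_one]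
  by_cases h0 : a = 0
  · rw [h0, IsCompAlg.zero_mul, inner_zero_left, inner_zero_left, norm_zero, zero_add,
      ← mul_pow, ← sq_abs]
    have := abs_real_inner_le_norm b e
    have h := pow_le_pow_left₀ (abs_nonneg _) this 2
    linarith
  -- The vector `‖a‖² c + (a b̄) e` replaces `a (ā c + b̄ e)`, to which it would be equal under
  -- associativity. Cauchy-Schwarz for it and `a` is the claim multiplied by `‖a‖⁴`.
  · have ha0 : 0 < ‖a‖ ^ 2 := by positivity
    have h1 : inner ℝ (‖a‖ ^ 2 • c + (a * star b) * e) a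
        = ‖a‖ ^ 2 * (inner ℝ a c + inner ℝ b e) := by
      rw [inner_add_left, real_inner_smul_left, inner_mul_left, star_mul', star_star',
        mul_star_mul_right, real_inner_smul_right, real_inner_comm, real_inner_comm e b]
      ring
    have h2 : ‖‖a‖ ^ 2 • c + (a * star b) * e‖ ^ 2
        = ‖a‖ ^ 2 * (‖a‖ ^ 2 * ‖c‖ ^ 2 + ‖b‖ ^ 2 * ‖e‖ ^ 2
          + 2 * inner ℝ (a * star b) (c * star e)) := by
      rw [norm_add_sq_real, real_inner_smul_left, real_inner_comm, ← inner_mul_right,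
        norm_smul, IsCompAlg.norm_mul, IsCompAlg.norm_mul, norm_star', Real.norm_of_nonneg ha0.le]
      ring
    have h3 := pow_le_pow_left₀ (abs_nonneg _)
      (abs_real_inner_le_norm (‖a‖ ^ 2 • c + (a * star b) * e) a) 2
    rw [sq_abs, mul_pow, h1, h2, mul_pow] at h3
    have h4 : (‖a‖ ^ 2) ^ 2 * (inner ℝ a c + inner ℝ b e) ^ 2
        ≤ (‖a‖ ^ 2) ^ 2 * (‖a‖ ^ 2 * ‖c‖ ^ 2 + ‖b‖ ^ 2 * ‖e‖ ^ 2
          + 2 * inner ℝ (a * star b) (c * star e)) := by linarith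
    have h5 := le_of_mul_le_mul_left h4 (by positivity)
    linarith

end IsCompAlg

namespace ProjectiveSpaceModel

variable {F : Type} [NormedAddCommGroup F] [InnerProductSpace ℝ F] [Mul F] [One F] [Star F]
  {n : ℕ}

theorem theta_nonneg (P P' : ProjectiveSpaceModel F n) : 0 ≤ P.theta P' :=
  mul_nonneg zero_le_two (Real.arccos_nonneg _)

theorem theta_le_pi (P P' : ProjectiveSpaceModel F n) : P.theta P' ≤ Real.pi := by
  have := Real.arccos_le_pi_div_two.2 (Real.sqrt_nonneg (P.innerProd P'))
  rw [theta]
  linarith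

theorem theta_comm (P P' : ProjectiveSpaceModel F n) : P.theta P' = P'.theta P := by
  rw [theta, theta, innerProd_comm]

variable [IsCompAlg F]

theorem sum_succ_norm_sq (P : ProjectiveSpaceModel F n) (h : 0 < P.diag 0) :
    ∑ i : Fin n, ‖(√(P.diag 0))⁻¹ • P.1 i.succ 0‖ ^ 2 = 1 - P.diag 0 := by
  have hs := P.sum_diag
  rw [Fin.sum_univ_succ] at hs
  rw [← eq_sub_iff_add_eq'.2 hs]
  refine Finset.sum_congr rfl fun i _ => ?_
  rw [norm_smul, mul_pow, norm_sq_apply, norm_inv, Real.norm_of_nonneg (Real.sqrt_nonneg _),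
    inv_pow, Real.sq_sqrt h.le]
  field_simp

/-- `P` is represented by the unit vector with real first coordinate `√(P.diag 0)` and remaining
coordinates `P.1 i 0 / √(P.diag 0)`. The claim is `(Re (a, b))² ≤ |(a, b)|²` for two such vectors.
-/
theorem sq_le_innerProd (hF : ∀ x y : Fin n → F, (∑ i, inner ℝ (x i) (y i)) ^ 2
      ≤ ∑ i, ∑ k, inner ℝ (x i * star (x k)) (y i * star (y k)))
    {P P' : ProjectiveSpaceModel F n} (h : 0 < P.diag 0) (h' : 0 < P'.diag 0) :
    (√(P.diag 0) * √(P'.diag 0) + ∑ i : Fin n, inner ℝ ((√(P.diag 0))⁻¹ • P.1 i.succ 0)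
      ((√(P'.diag 0))⁻¹ • P'.1 i.succ 0)) ^ 2 ≤ P.innerProd P' := by
  have hP := Real.sqrt_pos.2 h
  have hP' := Real.sqrt_pos.2 h'
  have hs := Real.sq_sqrt h.le
  have hs' := Real.sq_sqrt h'.le
  have hc := hF (fun i => (√(P.diag 0))⁻¹ • P.1 i.succ 0) fun i => (√(P'.diag 0))⁻¹ • P'.1 i.succ 0
  have hm : ∀ (R : ProjectiveSpaceModel F n), 0 < R.diag 0 → ∀ i k : Fin n,
      ((√(R.diag 0))⁻¹ • R.1 i.succ 0) * star ((√(R.diag 0))⁻¹ • R.1 k.succ 0)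
        = R.1 i.succ k.succ := fun R hR i k => by
    rw [IsCompAlg.star_smul', IsCompAlg.mul_smul, IsCompAlg.smul_mul, star_apply,
      mul_apply_apply, smul_smul, smul_smul, ← mul_inv, Real.mul_self_sqrt hR.le,
      inv_mul_cancel₀ hR.ne', one_smul]
  simp only [hm P h, hm P' h'] at hc
  have h00 : inner ℝ (P.1 0 0) (P'.1 0 0) = √(P.diag 0) ^ 2 * √(P'.diag 0) ^ 2 := by
    rw [P.apply_self, P'.apply_self, real_inner_smul_left, real_inner_smul_right,
      IsCompAlg.inner_one_one, hs, hs', mul_one]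
  have hi : ∀ i : Fin n, inner ℝ (P.1 i.succ 0) (P'.1 i.succ 0) = √(P.diag 0) * √(P'.diag 0) *
      inner ℝ ((√(P.diag 0))⁻¹ • P.1 i.succ 0) ((√(P'.diag 0))⁻¹ • P'.1 i.succ 0) := fun i => by
    rw [real_inner_smul_left, real_inner_smul_right]
    field_simp
  have hi' : ∀ i : Fin n, inner ℝ (P.1 0 i.succ) (P'.1 0 i.succ) = √(P.diag 0) * √(P'.diag 0) *
      inner ℝ ((√(P.diag 0))⁻¹ • P.1 i.succ 0) ((√(P'.diag 0))⁻¹ • P'.1 i.succ 0) := fun i => by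
    rw [← hi, ← star_apply, ← P'.star_apply, IsCompAlg.inner_star_star]
  rw [innerProd]
  simp only [Fin.sum_univ_succ (n := n), h00, hi, hi', Finset.sum_add_distrib, ← Finset.mul_sum]
  nlinarith [hc]

theorem theta_le_add_theta_basePoint (hF : ∀ x y : Fin n → F, (∑ i, inner ℝ (x i) (y i)) ^ 2
      ≤ ∑ i, ∑ k, inner ℝ (x i * star (x k)) (y i * star (y k)))
    (P P' : ProjectiveSpaceModel F n) :
    P.theta P' ≤ P.theta (basePoint F n) + P'.theta (basePoint F n) := by
  rw [theta_basePoint, theta_basePoint, theta]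
  have hA := Real.arccos_nonneg √(P.diag 0)
  have hB := Real.arccos_nonneg √(P'.diag 0)
  rcases le_or_gt (Real.pi / 2) (Real.arccos √(P.diag 0) + Real.arccos √(P'.diag 0)) with hAB | hAB
  · have := Real.arccos_le_pi_div_two.2 (Real.sqrt_nonneg (P.innerProd P'))
    linarith
  · have h : 0 < P.diag 0 :=
      Real.sqrt_pos.1 (Real.arccos_lt_pi_div_two.1 (by linarith))
    have h' : 0 < P'.diag 0 :=
      Real.sqrt_pos.1 (Real.arccos_lt_pi_div_two.1 (by linarith))
    have hsq := sq_le_innerProd hF h h'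
    have hin := (abs_le.1 (abs_sum_inner_le (fun i : Fin n => (√(P.diag 0))⁻¹ • P.1 i.succ 0)
      fun i => (√(P'.diag 0))⁻¹ • P'.1 i.succ 0)).1
    rw [P.sum_succ_norm_sq h, P'.sum_succ_norm_sq h'] at hin
    -- With `A`, `B` the half-distances to the base point, the first coordinates contribute `cos A
    -- cos B` to the real part, and Cauchy-Schwarz bounds the rest below by `-sin A sin B`.
    have hcos : Real.cos (Real.arccos √(P.diag 0) + Real.arccos √(P'.diag 0))
        ≤ √(P.innerProd P') := by
      rw [Real.cos_add, Real.sin_arccos, Real.sin_arccos, Real.sq_sqrt h.le, Real.sq_sqrt h'.le,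
        Real.cos_arccos (by linarith [Real.sqrt_nonneg (P.diag 0)])
          (Real.sqrt_le_one.2 (P.diag_le_one 0)),
        Real.cos_arccos (by linarith [Real.sqrt_nonneg (P'.diag 0)])
          (Real.sqrt_le_one.2 (P'.diag_le_one 0))]
      refine le_trans ?_ (Real.le_sqrt_of_sq_le hsq)
      linarith
    have := Real.arccos_le_arccos hcos
    rw [Real.arccos_cos (by linarith) (by linarith [Real.pi_pos])] at this
    linarith

theorem theta_triangle (hH : ∀ P : ProjectiveSpaceModel F n, Congruent P (basePoint F n))
    (hF : ∀ x y : Fin n → F, (∑ i, inner ℝ (x i) (y i)) ^ 2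
      ≤ ∑ i, ∑ k, inner ℝ (x i * star (x k)) (y i * star (y k)))
    (P R P' : ProjectiveSpaceModel F n) : P.theta P' ≤ P.theta R + R.theta P' := by
  obtain ⟨e, he⟩ := hH R
  have h := theta_le_add_theta_basePoint hF (e P) (e P')
  rw [← he] at h
  simp only [theta_eq_of_dist_eq (e.isometry.dist_eq _ _)] at h
  rwa [P'.theta_comm R] at h

end ProjectiveSpaceModel

/-! ### Hausdorff measure of annuli in charts -/

section Annuli

open Module Metric

theorem pow_sub_pow_le_mul {a b : ℝ} (ha : 0 ≤ a) (hab : a ≤ b) (k : ℕ) :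
    b ^ (k + 1) - a ^ (k + 1) ≤ (k + 1) * (b ^ k * (b - a)) := by
  induction k with
  | zero => simp
  | succ k ih =>
    have h1 : a ^ (k + 1) ≤ b ^ (k + 1) := pow_le_pow_left₀ ha hab _
    have h2 := mul_le_mul_of_nonneg_left ih (ha.trans hab)
    have h3 := mul_le_mul_of_nonneg_right h1 (sub_nonneg.2 hab)
    push_cast
    calc b ^ (k + 1 + 1) - a ^ (k + 1 + 1)
        = b * (b ^ (k + 1) - a ^ (k + 1)) + a ^ (k + 1) * (b - a) := by ring
      _ ≤ b * ((k + 1) * (b ^ k * (b - a))) + b ^ (k + 1) * (b - a) := add_le_add h2 h3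
      _ = _ := by ring

theorem LinearMap.exists_prod_equiv {E F : Type*} [AddCommGroup E] [Module ℝ E] [AddCommGroup F]
    [Module ℝ F] (p : E →ₗ[ℝ] F) (hp : Function.Surjective p) :
    ∃ e : E ≃ₗ[ℝ] F × p.ker, ∀ v, (e v).1 = p v := by
  obtain ⟨q, hq⟩ := LinearMap.exists_leftInverse_of_injective p.ker.subtype
    (LinearMap.ker_eq_bot.2 Subtype.val_injective)
  have hq' : ∀ w : p.ker, q w = w := fun w => LinearMap.congr_fun hq w
  refine ⟨LinearEquiv.ofBijective (p.prod q) ⟨?_, ?_⟩, fun v => rfl⟩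
  · rw [← LinearMap.ker_eq_bot, LinearMap.ker_eq_bot']
    intro v hv
    have h1 : p v = 0 := congrArg Prod.fst hv
    have h2 : q v = 0 := congrArg Prod.snd hv
    have := hq' ⟨v, h1⟩
    rw [h2] at this
    exact (congrArg Subtype.val this).symm
  · rintro ⟨f, w⟩
    obtain ⟨v, rfl⟩ := hp f
    refine ⟨v - (q v : E) + w, Prod.ext ?_ ?_⟩
    · simp
    · simp [hq']

variable {E F : Type*} [NormedAddCommGroup E] [NormedSpace ℝ E] [FiniteDimensional ℝ E]
  [NormedAddCommGroup F] [NormedSpace ℝ F] [FiniteDimensional ℝ F]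

/-- Split `E` as `F × ker p`. Hausdorff measure in the top dimension is a Haar measure, hence a
multiple of the product of Haar measures, and the set lies in an annulus of `F` times a ball of the
kernel. -/
theorem hausdorffMeasure_annulus_le [MeasurableSpace E] [BorelSpace E] (p : E →ₗ[ℝ] F)
    (hp : Function.Surjective p) (hF : 0 < finrank ℝ F) :
    ∃ C : ℝ, 0 ≤ C ∧ ∀ a b, 0 ≤ a → a ≤ b →
      Measure.hausdorffMeasure (finrank ℝ E) {v : E | ‖v‖ ≤ 1 ∧ a ≤ ‖p v‖ ∧ ‖p v‖ ≤ b}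
        ≤ ENNReal.ofReal (C * (b ^ (finrank ℝ F - 1) * (b - a))) := by
  borelize F
  obtain ⟨e, he⟩ := p.exists_prod_equiv hp
  let e' := e.toContinuousLinearEquiv
  have : Nontrivial F := finrank_pos_iff.1 hF
  let ν : Measure E := ((Measure.addHaar (G := F)).prod (Measure.addHaar (G := p.ker))).map e'.symm
  have hν : ν.IsAddHaarMeasure := e'.symm.isAddHaarMeasure_map _
  let c : ENNReal := Measure.addHaarScalarFactor (Measure.hausdorffMeasure (finrank ℝ E)) ν
  have hc : c ≠ ⊤ := ENNReal.coe_ne_top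
  have hμ : (Measure.hausdorffMeasure (finrank ℝ E) : Measure E) = c • ν :=
    Measure.isAddLeftInvariant_eq_smul _ ν
  obtain ⟨R, hR⟩ : ∃ R, ∀ v : E, ‖v‖ ≤ 1 → ‖(e' v).2‖ ≤ R := by
    refine ⟨‖(e' : E →L[ℝ] F × p.ker)‖, fun v hv => (norm_snd_le _).trans ?_⟩
    exact ((e' : E →L[ℝ] F × p.ker).le_opNorm v).trans (mul_le_of_le_one_right (norm_nonneg _) hv)
  let m : ENNReal := c * (Measure.addHaar (ball (0 : F) 1) *
    Measure.addHaar (closedBall (0 : p.ker) R))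
  have hm : m ≠ ⊤ := ENNReal.mul_ne_top hc (ENNReal.mul_ne_top measure_ball_lt_top.ne
    measure_closedBall_lt_top.ne)
  refine ⟨m.toReal * finrank ℝ F, by positivity, fun a b ha hab => ?_⟩
  have hsub : e'.symm ⁻¹' {v : E | ‖v‖ ≤ 1 ∧ a ≤ ‖p v‖ ∧ ‖p v‖ ≤ b}
      ⊆ (closedBall (0 : F) b \ ball 0 a) ×ˢ closedBall (0 : p.ker) R := by
    rintro ⟨f, w⟩ ⟨h1, h2, h3⟩
    have hpe : p (e'.symm (f, w)) = f := by
      rw [← he]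
      exact congrArg Prod.fst (e'.apply_symm_apply (f, w))
    rw [hpe] at h2 h3
    have h4 := hR _ h1
    rw [e'.apply_symm_apply] at h4
    simpa [h2, h3] using h4
  have hann : Measure.addHaar (closedBall (0 : F) b \ ball 0 a)
      ≤ ENNReal.ofReal (finrank ℝ F * (b ^ (finrank ℝ F - 1) * (b - a)))
        * Measure.addHaar (ball (0 : F) 1) := by
    rw [measure_sdiff (ball_subset_closedBall.trans (closedBall_subset_closedBall hab))
      measurableSet_ball.nullMeasurableSet measure_ball_lt_top.ne,
      Measure.addHaar_closedBall _ _ (ha.trans hab), Measure.addHaar_ball _ _ ha,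
      ← ENNReal.sub_mul (fun _ _ => measure_ball_lt_top.ne), ← ENNReal.ofReal_sub _ (by positivity)]
    gcongr
    obtain ⟨k, hk⟩ : ∃ k, finrank ℝ F = k + 1 := ⟨_, (Nat.succ_pred_eq_of_pos hF).symm⟩
    rw [hk]
    push_cast
    exact pow_sub_pow_le_mul ha hab k
  calc (Measure.hausdorffMeasure (finrank ℝ E) : Measure E)
        {v : E | ‖v‖ ≤ 1 ∧ a ≤ ‖p v‖ ∧ ‖p v‖ ≤ b}
      = c * ((Measure.addHaar (G := F)).prod (Measure.addHaar (G := p.ker)))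
          (e'.symm ⁻¹' {v : E | ‖v‖ ≤ 1 ∧ a ≤ ‖p v‖ ∧ ‖p v‖ ≤ b}) := by
        rw [hμ, Measure.smul_apply, smul_eq_mul]
        exact congrArg _ (e'.symm.toHomeomorph.toMeasurableEquiv.map_apply _)
    _ ≤ c * ((Measure.addHaar (closedBall (0 : F) b \ ball 0 a))
          * Measure.addHaar (closedBall (0 : p.ker) R)) := by
        gcongr
        exact (measure_mono hsub).trans_eq (Measure.prod_prod _ _)
    _ ≤ c * (ENNReal.ofReal (finrank ℝ F * (b ^ (finrank ℝ F - 1) * (b - a)))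
        * Measure.addHaar (ball (0 : F) 1) * Measure.addHaar (closedBall (0 : p.ker) R)) := by
        gcongr
    _ = ENNReal.ofReal (finrank ℝ F * (b ^ (finrank ℝ F - 1) * (b - a))) * m := by ring
    _ = _ := by
        rw [← ENNReal.ofReal_toReal hm, mul_comm, ← ENNReal.ofReal_mul ENNReal.toReal_nonneg,
          ENNReal.toReal_ofReal ENNReal.toReal_nonneg, mul_assoc]

/-- The isometric embedding `ι` preserves Hausdorff measure, so the chart `Φ` may take values in the
ambient space `Y`; it costs the factor `K ^ d`. -/
theorem hausdorffMeasure_le_of_chart {X Y : Type*} [MetricSpace X] [MeasurableSpace X]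
    [BorelSpace X] [MetricSpace Y] {d : ℕ} (hd : finrank ℝ E = d) {ι : X → Y} (hι : Isometry ι)
    {Φ : E → Y} {ρ : ℝ} (hρ : ρ ≤ 1) (hΦ : ∃ K, LipschitzOnWith K Φ (closedBall 0 ρ))
    (p : E →ₗ[ℝ] F) (hp : Function.Surjective p) (hF : 0 < finrank ℝ F) :
    ∃ C : ℝ, 0 ≤ C ∧ ∀ a b, 0 ≤ a → a ≤ b → ∀ S : Set X,
      (∀ x ∈ S, ∃ v, ‖v‖ ≤ ρ ∧ Φ v = ι x ∧ a ≤ ‖p v‖ ∧ ‖p v‖ ≤ b) →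
        Measure.hausdorffMeasure d S
          ≤ ENNReal.ofReal (C * (b ^ (finrank ℝ F - 1) * (b - a))) := by
  borelize E Y
  subst hd
  obtain ⟨C, hC, h⟩ := hausdorffMeasure_annulus_le p hp hF
  obtain ⟨K, hK⟩ := hΦ
  refine ⟨(K ^ finrank ℝ E : NNReal) * C, by positivity, fun a b ha hab S hS => ?_⟩
  have hsub : ι '' S ⊆ Φ '' ({v : E | ‖v‖ ≤ 1 ∧ a ≤ ‖p v‖ ∧ ‖p v‖ ≤ b} ∩ closedBall 0 ρ) := by
    rintro _ ⟨x, hx, rfl⟩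
    obtain ⟨v, h1, h2, h3, h4⟩ := hS x hx
    exact ⟨v, ⟨⟨h1.trans hρ, h3, h4⟩, by simpa using h1⟩, h2⟩
  calc Measure.hausdorffMeasure (finrank ℝ E) S
      = Measure.hausdorffMeasure (finrank ℝ E) (ι '' S) :=
        (hι.hausdorffMeasure_image (Or.inl (Nat.cast_nonneg _)) S).symm
    _ ≤ _ := measure_mono hsub
    _ ≤ _ := (hK.mono Set.inter_subset_right).hausdorffMeasure_image_le (Nat.cast_nonneg _)
    _ ≤ (K : ENNReal) ^ (finrank ℝ E : ℝ) *
          ENNReal.ofReal (C * (b ^ (finrank ℝ F - 1) * (b - a))) := by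
        gcongr
        exact (measure_mono Set.inter_subset_left).trans (h a b ha hab)
    _ = _ := by
        rw [mul_assoc, ENNReal.ofReal_mul (NNReal.coe_nonneg _), ENNReal.ofReal_coe_nnreal,
          ENNReal.rpow_natCast, ENNReal.coe_pow]

/-- A null set cannot have a Lipschitz image that contains a ball. -/
theorem hausdorffMeasure_univ_pos {X : Type*} [MetricSpace X] [MeasurableSpace X] [BorelSpace X]
    {d : ℕ} (hd : finrank ℝ E = d) {ψ : X → E} {K : NNReal} (hψ : LipschitzWith K ψ) {r : ℝ}
    (hr : 0 < r) (hrange : ball 0 r ⊆ Set.range ψ) :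
    0 < Measure.hausdorffMeasure (d : ℝ) (Set.univ : Set X) := by
  borelize E
  subst hd
  refine pos_iff_ne_zero.2 fun h => ?_
  have h1 := hψ.hausdorffMeasure_image_le (d := finrank ℝ E) (Nat.cast_nonneg _) Set.univ
  rw [h, mul_zero, Set.image_univ] at h1
  exact (measure_ball_pos (Measure.hausdorffMeasure (finrank ℝ E) : Measure E) (0 : E) hr).ne'
    (le_antisymm ((measure_mono hrange).trans h1) zero_le)

end Annuli

/-! ### The common properties of the two-point homogeneous spaces -/

theorem sin_sub_sin_le_sub {x y : ℝ} (h : x ≤ y) : Real.sin y - Real.sin x ≤ y - x := by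
  rw [Real.sin_sub_sin]
  have h1 : Real.sin ((y - x) / 2) ≤ (y - x) / 2 := Real.sin_le (by linarith)
  have h2 : -((y - x) / 2) ≤ Real.sin ((y - x) / 2) := by
    have := Real.abs_sin_le_abs (x := (y - x) / 2)
    rw [abs_of_nonneg (a := (y - x) / 2) (by linarith)] at this
    exact (abs_le.1 this).1
  have h3 := Real.cos_le_one ((y + x) / 2)
  have h4 := Real.neg_one_le_cos ((y + x) / 2)
  nlinarith

theorem cos_sub_cos_le_sub {x y : ℝ} (h : x ≤ y) : Real.cos x - Real.cos y ≤ y - x := by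
  rw [← Real.sin_pi_div_two_sub, ← Real.sin_pi_div_two_sub y]
  exact (sin_sub_sin_le_sub (by linarith)).trans_eq (by ring)

/-- The metric and measure-theoretic properties of a compact two-point homogeneous space `X` with
the geodesic metric `θ` that are used in the proof of the discrepancy bounds: homogeneity, and the
bounds for the Hausdorff measure of the spherical shells about one point. -/
structure IsTwoPointHomogeneous (X : Type) [MetricSpace X] [MeasurableSpace X] [BorelSpace X]
    (θ : X → X → ℝ) (d d₀ : ℕ) : Prop where
  one_le_dim : 1 ≤ d
  one_le_dim₀ : 1 ≤ d₀
  secondCountable : SecondCountableTopology X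
  continuous_theta : Continuous (Function.uncurry θ)
  nonneg : ∀ x y, 0 ≤ θ x y
  le_pi : ∀ x y, θ x y ≤ Real.pi
  comm : ∀ x y, θ x y = θ y x
  triangle : ∀ x y z, θ x z ≤ θ x y + θ y z
  theta_congr : ∀ x y x' y', dist x y = dist x' y' → θ x y = θ x' y'
  homogeneous : ∀ x y, ∃ e : X ≃ᵢ X, e x = y
  hausdorffMeasure_pos : 0 < Measure.hausdorffMeasure (d : ℝ) (Set.univ : Set X)
  shells : ∃ o : X,
    (∃ C : ℝ, 0 ≤ C ∧ ∀ a b, 0 ≤ a → a ≤ b → b ≤ Real.pi / 2 →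
      Measure.hausdorffMeasure d {x | a ≤ θ x o ∧ θ x o ≤ b}
        ≤ ENNReal.ofReal (C * (Real.sin (b / 2) ^ (d - 1) * (b - a)))) ∧
    (∃ C : ℝ, 0 ≤ C ∧ ∀ a b, Real.pi / 2 ≤ a → a ≤ b → a ≤ Real.pi →
      Measure.hausdorffMeasure d {x | a ≤ θ x o ∧ θ x o ≤ b}
        ≤ ENNReal.ofReal (C * (Real.cos (a / 2) ^ (d₀ - 1) * (b - a))))

theorem shell_near_of_chart {X : Type} [MetricSpace X] [MeasurableSpace X] [BorelSpace X]
    {f : X → ℝ} (hf : ∀ x, 0 ≤ f x) {d : ℕ} {E Y : Type*} [NormedAddCommGroup E] [NormedSpace ℝ E]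
    [FiniteDimensional ℝ E] [MetricSpace Y] (hd : Module.finrank ℝ E = d) (hd1 : 1 ≤ d)
    {ι : X → Y} (hι : Isometry ι) {Φ : E → Y} {ρ : ℝ} (hρ : ρ ≤ 1)
    (hΦ : ∃ K, LipschitzOnWith K Φ (Metric.closedBall 0 ρ))
    (h : ∀ x, f x ≤ Real.pi / 2 → ∃ v, ‖v‖ ≤ ρ ∧ Φ v = ι x ∧ ‖v‖ = Real.sin (f x / 2)) :
    ∃ C : ℝ, 0 ≤ C ∧ ∀ a b, 0 ≤ a → a ≤ b → b ≤ Real.pi / 2 →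
      Measure.hausdorffMeasure d {x | a ≤ f x ∧ f x ≤ b}
        ≤ ENNReal.ofReal (C * (Real.sin (b / 2) ^ (d - 1) * (b - a))) := by
  obtain ⟨C, hC, hs⟩ := hausdorffMeasure_le_of_chart hd hι hρ hΦ LinearMap.id
    Function.surjective_id (by omega)
  rw [hd] at hs
  refine ⟨C, hC, fun a b ha hab hb => ?_⟩
  have hpi := Real.pi_pos
  have hmono : ∀ s t, 0 ≤ s → s ≤ t → t ≤ Real.pi / 2 → Real.sin (s / 2) ≤ Real.sin (t / 2) :=
    fun s t h0 hst ht => Real.sin_le_sin_of_le_of_le_pi_div_two (by linarith) (by linarith)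
      (by linarith)
  have hb0 : 0 ≤ Real.sin (b / 2) := Real.sin_nonneg_of_nonneg_of_le_pi (by linarith) (by linarith)
  refine (hs (Real.sin (a / 2)) (Real.sin (b / 2))
    (Real.sin_nonneg_of_nonneg_of_le_pi (by linarith) (by linarith)) (hmono a b ha hab hb) _
    fun x hx => ?_).trans ?_
  · obtain ⟨v, h1, h2, h3⟩ := h x (hx.2.trans hb)
    refine ⟨v, h1, h2, ?_⟩
    rw [LinearMap.id_apply, h3]
    exact ⟨hmono _ _ ha hx.1 (hx.2.trans hb), hmono _ _ (hf x) hx.2 hb⟩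
  · have hsin : Real.sin (b / 2) - Real.sin (a / 2) ≤ b - a :=
      (sin_sub_sin_le_sub (by linarith)).trans (by linarith)
    gcongr

/-- In a chart the points at distance `π` form the kernel of `p`, of codimension `d₀`; hence the
exponent `d₀ - 1`. One chart need not reach all of them, so a finite family is used and the
constants are added. -/
theorem shell_far_of_charts {X : Type} [MetricSpace X] [MeasurableSpace X] [BorelSpace X]
    {f : X → ℝ} (hf : ∀ x, f x ≤ Real.pi) {d d₀ : ℕ} {J : Type*} [Fintype J] {E : J → Type*}
    {F Y : Type*} [∀ j, NormedAddCommGroup (E j)] [∀ j, NormedSpace ℝ (E j)]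
    [∀ j, FiniteDimensional ℝ (E j)] [NormedAddCommGroup F] [NormedSpace ℝ F]
    [FiniteDimensional ℝ F] [MetricSpace Y] (hd : ∀ j, Module.finrank ℝ (E j) = d)
    (hd₀ : Module.finrank ℝ F = d₀) (hd1 : 1 ≤ d₀)
    {ι : X → Y} (hι : Isometry ι) {Φ : ∀ j, E j → Y} {ρ : ℝ} (hρ : ρ ≤ 1)
    (hΦ : ∀ j, ∃ K, LipschitzOnWith K (Φ j) (Metric.closedBall 0 ρ)) (p : ∀ j, E j →ₗ[ℝ] F)
    (hp : ∀ j, Function.Surjective (p j))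
    (h : ∀ x, Real.pi / 2 ≤ f x →
      ∃ j v, ‖v‖ ≤ ρ ∧ Φ j v = ι x ∧ ‖p j v‖ = Real.cos (f x / 2)) :
    ∃ C : ℝ, 0 ≤ C ∧ ∀ a b, Real.pi / 2 ≤ a → a ≤ b → a ≤ Real.pi →
      Measure.hausdorffMeasure d {x | a ≤ f x ∧ f x ≤ b}
        ≤ ENNReal.ofReal (C * (Real.cos (a / 2) ^ (d₀ - 1) * (b - a))) := by
  choose C hC hs using fun j => hausdorffMeasure_le_of_chart (hd j) hι hρ (hΦ j) (p j) (hp j)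
    (by omega)
  rw [hd₀] at hs
  refine ⟨∑ j, C j, Finset.sum_nonneg fun j _ => hC j, fun a b ha hab hpia => ?_⟩
  have hpi := Real.pi_pos
  have hmono : ∀ s t, 0 ≤ s → s ≤ t → t ≤ Real.pi → Real.cos (t / 2) ≤ Real.cos (s / 2) :=
    fun s t h0 hst ht => Real.cos_le_cos_of_nonneg_of_le_pi (by linarith) (by linarith)
      (by linarith)
  have ha0 : 0 ≤ Real.cos (a / 2) :=
    Real.cos_nonneg_of_neg_pi_div_two_le_of_le (by linarith) (by linarith)
  -- The outer radius may exceed `π`, as it does later for `b = r + θ(y₁, y₂)`, and the cosine is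
  -- monotone only up to `π`.
  have ham : a ≤ min b Real.pi := le_min hab hpia
  have hmp : min b Real.pi ≤ Real.pi := min_le_right _ _
  have hmb : min b Real.pi ≤ b := min_le_left _ _
  have hsub : {x | a ≤ f x ∧ f x ≤ b} ⊆ ⋃ j, {x | a ≤ f x ∧ f x ≤ b ∧
      ∃ v, ‖v‖ ≤ ρ ∧ Φ j v = ι x ∧ ‖p j v‖ = Real.cos (f x / 2)} := fun x hx =>
    Set.mem_iUnion.2 ((h x (ha.trans hx.1)).imp fun j hj => ⟨hx.1, hx.2, hj⟩)
  calc _ ≤ ∑ j, Measure.hausdorffMeasure d {x | a ≤ f x ∧ f x ≤ b ∧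
      ∃ v, ‖v‖ ≤ ρ ∧ Φ j v = ι x ∧ ‖p j v‖ = Real.cos (f x / 2)} :=
        (measure_mono hsub).trans (measure_iUnion_fintype_le _ _)
    _ ≤ ∑ j, ENNReal.ofReal (C j * (Real.cos (a / 2) ^ (d₀ - 1) * (b - a))) := by
        gcongr with j
        refine (hs j (Real.cos (min b Real.pi / 2)) (Real.cos (a / 2))
          (Real.cos_nonneg_of_neg_pi_div_two_le_of_le (by linarith) (by linarith))
          (hmono _ _ (by linarith) ham hmp) _ ?_).trans ?_
        · rintro x ⟨h1, h2, v, h3, h4, h5⟩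
          refine ⟨v, h3, h4, ?_⟩
          rw [h5]
          exact ⟨hmono _ _ (by linarith) (le_min h2 (hf x)) hmp, hmono _ _ (by linarith) h1 (hf x)⟩
        · have hcos : Real.cos (a / 2) - Real.cos (min b Real.pi / 2) ≤ b - a :=
            (cos_sub_cos_le_sub (by linarith)).trans (by linarith)
          have := hC j
          gcongr
    _ = _ := by
        rw [← ENNReal.ofReal_sum_of_nonneg fun j _ => mul_nonneg (hC j)
          (mul_nonneg (pow_nonneg ha0 _) (by linarith)), Finset.sum_mul]

/-! ### Affine charts and shells of the projective spaces -/

namespace ProjectiveSpaceModel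

variable {F : Type} [NormedAddCommGroup F] [InnerProductSpace ℝ F] [Mul F] [One F] [Star F]
  {n : ℕ}

/-- The entries of a projector as a vector of a Euclidean space. -/
noncomputable def toPiLp (P : ProjectiveSpaceModel F n) : PiLp 2 fun _ : Fin (n + 1) × Fin (n + 1) => F :=
  WithLp.toLp 2 fun q => P.1 q.1 q.2

theorem isometry_toPiLp : Isometry (toPiLp : ProjectiveSpaceModel F n → _) :=
  Isometry.of_dist_eq fun P P' => by
    rw [← sq_eq_sq₀ dist_nonneg dist_nonneg, PiLp.dist_sq_eq_of_L2, dist_sq,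
      Fintype.sum_prod_type]
    simp only [toPiLp, dist_eq_norm]

/-- The homogeneous coordinates, the `j`-th one being positive. -/
noncomputable def chartVec (j : Fin (n + 1)) (v : PiLp 2 fun _ : {i // i ≠ j} => F) (i : Fin (n + 1)) : F :=
  if h : i = j then √(1 - ‖v‖ ^ 2) • 1 else v ⟨i, h⟩

/-- The affine chart. -/
noncomputable def chart (j : Fin (n + 1)) (v : PiLp 2 fun _ : {i // i ≠ j} => F) :
    PiLp 2 fun _ : Fin (n + 1) × Fin (n + 1) => F :=
  WithLp.toLp 2 fun q => chartVec j v q.1 * star (chartVec j v q.2)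

variable [IsCompAlg F] [FiniteDimensional ℝ F]

theorem exists_lipschitzOnWith_chart (j : Fin (n + 1)) {ρ : ℝ} (h1 : ρ < 1) :
    ∃ K, LipschitzOnWith K (chart (F := F) j) (Metric.closedBall 0 ρ) := by
  have hvec : ∀ i, ContDiffOn ℝ 1 (fun v => chartVec (F := F) j v i) (Metric.closedBall 0 ρ) := by
    intro i
    by_cases h : i = j
    · simp only [chartVec, h, dite_true]
      refine ContDiffOn.smul (ContDiffOn.sqrt ?_ fun v hv => ?_) contDiffOn_const
      · exact (contDiff_const.sub (contDiff_norm_sq ℝ)).contDiffOn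
      · have hv1 : ‖v‖ < 1 := (mem_closedBall_zero_iff.1 hv).trans_lt h1
        have : ‖v‖ ^ 2 < 1 := pow_lt_one₀ (norm_nonneg _) hv1 two_ne_zero
        linarith
    · simp only [chartVec, h, dite_false]
      exact (contDiff_piLp_apply 2).contDiffOn
  refine ContDiffOn.exists_lipschitzOnWith (n := 1) ?_ one_ne_zero (convex_closedBall _ _)
    (isCompact_closedBall _ _)
  refine contDiffOn_piLp' 2 fun q => ?_
  have hstar : ContDiffOn ℝ 1 (fun v => star (chartVec (F := F) j v q.2))
      (Metric.closedBall 0 ρ) :=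
    (IsCompAlg.starL F).toContinuousLinearMap.contDiff.comp_contDiffOn (hvec q.2)
  exact (((IsCompAlg.mulL F).toContinuousBilinearMap.contDiff.comp_contDiffOn
    (hvec q.1)).clm_apply hstar)

/-- The coordinates are `P.1 i j / √(P.diag j)`. For `j = 0` the norm of `v` is `sin(θ/2)`; for `j ≠
0` the norm of its coordinate `0` is `cos(θ/2)`, with `θ` the distance to the base point. -/
theorem exists_chart_eq (P : ProjectiveSpaceModel F n) {j : Fin (n + 1)} (h : 0 < P.diag j) :
    ∃ v : PiLp 2 fun _ : {i // i ≠ j} => F, chart j v = P.toPiLp ∧ ‖v‖ = √(1 - P.diag j) ∧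
      ∀ i, ‖v i‖ = √(P.diag i) := by
  have hj := Real.sqrt_pos.2 h
  have hjs := Real.sq_sqrt h.le
  have hn : ∀ i, ‖(√(P.diag j))⁻¹ • P.1 i j‖ = √(P.diag i) := fun i => by
    rw [norm_smul, norm_apply, Real.sqrt_mul (P.diag_nonneg i), norm_inv,
      Real.norm_of_nonneg hj.le]
    field_simp
  let v : PiLp 2 fun _ : {i // i ≠ j} => F := WithLp.toLp 2 fun i => (√(P.diag j))⁻¹ • P.1 i j
  have hv : ‖v‖ ^ 2 = 1 - P.diag j := by
    rw [PiLp.norm_sq_eq_of_L2]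
    simp only [v, hn, Real.sq_sqrt (P.diag_nonneg _)]
    rw [← P.sum_diag, ← Finset.add_sum_erase _ _ (Finset.mem_univ j), add_sub_cancel_left]
    exact (Finset.sum_subtype _ (fun i => by simp) _).symm
  have hc : ∀ i, chartVec j v i = (√(P.diag j))⁻¹ • P.1 i j := fun i => by
    by_cases hij : i = j
    · rw [chartVec, dif_pos hij, hij, P.apply_self, hv, sub_sub_cancel, smul_smul]
      congr 1
      rw [eq_inv_mul_iff_mul_eq₀ hj.ne', ← sq, hjs]
    · rw [chartVec, dif_neg hij]
  refine ⟨v, ?_, ?_, fun i => hn i⟩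
  · ext q
    simp only [chart, toPiLp, hc]
    rw [IsCompAlg.star_smul', IsCompAlg.mul_smul, IsCompAlg.smul_mul, star_apply,
      mul_apply_apply, smul_smul, smul_smul, ← mul_inv, ← sq, hjs, inv_mul_cancel₀ h.ne', one_smul]
  · rw [← hv, Real.sqrt_sq (norm_nonneg _)]

theorem cos_half_theta_basePoint (P : ProjectiveSpaceModel F n) :
    Real.cos (P.theta (basePoint F n) / 2) = √(P.diag 0) := by
  rw [theta_basePoint, mul_div_cancel_left₀ _ two_ne_zero, Real.cos_arccos
    (by linarith [Real.sqrt_nonneg (P.diag 0)]) (Real.sqrt_le_one.2 (P.diag_le_one 0))]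

theorem sin_half_theta_basePoint (P : ProjectiveSpaceModel F n) :
    Real.sin (P.theta (basePoint F n) / 2) = √(1 - P.diag 0) := by
  rw [theta_basePoint, mul_div_cancel_left₀ _ two_ne_zero, Real.sin_arccos,
    Real.sq_sqrt (P.diag_nonneg 0)]

theorem half_le_diag_of_theta_le {P : ProjectiveSpaceModel F n}
    (h : P.theta (basePoint F n) ≤ Real.pi / 2) : 1 / 2 ≤ P.diag 0 := by
  have h1 := theta_nonneg P (basePoint F n)
  have h2 := Real.cos_le_cos_of_nonneg_of_le_pi (x := P.theta (basePoint F n) / 2)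
    (y := Real.pi / 4) (by linarith) (by linarith [Real.pi_pos]) (by linarith)
  rw [cos_half_theta_basePoint, Real.cos_pi_div_four] at h2
  have h3 := pow_le_pow_left₀ (by positivity) h2 2
  rw [Real.sq_sqrt (P.diag_nonneg 0), div_pow, Real.sq_sqrt zero_le_two] at h3
  linarith

theorem diag_le_half_of_le_theta {P : ProjectiveSpaceModel F n}
    (h : Real.pi / 2 ≤ P.theta (basePoint F n)) : P.diag 0 ≤ 1 / 2 := by
  have h1 := theta_le_pi P (basePoint F n)
  have h2 := Real.cos_le_cos_of_nonneg_of_le_pi (y := P.theta (basePoint F n) / 2)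
    (x := Real.pi / 4) (by linarith [Real.pi_pos]) (by linarith [Real.pi_pos]) (by linarith)
  rw [cos_half_theta_basePoint, Real.cos_pi_div_four] at h2
  have h3 := pow_le_pow_left₀ (by positivity) h2 2
  rw [Real.sq_sqrt (P.diag_nonneg 0), div_pow, Real.sq_sqrt zero_le_two] at h3
  linarith

variable (F) in
theorem finrank_chart (j : Fin (n + 1)) :
    Module.finrank ℝ (PiLp 2 fun _ : {i // i ≠ j} => F) = n * Module.finrank ℝ F := by
  rw [(WithLp.linearEquiv 2 ℝ ({i // i ≠ j} → F)).finrank_eq, Module.finrank_pi_fintype]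
  simp

theorem nontrivial_of_isCompAlg : Nontrivial F :=
  ⟨⟨1, 0, fun h => by
    have := IsCompAlg.norm_one (F := F)
    rw [h, norm_zero] at this
    exact zero_ne_one this⟩⟩

/-- Pigeonhole: the other diagonal entries add up to at least `1/2`, while `n / (2n + 2) < 1/2`. The
lower bound keeps the far charts inside a fixed ball of radius less than one. -/
theorem exists_diag_ge {P : ProjectiveSpaceModel F n} (h : P.diag 0 ≤ 1 / 2) :
    ∃ j : {j : Fin (n + 1) // j ≠ 0}, 1 / (2 * n + 2) ≤ P.diag j := by
  by_contra! hlt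
  have hs := P.sum_diag
  rw [Fin.sum_univ_succ] at hs
  have : ∑ i : Fin n, P.diag i.succ ≤ ∑ i : Fin n, (1 : ℝ) / (2 * n + 2) :=
    Finset.sum_le_sum fun i _ => (hlt ⟨i.succ, i.succ_ne_zero⟩).le
  rw [Finset.sum_const, Finset.card_univ, Fintype.card_fin, nsmul_eq_mul] at this
  have h2 : (n : ℝ) * (1 / (2 * n + 2)) < 1 / 2 := by
    rw [mul_one_div, div_lt_div_iff₀ (by positivity) (by positivity)]
    linarith
  linarith

theorem shells_basePoint [MeasurableSpace (ProjectiveSpaceModel F n)]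
    [BorelSpace (ProjectiveSpaceModel F n)] (hn : 1 ≤ n) :
    (∃ C : ℝ, 0 ≤ C ∧ ∀ a b, 0 ≤ a → a ≤ b → b ≤ Real.pi / 2 →
      Measure.hausdorffMeasure (n * Module.finrank ℝ F : ℕ)
          {x : ProjectiveSpaceModel F n | a ≤ x.theta (basePoint F n) ∧
            x.theta (basePoint F n) ≤ b}
        ≤ ENNReal.ofReal (C * (Real.sin (b / 2) ^ (n * Module.finrank ℝ F - 1) * (b - a)))) ∧
    (∃ C : ℝ, 0 ≤ C ∧ ∀ a b, Real.pi / 2 ≤ a → a ≤ b → a ≤ Real.pi →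
      Measure.hausdorffMeasure (n * Module.finrank ℝ F : ℕ)
          {x : ProjectiveSpaceModel F n | a ≤ x.theta (basePoint F n) ∧
            x.theta (basePoint F n) ≤ b}
        ≤ ENNReal.ofReal (C * (Real.cos (a / 2) ^ (Module.finrank ℝ F - 1) * (b - a)))) := by
  have : Nontrivial F := nontrivial_of_isCompAlg
  have hF : 1 ≤ Module.finrank ℝ F := Module.finrank_pos
  constructor
  · refine shell_near_of_chart (fun x => x.theta_nonneg _) (finrank_chart F 0) (Nat.mul_pos hn hF)
      isometry_toPiLp (Φ := chart 0) (ρ := √(1 / 2)) (Real.sqrt_le_one.2 (by norm_num))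
      (exists_lipschitzOnWith_chart 0
        ((Real.sqrt_lt' one_pos).2 (by norm_num))) fun P hP => ?_
    have h := half_le_diag_of_theta_le hP
    obtain ⟨v, hv, hvn, -⟩ := P.exists_chart_eq (j := 0) (by linarith)
    refine ⟨v, ?_, hv, ?_⟩
    · rw [hvn]
      exact Real.sqrt_le_sqrt (by linarith)
    · rw [hvn, sin_half_theta_basePoint]
  · have hpos : (0 : ℝ) < 1 / (2 * n + 2) := by positivity
    refine shell_far_of_charts (fun x => x.theta_le_pi _) (J := {j : Fin (n + 1) // j ≠ 0})
      (E := fun j => PiLp 2 fun _ : {i // i ≠ j.1} => F) (fun j => finrank_chart F j.1) rfl hF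
      isometry_toPiLp (Φ := fun j => chart j.1) (ρ := √(1 - 1 / (2 * n + 2)))
      (Real.sqrt_le_one.2 (by linarith))
      (fun j => exists_lipschitzOnWith_chart j.1
        ((Real.sqrt_lt' one_pos).2 (by linarith)))
      -- Since `j ≠ 0`, the index `0` is among the affine coordinates of the chart `j`.
      (fun j => PiLp.projₗ 2 (fun _ => F) ⟨0, j.2.symm⟩)
      (fun j x => ⟨WithLp.toLp 2 fun _ => x, rfl⟩) fun P hP => ?_
    obtain ⟨j, hj⟩ := exists_diag_ge (diag_le_half_of_le_theta hP)
    obtain ⟨v, hv, hvn, hvi⟩ := P.exists_chart_eq (j := j.1) (hpos.trans_le hj)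
    refine ⟨j, v, ?_, hv, ?_⟩
    · rw [hvn]
      exact Real.sqrt_le_sqrt (by linarith)
    · rw [cos_half_theta_basePoint]
      exact hvi _

/-- The first column without its first entry. -/
noncomputable def firstColumn (P : ProjectiveSpaceModel F n) : PiLp 2 fun _ : {i : Fin (n + 1) // i ≠ 0} => F :=
  WithLp.toLp 2 fun i => P.1 i 0

theorem lipschitzWith_firstColumn :
    LipschitzWith 1 (firstColumn : ProjectiveSpaceModel F n → _) :=
  LipschitzWith.of_dist_le_mul fun P P' => by
    rw [NNReal.coe_one, one_mul, ← sq_le_sq₀ dist_nonneg dist_nonneg, PiLp.dist_sq_eq_of_L2,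
      dist_sq]
    simp only [firstColumn, dist_eq_norm]
    have h := Finset.sum_subtype (F := inferInstance) (Finset.univ.erase 0)
      (p := fun i : Fin (n + 1) => i ≠ 0) (by simp) fun i => ‖P.1 i 0 - P'.1 i 0‖ ^ 2
    rw [← h]
    refine (Finset.sum_le_sum_of_subset_of_nonneg (Finset.subset_univ _) fun _ _ _ => by
      positivity).trans (Finset.sum_le_sum fun i _ => ?_)
    exact Finset.single_le_sum (f := fun j => ‖P.1 i j - P'.1 i j‖ ^ 2) (fun _ _ => by positivity)
      (Finset.mem_univ 0)

/-- In the plane three distinct indices include `0`, where the coordinate is real, so each product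
involves only two nonreal elements and the cancellation rules suffice. -/
theorem exists_of_vector (hF : (∀ x y z : F, x * y * z = x * (y * z)) ∨ n = 2)
    (B : Fin (n + 1) → F) {c : ℝ} (h0 : B 0 = c • 1) (hB : ∑ i, ‖B i‖ ^ 2 = 1) :
    ∃ P : ProjectiveSpaceModel F n, ∀ i j, P.1 i j = B i * star (B j) := by
  refine ⟨ofRankOne (Matrix.of fun i j => B i * star (B j)) (fun i => ‖B i‖ ^ 2)
    (fun i j => ?_) (fun i => ?_) (fun i j => ?_) hB (fun i j k hij hik hjk => ?_),
    fun i j => rfl⟩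
  · simp only [Matrix.of_apply, IsCompAlg.star_mul', IsCompAlg.star_star']
  · simp only [Matrix.of_apply, IsCompAlg.mul_star_self']
  · simp only [Matrix.of_apply, IsCompAlg.norm_mul, IsCompAlg.norm_star', mul_pow]
  · simp only [Matrix.of_apply]
    rcases hF with hF | rfl
    · rw [hF, IsCompAlg.star_mul_mul, IsCompAlg.mul_smul]
    · have h3 : ∀ i j k : Fin 3, i ≠ j → i ≠ k → j ≠ k → i = 0 ∨ j = 0 ∨ k = 0 := by decide
      rcases h3 i j k hij hik hjk with rfl | rfl | rfl
      · rw [h0, IsCompAlg.smul_mul, IsCompAlg.one_mul, IsCompAlg.smul_mul, IsCompAlg.smul_mul,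
          IsCompAlg.one_mul, IsCompAlg.star_mul_mul, smul_comm]
      · rw [h0, IsCompAlg.star_smul', IsCompAlg.star_one', IsCompAlg.mul_smul, IsCompAlg.mul_smul,
          IsCompAlg.mul_smul, IsCompAlg.mul_one, IsCompAlg.mul_one, IsCompAlg.mul_star_mul_right,
          smul_comm]
      · rw [h0, IsCompAlg.star_smul', IsCompAlg.star_one', IsCompAlg.mul_smul, IsCompAlg.smul_mul,
          IsCompAlg.mul_one, IsCompAlg.smul_mul, IsCompAlg.mul_smul, IsCompAlg.one_mul, smul_smul,
          norm_smul, mul_pow, Real.norm_eq_abs, sq_abs, IsCompAlg.norm_one, one_pow, mul_one, sq]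

theorem ball_subset_range_firstColumn (hF : (∀ x y z : F, x * y * z = x * (y * z)) ∨ n = 2) :
    Metric.ball 0 (1 / 2) ⊆ Set.range (firstColumn : ProjectiveSpaceModel F n → _) := by
  intro b hb
  rw [mem_ball_zero_iff] at hb
  have ht : 0 ≤ 1 - 4 * ‖b‖ ^ 2 := by nlinarith [norm_nonneg b]
  -- The vector `(c, b / c)` has first column `b` below the corner, and it is a unit vector exactly
  -- under this equation, whose discriminant is nonnegative for `‖b‖ ≤ 1/2`.
  obtain ⟨c, hc0, hc⟩ : ∃ c : ℝ, 0 < c ∧ c ^ 2 * (1 - c ^ 2) = ‖b‖ ^ 2 := by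
    have h1 := Real.sqrt_nonneg (1 - 4 * ‖b‖ ^ 2)
    have h2 := Real.sq_sqrt ht
    refine ⟨√((1 + √(1 - 4 * ‖b‖ ^ 2)) / 2), Real.sqrt_pos.2 (by linarith), ?_⟩
    rw [Real.sq_sqrt (by linarith)]
    linarith
  obtain ⟨P, hP⟩ := exists_of_vector hF
    (fun i => if h : i = 0 then c • 1 else c⁻¹ • b ⟨i, h⟩) (c := c) (by simp) (by
      rw [← Finset.add_sum_erase _ _ (Finset.mem_univ 0)]
      have h := Finset.sum_subtype (F := inferInstance) (Finset.univ.erase (0 : Fin (n + 1)))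
        (p := fun i : Fin (n + 1) => i ≠ 0) (by simp)
        fun i => ‖(if h : i = 0 then c • 1 else c⁻¹ • b ⟨i, h⟩ : F)‖ ^ 2
      rw [h]
      have h' : ∀ i : {i : Fin (n + 1) // i ≠ 0},
          ‖(if h : i.1 = 0 then c • 1 else c⁻¹ • b ⟨i, h⟩ : F)‖ ^ 2 = (c ^ 2)⁻¹ * ‖b i‖ ^ 2 := by
        intro i
        rw [dif_neg i.2, norm_smul, mul_pow, norm_inv, Real.norm_of_nonneg hc0.le, inv_pow]
      simp only [h', ← Finset.mul_sum]
      rw [← PiLp.norm_sq_eq_of_L2, ← hc, dif_pos trivial, norm_smul, IsCompAlg.norm_one,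
        Real.norm_of_nonneg hc0.le]
      field_simp
      ring)
  refine ⟨P, ?_⟩
  ext i
  change P.1 i 0 = b i
  rw [hP, dif_neg i.2, dif_pos rfl, IsCompAlg.star_smul', IsCompAlg.star_one',
    IsCompAlg.mul_smul, IsCompAlg.mul_one, smul_smul, mul_inv_cancel₀ hc0.ne', one_smul]

theorem isTwoPointHomogeneous [MeasurableSpace (ProjectiveSpaceModel F n)]
    [BorelSpace (ProjectiveSpaceModel F n)] (hn : 1 ≤ n)
    (hF : (∀ x y z : F, x * y * z = x * (y * z)) ∨ n = 2) {d₀ : ℕ}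
    (hd₀ : Module.finrank ℝ F = d₀) :
    IsTwoPointHomogeneous (ProjectiveSpaceModel F n) theta (n * d₀) d₀ := by
  subst hd₀
  have : Nontrivial F := nontrivial_of_isCompAlg
  have hF1 : 1 ≤ Module.finrank ℝ F := Module.finrank_pos
  have hH : ∀ P : ProjectiveSpaceModel F n, Congruent P (basePoint F n) := by
    rcases hF with hF | rfl
    · exact congruent_basePoint_of_assoc hF
    · exact congruent_basePoint_of_plane
  have hsq : ∀ x y : Fin n → F, (∑ i, inner ℝ (x i) (y i)) ^ 2
      ≤ ∑ i, ∑ k, inner ℝ (x i * star (x k)) (y i * star (y k)) := by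
    rcases hF with hF | rfl
    · exact IsCompAlg.sq_sum_inner_le_of_assoc hF
    · exact IsCompAlg.sq_sum_inner_le_of_two
  exact
  { one_le_dim := Nat.mul_pos hn hF1
    one_le_dim₀ := hF1
    secondCountable := isometry_toPiLp.isEmbedding.secondCountableTopology
    continuous_theta := by
      simp only [Function.uncurry_def, theta, innerProd_eq]
      fun_prop
    nonneg := theta_nonneg
    le_pi := theta_le_pi
    comm := theta_comm
    triangle := theta_triangle hH hsq
    theta_congr := fun _ _ _ _ h => theta_eq_of_dist_eq h
    homogeneous := fun x y => by
      obtain ⟨e, he⟩ := hH x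
      obtain ⟨e', he'⟩ := hH y
      exact ⟨e.trans e'.symm, by rw [IsometryEquiv.trans_apply, he, ← he', e'.symm_apply_apply]⟩
    hausdorffMeasure_pos := hausdorffMeasure_univ_pos (finrank_chart F 0)
      lipschitzWith_firstColumn one_half_pos (ball_subset_range_firstColumn hF)
    shells := ⟨basePoint F n, shells_basePoint hn⟩ }

end ProjectiveSpaceModel

/-! ### The spheres -/

section Sphere

open InnerProductGeometry Module

variable {V : Type*} [NormedAddCommGroup V] [InnerProductSpace ℝ V]

theorem angle_eq_arccos_dist {u v : V} (hu : ‖u‖ = 1) (hv : ‖v‖ = 1) :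
    angle u v = Real.arccos (1 - dist u v ^ 2 / 2) := by
  rw [angle, hu, hv, mul_one, div_one, dist_eq_norm, norm_sub_sq_real, hu, hv]
  congr 1
  ring

/-- The chart of the sphere about the pole `s • o`, where `s = 1` or `s = -1`. -/
noncomputable def sphereChart (o : V) (s : ℝ) (v : (ℝ ∙ o)ᗮ) : V :=
  (s * (1 - 2 * ‖v‖ ^ 2)) • o + (2 * √(1 - ‖v‖ ^ 2)) • (v : V)

theorem exists_lipschitzOnWith_sphereChart [FiniteDimensional ℝ V] (o : V) (s : ℝ) {ρ : ℝ}
    (h1 : ρ < 1) : ∃ K, LipschitzOnWith K (sphereChart o s) (Metric.closedBall 0 ρ) := by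
  have hn : ContDiffOn ℝ 1 (fun v : (ℝ ∙ o)ᗮ => ‖v‖ ^ 2) (Metric.closedBall 0 ρ) :=
    (contDiff_norm_sq ℝ).contDiffOn
  refine ContDiffOn.exists_lipschitzOnWith (n := 1) ?_ one_ne_zero (convex_closedBall _ _)
    (isCompact_closedBall _ _)
  refine ContDiffOn.add (ContDiffOn.smul ?_ contDiffOn_const) (ContDiffOn.smul ?_ ?_)
  · exact contDiffOn_const.mul (contDiffOn_const.sub (contDiffOn_const.mul hn))
  · refine contDiffOn_const.mul ((contDiffOn_const.sub hn).sqrt fun v hv => ?_)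
    have hv1 : ‖v‖ < 1 := (mem_closedBall_zero_iff.1 hv).trans_lt h1
    have : ‖v‖ ^ 2 < 1 := pow_lt_one₀ (norm_nonneg _) hv1 two_ne_zero
    linarith
  · exact (Submodule.subtypeL (ℝ ∙ o)ᗮ).contDiff.contDiffOn

theorem exists_eq_cos_smul_add {o u : V} (ho : ‖o‖ = 1) (hu : ‖u‖ = 1) :
    ∃ w : (ℝ ∙ o)ᗮ, u = Real.cos (angle u o) • o + (w : V) ∧ ‖w‖ = Real.sin (angle u o) := by
  have hc : Real.cos (angle u o) = inner ℝ u o := by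
    rw [cos_angle, hu, ho, mul_one, div_one]
  have hs : ‖u - inner ℝ u o • o‖ ^ 2 = Real.sin (angle u o) ^ 2 := by
    rw [Real.sin_sq, hc, norm_sub_sq_real, inner_smul_right, norm_smul, hu, ho, Real.norm_eq_abs,
      mul_one, sq_abs]
    ring
  refine ⟨⟨u - inner ℝ u o • o, ?_⟩, ?_, ?_⟩
  · rw [Submodule.mem_orthogonal_singleton_iff_inner_right, inner_sub_right, inner_smul_right,
      real_inner_self_eq_norm_sq, ho, real_inner_comm]
    ring
  · rw [hc]
    exact (add_sub_cancel _ _).symm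
  · exact (sq_eq_sq₀ (norm_nonneg _) (sin_angle_nonneg _ _)).1 hs

/-- With `‖v‖ = sin t` and `t` half the angle, the chart is the double-angle formula: `1 - 2 sin² t`
along `o` and `2 sin t cos t` across. -/
theorem sphereChart_near {o u : V} (ho : ‖o‖ = 1) (hu : ‖u‖ = 1)
    (h : angle u o ≤ Real.pi / 2) :
    ∃ v, ‖v‖ ≤ √(1 / 2) ∧ sphereChart o 1 v = u ∧ ‖v‖ = Real.sin (angle u o / 2) := by
  obtain ⟨w, hw, hwn⟩ := exists_eq_cos_smul_add ho hu
  have h0 := angle_nonneg u o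
  obtain ⟨t, ht⟩ : ∃ t, t = angle u o / 2 := ⟨_, rfl⟩
  have hθ : angle u o = 2 * t := by rw [ht]; ring
  rw [hθ] at hw hwn h h0
  rw [← ht]
  have hpi := Real.pi_pos
  have hc : 0 < Real.cos t := Real.cos_pos_of_mem_Ioo ⟨by linarith, by linarith⟩
  have hs : 0 ≤ Real.sin t := Real.sin_nonneg_of_nonneg_of_le_pi (by linarith) (by linarith)
  have hsc := Real.sin_sq_add_cos_sq t
  have hv : ‖(2 * Real.cos t)⁻¹ • w‖ = Real.sin t := by
    rw [norm_smul, hwn, Real.sin_two_mul, norm_inv, Real.norm_of_nonneg (by positivity)]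
    field_simp
  refine ⟨(2 * Real.cos t)⁻¹ • w, ?_, ?_, hv⟩
  · rw [hv]
    refine Real.le_sqrt_of_sq_le ?_
    have h2 : 0 ≤ Real.cos (2 * t) :=
      Real.cos_nonneg_of_neg_pi_div_two_le_of_le (by linarith) (by linarith)
    rw [Real.cos_two_mul] at h2
    linarith
  · rw [sphereChart, hv, show 1 - Real.sin t ^ 2 = Real.cos t ^ 2 by linarith,
      Real.sqrt_sq hc.le, Submodule.coe_smul, smul_smul, mul_inv_cancel₀ (by positivity), one_smul,
      one_mul, hw, Real.cos_two_mul]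
    congr 2
    linarith

theorem sphereChart_far {o u : V} (ho : ‖o‖ = 1) (hu : ‖u‖ = 1)
    (h : Real.pi / 2 ≤ angle u o) :
    ∃ v, ‖v‖ ≤ √(1 / 2) ∧ sphereChart o (-1) v = u ∧ ‖v‖ = Real.cos (angle u o / 2) := by
  obtain ⟨w, hw, hwn⟩ := exists_eq_cos_smul_add ho hu
  have h0 := angle_le_pi u o
  obtain ⟨t, ht⟩ : ∃ t, t = angle u o / 2 := ⟨_, rfl⟩
  have hθ : angle u o = 2 * t := by rw [ht]; ring
  rw [hθ] at hw hwn h h0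
  rw [← ht]
  have hpi := Real.pi_pos
  have hc : 0 ≤ Real.cos t :=
    Real.cos_nonneg_of_neg_pi_div_two_le_of_le (by linarith) (by linarith)
  have hs : 0 < Real.sin t := Real.sin_pos_of_pos_of_lt_pi (by linarith) (by linarith)
  have hsc := Real.sin_sq_add_cos_sq t
  have hv : ‖(2 * Real.sin t)⁻¹ • w‖ = Real.cos t := by
    rw [norm_smul, hwn, Real.sin_two_mul, norm_inv, Real.norm_of_nonneg (by positivity)]
    field_simp
  refine ⟨(2 * Real.sin t)⁻¹ • w, ?_, ?_, hv⟩
  · rw [hv]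
    refine Real.le_sqrt_of_sq_le ?_
    have h2 : Real.cos (2 * t) ≤ 0 :=
      Real.cos_nonpos_of_pi_div_two_le_of_le h (by linarith)
    rw [Real.cos_two_mul] at h2
    linarith
  · rw [sphereChart, hv, show 1 - Real.cos t ^ 2 = Real.sin t ^ 2 by linarith,
      Real.sqrt_sq hs.le, Submodule.coe_smul, smul_smul, mul_inv_cancel₀ (by positivity), one_smul,
      hw, Real.cos_two_mul]
    congr 2
    linarith

theorem exists_isometryEquiv_of_linearIsometryEquiv {X : Type*} [MetricSpace X] {ι : X → V}
    (hι : Isometry ι) (hr : Set.range ι = Metric.sphere 0 1) (L : V ≃ₗᵢ[ℝ] V) :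
    ∃ e : X ≃ᵢ X, ∀ x, ι (e x) = L (ι x) := by
  have hmem : ∀ x, ‖ι x‖ = 1 := fun x => by
    have := hr.le ⟨x, rfl⟩
    simpa using this
  have h : ∀ (L : V ≃ₗᵢ[ℝ] V) (x : X), ∃ y, ι y = L (ι x) := fun L x => by
    have : L (ι x) ∈ Set.range ι := by
      rw [hr, mem_sphere_zero_iff_norm, L.norm_map, hmem]
    exact this
  choose f hf using h L
  choose f' hf' using h L.symm
  refine ⟨⟨⟨f, f', fun x => hι.injective ?_, fun x => hι.injective ?_⟩, ?_⟩, hf⟩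
  · rw [hf', hf, L.symm_apply_apply]
  · rw [hf, hf', L.apply_symm_apply]
  · refine Isometry.of_dist_eq fun x y => ?_
    change dist (f x) (f y) = dist x y
    rw [← hι.dist_eq, hf, hf, L.isometry.dist_eq, hι.dist_eq]

theorem isTwoPointHomogeneous_sphere [FiniteDimensional ℝ V] {d : ℕ} (hd : 1 ≤ d)
    (hV : finrank ℝ V = d + 1) {X : Type} [MetricSpace X] [MeasurableSpace X] [BorelSpace X]
    {ι : X → V} (hι : Isometry ι) (hr : Set.range ι = Metric.sphere 0 1) :
    IsTwoPointHomogeneous X (fun x y => angle (ι x) (ι y)) d d := by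
  have hn : ∀ x, ‖ι x‖ = 1 := fun x => by
    have := hr.le ⟨x, rfl⟩
    simpa using this
  have hθ : ∀ x y, angle (ι x) (ι y) = Real.arccos (1 - dist x y ^ 2 / 2) := fun x y => by
    rw [angle_eq_arccos_dist (hn x) (hn y), hι.dist_eq]
  have : Nontrivial V := finrank_pos_iff (R := ℝ).1 (by omega)
  obtain ⟨o, ho⟩ : ∃ o, o ∈ Set.range ι := by
    rw [hr]
    exact (NormedSpace.sphere_nonempty (x := (0 : V))).2 zero_le_one
  obtain ⟨o, rfl⟩ := ho
  have : Fact (finrank ℝ V = d + 1) := ⟨hV⟩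
  have hE : finrank ℝ (ℝ ∙ ι o)ᗮ = d :=
    Submodule.finrank_orthogonal_span_singleton (norm_ne_zero_iff.1 (by rw [hn]; exact one_ne_zero))
  have hρ : √(1 / 2) < (1 : ℝ) := (Real.sqrt_lt' one_pos).2 (by norm_num)
  exact
  { one_le_dim := hd
    one_le_dim₀ := hd
    secondCountable := hι.isEmbedding.secondCountableTopology
    continuous_theta := by
      simp only [Function.uncurry_def, hθ]
      fun_prop
    nonneg := fun _ _ => angle_nonneg _ _
    le_pi := fun _ _ => angle_le_pi _ _
    comm := fun _ _ => angle_comm _ _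
    triangle := fun _ _ _ => angle_le_angle_add_angle _ _ _
    theta_congr := fun x y x' y' h => by rw [hθ, hθ, h]
    homogeneous := fun x y => by
      -- The reflection in the hyperplane orthogonal to `x - y` exchanges the two unit vectors.
      obtain ⟨e, he⟩ := exists_isometryEquiv_of_linearIsometryEquiv hι hr
        (ℝ ∙ (ι x - ι y))ᗮ.reflection
      refine ⟨e, hι.injective ?_⟩
      rw [he, Submodule.reflection_sub ((hn x).trans (hn y).symm)]
    hausdorffMeasure_pos := by
      refine hausdorffMeasure_univ_pos hE (ψ := fun x => (ℝ ∙ ι o)ᗮ.orthogonalProjectionOnto (ι x))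
        ((ℝ ∙ ι o)ᗮ.lipschitzWith_orthogonalProjectionOnto.comp hι.lipschitz) one_pos
        fun b hb => ?_
      rw [mem_ball_zero_iff] at hb
      have hb2 : ‖b‖ ^ 2 < 1 := pow_lt_one₀ (norm_nonneg _) hb two_ne_zero
      have hob : inner ℝ (ι o) (b : V) = 0 :=
        Submodule.mem_orthogonal_singleton_iff_inner_right.1 b.2
      -- The point of the hemisphere about `o` that projects to `b`; the projection thus covers the
      -- open unit ball of the equatorial hyperplane.
      obtain ⟨x, hx⟩ : √(1 - ‖b‖ ^ 2) • ι o + (b : V) ∈ Set.range ι := by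
        rw [hr, mem_sphere_zero_iff_norm, ← sq_eq_sq₀ (norm_nonneg _) zero_le_one,
          norm_add_sq_real, inner_smul_left, hob, norm_smul, hn, mul_one,
          Real.norm_of_nonneg (Real.sqrt_nonneg _), Real.sq_sqrt (by linarith),
          Submodule.coe_norm]
        ring
      refine ⟨x, ?_⟩
      change (ℝ ∙ ι o)ᗮ.orthogonalProjectionOnto (ι x) = b
      rw [hx, map_add, map_smul,
        Submodule.orthogonalProjectionOnto_orthogonalComplement_singleton_eq_zero, smul_zero,
        zero_add, Submodule.orthogonalProjectionOnto_mem_subspace_eq_self]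
    shells := ⟨o,
      shell_near_of_chart (fun _ => angle_nonneg _ _) hE hd hι hρ.le
        (exists_lipschitzOnWith_sphereChart (ι o) 1 hρ)
        fun x hx => sphereChart_near (hn o) (hn x) hx,
      shell_far_of_charts (fun _ => angle_le_pi _ _) (J := Unit) (fun _ => hE) hE hd hι hρ.le
        (Φ := fun _ => sphereChart (ι o) (-1))
        (fun _ => exists_lipschitzOnWith_sphereChart (ι o) (-1) hρ) (fun _ => LinearMap.id)
        (fun _ => Function.surjective_id)
        fun x hx => ⟨(), sphereChart_far (hn o) (hn x) hx⟩⟩ }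

end Sphere

/-! ### Discrepancy bounds and the invariance principle -/

/-- `η` itself is not assumed measurable: measurability is known only for its product with the
density. Dividing by the density, which is positive on the open interval, recovers what is needed.
-/
theorem intervalIntegrable_weight_mul {a b : ℕ} {η f : ℝ → ℝ} {C : ℝ}
    (hη : η ∈ WeightClass a b) (hf : Measurable f)
    (hC : ∀ r ∈ Set.Icc 0 Real.pi, |f r| ≤ C * weightDensity a b r) :
    IntervalIntegrable (fun r => f r * η r) volume 0 Real.pi ∧
      |∫ r in (0 : ℝ)..Real.pi, f r * η r| ≤ C * weightNorm a b η := by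
  have hw : Measurable (weightDensity a b) := by
    unfold weightDensity
    fun_prop
  have hpos : ∀ r ∈ Set.Ioo 0 Real.pi, 0 < weightDensity a b r := fun r hr =>
    mul_pos (pow_pos (Real.sin_pos_of_pos_of_lt_pi (by linarith [hr.1])
      (by linarith [hr.2, Real.pi_pos])) _)
      (pow_pos (Real.cos_pos_of_mem_Ioo ⟨by linarith [hr.1, Real.pi_pos], by linarith [hr.2]⟩) _)
  have hint := (intervalIntegrable_iff_integrableOn_Ioo_of_le Real.pi_pos.le).1 hη.2
  have hle : ∀ r ∈ Set.Icc 0 Real.pi, ‖f r * η r‖ ≤ C * (weightDensity a b r * η r) := by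
    intro r hr
    rw [norm_mul, Real.norm_eq_abs, Real.norm_of_nonneg (hη.1 r hr), ← mul_assoc]
    exact mul_le_mul_of_nonneg_right (hC r hr) (hη.1 r hr)
  refine ⟨(intervalIntegrable_iff_integrableOn_Ioo_of_le Real.pi_pos.le).2 ?_, ?_⟩
  · refine (hint.const_mul C).mono' ?_ ?_
    · refine ((hf.div hw).aestronglyMeasurable.mul hint.aestronglyMeasurable).congr ?_
      filter_upwards [ae_restrict_mem measurableSet_Ioo] with r hr
      have := (hpos r hr).ne'
      simp only [Pi.mul_apply, Pi.div_apply]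
      field_simp
    · filter_upwards [ae_restrict_mem measurableSet_Ioo] with r hr
      exact hle r (Set.Ioo_subset_Icc_self hr)
  · rw [weightNorm, ← intervalIntegral.integral_const_mul, ← Real.norm_eq_abs]
    refine intervalIntegral.norm_integral_le_of_norm_le Real.pi_pos.le ?_ (hη.2.const_mul C)
    exact Filter.Eventually.of_forall fun r hr => hle r (Set.Ioc_subset_Icc_self hr)

theorem intervalIntegrable_sum {ι : Type*} {s : Finset ι} {f : ι → ℝ → ℝ} {a b : ℝ}
    (h : ∀ i ∈ s, IntervalIntegrable (f i) volume a b) :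
    IntervalIntegrable (fun r => ∑ i ∈ s, f i r) volume a b := by
  have := IntervalIntegrable.sum s h
  rwa [Finset.sum_fn] at this

/-- The properties of a metric `θ` and a probability measure `μ` used in the discrepancy bounds:
the volume of a ball depends only on its radius, and the spherical shells satisfy the bounds
with the constant `C`. -/
structure HasShellBounds {X : Type} [MeasurableSpace X] (θ : X → X → ℝ) (μ : Measure X)
    (d d₀ : ℕ) (C : ℝ) : Prop where
  one_le_dim : 1 ≤ d
  one_le_dim₀ : 1 ≤ d₀
  const_nonneg : 0 ≤ C
  measurable : Measurable (Function.uncurry θ)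
  nonneg : ∀ x y, 0 ≤ θ x y
  le_pi : ∀ x y, θ x y ≤ Real.pi
  comm : ∀ x y, θ x y = θ y x
  triangle : ∀ x y z, θ x z ≤ θ x y + θ y z
  volume_eq : ∀ r y y', ballVolume θ μ r y = ballVolume θ μ r y'
  near : ∀ y a b, 0 ≤ a → a ≤ b → b ≤ Real.pi / 2 →
    μ.real {x | a ≤ θ x y ∧ θ x y ≤ b} ≤ C * (Real.sin (b / 2) ^ (d - 1) * (b - a))
  far : ∀ y a b, Real.pi / 2 ≤ a → a ≤ b → a ≤ Real.pi →
    μ.real {x | a ≤ θ x y ∧ θ x y ≤ b} ≤ C * (Real.cos (a / 2) ^ (d₀ - 1) * (b - a))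

theorem half_le_cos_half {r : ℝ} (h0 : 0 ≤ r) (h : r ≤ Real.pi / 2) : 1 / 2 ≤ Real.cos (r / 2) := by
  rw [← Real.cos_pi_div_three]
  exact Real.cos_le_cos_of_nonneg_of_le_pi (by linarith) (by linarith [Real.pi_pos])
    (by linarith [Real.pi_pos])

theorem half_le_sin_half {r : ℝ} (h0 : Real.pi / 2 ≤ r) (h : r ≤ Real.pi) :
    1 / 2 ≤ Real.sin (r / 2) := by
  have := half_le_cos_half (r := Real.pi - r) (by linarith) (by linarith)
  rwa [show (Real.pi - r) / 2 = Real.pi / 2 - r / 2 by ring, Real.cos_pi_div_two_sub] at this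

theorem le_pi_mul_sin_half {r : ℝ} (h0 : 0 ≤ r) (h : r ≤ Real.pi) :
    r ≤ Real.pi * Real.sin (r / 2) := by
  have h1 := Real.mul_le_sin (x := r / 2) (by linarith) (by linarith)
  have h2 := mul_le_mul_of_nonneg_left h1 Real.pi_pos.le
  have h3 : Real.pi * (2 / Real.pi * (r / 2)) = r := by
    field_simp
  linarith

theorem le_pi_mul_cos_half {r : ℝ} (h0 : 0 ≤ r) (h : r ≤ Real.pi) :
    Real.pi - r ≤ Real.pi * Real.cos (r / 2) := by
  have := le_pi_mul_sin_half (r := Real.pi - r) (by linarith) (by linarith)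
  rwa [show (Real.pi - r) / 2 = Real.pi / 2 - r / 2 by ring, Real.sin_pi_div_two_sub] at this

theorem one_le_two_pow_mul_pow {x : ℝ} (h : 1 / 2 ≤ x) (k : ℕ) : 1 ≤ 2 ^ k * x ^ k := by
  rw [← mul_pow]
  exact one_le_pow₀ (by linarith)

namespace HasShellBounds

variable {X : Type} [MeasurableSpace X] {θ : X → X → ℝ} {μ : Measure X} [IsProbabilityMeasure μ]
  {d d₀ : ℕ} {C : ℝ} (h : HasShellBounds θ μ d d₀ C)

include h

theorem measurableSet_thetaBall (r : ℝ) (y : X) : MeasurableSet (thetaBall θ r y) := by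
  have : Measurable fun x => θ x y := h.measurable.comp (measurable_id.prodMk measurable_const)
  exact this measurableSet_Iio

theorem mem_thetaBall_comm {r : ℝ} {x y : X} : x ∈ thetaBall θ r y ↔ y ∈ thetaBall θ r x := by
  simp only [thetaBall, Set.mem_ofPred_eq, h.comm x y]

theorem measureReal_sdiff (r : ℝ) (y₁ y₂ : X) :
    μ.real (thetaBall θ r y₁ \ thetaBall θ r y₂)
      = ballVolume θ μ r y₁ - μ.real (thetaBall θ r y₁ ∩ thetaBall θ r y₂) := by
  have := measureReal_inter_add_sdiff (μ := μ) (s := thetaBall θ r y₁)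
    (h.measurableSet_thetaBall r y₂)
  rw [ballVolume]
  linarith

/-- The balls have equal volumes, so the two halves of the symmetric difference have equal measures,
and the factor `1/2` selects either one. -/
theorem symmDiffMetric_eq (r : ℝ) (y₁ y₂ : X) : symmDiffMetric θ μ r y₁ y₂
    = ballVolume θ μ r y₁ - μ.real (thetaBall θ r y₁ ∩ thetaBall θ r y₂) := by
  have h1 := h.measureReal_sdiff r y₁ y₂
  have h2 := h.measureReal_sdiff r y₂ y₁
  rw [Set.inter_comm, h.volume_eq r y₂ y₁] at h2
  rw [symmDiffMetric, Set.symmDiff_def, measureReal_union disjoint_sdiff_sdiff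
    ((h.measurableSet_thetaBall r y₂).diff (h.measurableSet_thetaBall r y₁)), h1, h2]
  ring

/-- By the symmetry of `θ` the centre and the point change roles, so an integral over centres
becomes an integral of indicators of fixed balls. -/
theorem localDiscrepancy_eq (r : ℝ) (y x : X) : localDiscrepancy θ μ r y x
    = (thetaBall θ r x).indicator (fun _ => (1 : ℝ)) y - ballVolume θ μ r x := by
  rw [localDiscrepancy, h.volume_eq r y x]
  by_cases hx : x ∈ thetaBall θ r y
  · rw [Set.indicator_of_mem hx, Set.indicator_of_mem (h.mem_thetaBall_comm.1 hx)]
  · rw [Set.indicator_of_notMem hx,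
      Set.indicator_of_notMem fun hy => hx (h.mem_thetaBall_comm.1 hy)]

theorem integrable_indicator (r : ℝ) (y : X) :
    Integrable ((thetaBall θ r y).indicator fun _ => (1 : ℝ)) μ :=
  (integrable_const 1).indicator (h.measurableSet_thetaBall r y)

theorem localDiscrepancy_mul (r : ℝ) (y₁ y₂ y : X) :
    localDiscrepancy θ μ r y y₁ * localDiscrepancy θ μ r y y₂
      = (thetaBall θ r y₁ ∩ thetaBall θ r y₂).indicator (fun _ => (1 : ℝ)) y
        - ballVolume θ μ r y₁ * (thetaBall θ r y₁).indicator (fun _ => (1 : ℝ)) y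
        - ballVolume θ μ r y₁ * (thetaBall θ r y₂).indicator (fun _ => (1 : ℝ)) y
        + ballVolume θ μ r y₁ ^ 2 := by
  rw [h.localDiscrepancy_eq, h.localDiscrepancy_eq, h.volume_eq r y₂ y₁]
  by_cases h1 : y ∈ thetaBall θ r y₁ <;> by_cases h2 : y ∈ thetaBall θ r y₂ <;>
    simp [h1, h2] <;> ring

theorem integrable_localDiscrepancy_mul (r : ℝ) (y₁ y₂ : X) :
    Integrable (fun y => localDiscrepancy θ μ r y y₁ * localDiscrepancy θ μ r y y₂) μ := by
  simp only [h.localDiscrepancy_mul]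
  have h12 : Integrable ((thetaBall θ r y₁ ∩ thetaBall θ r y₂).indicator fun _ => (1 : ℝ)) μ :=
    (integrable_const 1).indicator
      ((h.measurableSet_thetaBall r y₁).inter (h.measurableSet_thetaBall r y₂))
  exact ((h12.sub ((h.integrable_indicator r y₁).const_mul _)).sub
    ((h.integrable_indicator r y₂).const_mul _)).add (integrable_const _)

theorem discKernel_eq (r : ℝ) (y₁ y₂ : X) : discKernel θ μ r y₁ y₂
    = μ.real (thetaBall θ r y₁ ∩ thetaBall θ r y₂) - ballVolume θ μ r y₁ ^ 2 := by
  have h12 : Integrable ((thetaBall θ r y₁ ∩ thetaBall θ r y₂).indicator fun _ => (1 : ℝ)) μ :=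
    (integrable_const 1).indicator
      ((h.measurableSet_thetaBall r y₁).inter (h.measurableSet_thetaBall r y₂))
  have i1 := (h.integrable_indicator r y₁).const_mul (ballVolume θ μ r y₁)
  have i2 := (h.integrable_indicator r y₂).const_mul (ballVolume θ μ r y₁)
  have hv := h.volume_eq r y₂ y₁
  rw [discKernel]
  simp only [h.localDiscrepancy_mul]
  have i3 : Integrable (fun y => (thetaBall θ r y₁ ∩ thetaBall θ r y₂).indicator
      (fun _ => (1 : ℝ)) y - ballVolume θ μ r y₁ * (thetaBall θ r y₁).indicator
      (fun _ => (1 : ℝ)) y) μ := h12.sub i1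
  have i4 : Integrable (fun y => (thetaBall θ r y₁ ∩ thetaBall θ r y₂).indicator
      (fun _ => (1 : ℝ)) y - ballVolume θ μ r y₁ * (thetaBall θ r y₁).indicator
      (fun _ => (1 : ℝ)) y - ballVolume θ μ r y₁ * (thetaBall θ r y₂).indicator
      (fun _ => (1 : ℝ)) y) μ := i3.sub i2
  rw [integral_add i4 (integrable_const _), integral_sub i3 i2,
    integral_sub h12 i1, integral_const_mul, integral_const_mul,
    integral_indicator_const _ (h.measurableSet_thetaBall r y₁),
    integral_indicator_const _ (h.measurableSet_thetaBall r y₂), integral_indicator_const _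
      ((h.measurableSet_thetaBall r y₁).inter (h.measurableSet_thetaBall r y₂)), integral_const]
  rw [ballVolume] at hv
  simp only [smul_eq_mul, mul_one, hv, probReal_univ]
  rw [ballVolume]
  ring

theorem discKernel_add_symmDiffMetric (r : ℝ) (y₁ y₂ : X) :
    discKernel θ μ r y₁ y₂ + symmDiffMetric θ μ r y₁ y₂
      = ballVolume θ μ r y₁ - ballVolume θ μ r y₁ ^ 2 := by
  rw [h.discKernel_eq, h.symmDiffMetric_eq]
  ring

theorem symmDiffMetric_nonneg (r : ℝ) (y₁ y₂ : X) : 0 ≤ symmDiffMetric θ μ r y₁ y₂ :=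
  mul_nonneg (by norm_num) measureReal_nonneg

/-- With `v` the volume of a ball, the measure `m` of the intersection satisfies `0 ≤ m ≤ v`, and
`2v - m ≤ 1` because the union has measure at most one. -/
theorem kernel_le_min (r : ℝ) (y₁ y₂ y : X) :
    |discKernel θ μ r y₁ y₂| ≤ min (ballVolume θ μ r y) (1 - ballVolume θ μ r y) ∧
    symmDiffMetric θ μ r y₁ y₂ ≤ min (ballVolume θ μ r y) (1 - ballVolume θ μ r y) := by
  rw [h.discKernel_eq, h.symmDiffMetric_eq, h.volume_eq r y₁ y]
  have hi0 : 0 ≤ μ.real (thetaBall θ r y₁ ∩ thetaBall θ r y₂) := measureReal_nonneg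
  have hi1 : μ.real (thetaBall θ r y₁ ∩ thetaBall θ r y₂) ≤ ballVolume θ μ r y := by
    rw [h.volume_eq r y y₁]
    exact measureReal_mono Set.inter_subset_left
  have hi2 := measureReal_union_add_inter (μ := μ) (s := thetaBall θ r y₁)
    (h.measurableSet_thetaBall r y₂)
  have hu : μ.real (thetaBall θ r y₁ ∪ thetaBall θ r y₂) ≤ 1 := measureReal_le_one
  have hv1 : μ.real (thetaBall θ r y₁) = ballVolume θ μ r y := h.volume_eq r y₁ y
  have hv2 : μ.real (thetaBall θ r y₂) = ballVolume θ μ r y := h.volume_eq r y₂ y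
  rw [hv1, hv2] at hi2
  have h0 : 0 ≤ ballVolume θ μ r y := measureReal_nonneg
  have h1 : ballVolume θ μ r y ≤ 1 := measureReal_le_one
  exact ⟨le_min (abs_le.2 ⟨by nlinarith, by nlinarith⟩) (abs_le.2 ⟨by nlinarith, by nlinarith⟩),
    le_min (by linarith) (by linarith)⟩

theorem ballVolume_le {r : ℝ} (h0 : 0 ≤ r) (hr : r ≤ Real.pi / 2) (y : X) :
    ballVolume θ μ r y
      ≤ C * Real.pi * 2 ^ d₀ * (Real.sin (r / 2) ^ d * Real.cos (r / 2) ^ d₀) := by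
  have hpi := Real.pi_pos
  have hC := h.const_nonneg
  have hs : 0 ≤ Real.sin (r / 2) := Real.sin_nonneg_of_nonneg_of_le_pi (by linarith) (by linarith)
  have h1 := h.near y 0 r le_rfl h0 hr
  have h2 : ballVolume θ μ r y ≤ μ.real {x | 0 ≤ θ x y ∧ θ x y ≤ r} :=
    measureReal_mono fun x hx => ⟨h.nonneg x y, le_of_lt hx⟩
  -- For `r ≤ π/2` the cosine is at least `1/2`, so its power can be inserted at the cost of a power
  -- of two.
  have h3 := one_le_two_pow_mul_pow (half_le_cos_half h0 hr) d₀
  obtain ⟨k, rfl⟩ : ∃ k, d = k + 1 := ⟨d - 1, (Nat.sub_add_cancel h.one_le_dim).symm⟩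
  calc _ ≤ _ := h2.trans h1
    _ ≤ C * (Real.sin (r / 2) ^ k * (Real.pi * Real.sin (r / 2))) := by
      rw [Nat.add_sub_cancel, sub_zero]
      gcongr
      exact le_pi_mul_sin_half h0 (by linarith)
    _ ≤ C * (Real.sin (r / 2) ^ k * (Real.pi * Real.sin (r / 2)))
        * (2 ^ d₀ * Real.cos (r / 2) ^ d₀) := le_mul_of_one_le_right (by positivity) h3
    _ = _ := by ring

theorem one_sub_ballVolume_le {r : ℝ} (h0 : Real.pi / 2 ≤ r) (hr : r ≤ Real.pi) (y : X) :
    1 - ballVolume θ μ r y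
      ≤ C * Real.pi * 2 ^ d * (Real.sin (r / 2) ^ d * Real.cos (r / 2) ^ d₀) := by
  have hpi := Real.pi_pos
  have hC := h.const_nonneg
  have hs : 0 ≤ Real.cos (r / 2) :=
    Real.cos_nonneg_of_neg_pi_div_two_le_of_le (by linarith) (by linarith)
  have h1 := h.far y r Real.pi h0 hr hr
  have h2 : 1 - ballVolume θ μ r y ≤ μ.real {x | r ≤ θ x y ∧ θ x y ≤ Real.pi} := by
    rw [ballVolume, ← probReal_compl_eq_one_sub (h.measurableSet_thetaBall r y)]
    exact measureReal_mono fun x hx => ⟨not_lt.1 hx, h.le_pi x y⟩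
  have h3 := one_le_two_pow_mul_pow (half_le_sin_half h0 hr) d
  obtain ⟨k, rfl⟩ : ∃ k, d₀ = k + 1 := ⟨d₀ - 1, (Nat.sub_add_cancel h.one_le_dim₀).symm⟩
  calc _ ≤ _ := h2.trans h1
    _ ≤ C * (Real.cos (r / 2) ^ k * (Real.pi * Real.cos (r / 2))) := by
      rw [Nat.add_sub_cancel]
      gcongr
      exact le_pi_mul_cos_half (by linarith) hr
    _ ≤ C * (Real.cos (r / 2) ^ k * (Real.pi * Real.cos (r / 2)))
        * (2 ^ d * Real.sin (r / 2) ^ d) := le_mul_of_one_le_right (by positivity) h3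
    _ = _ := by ring

theorem kernel_le {r : ℝ} (hr : r ∈ Set.Icc 0 Real.pi) (y₁ y₂ : X) :
    |discKernel θ μ r y₁ y₂|
      ≤ C * Real.pi * 2 ^ (d + d₀) * (Real.sin (r / 2) ^ d * Real.cos (r / 2) ^ d₀) ∧
    symmDiffMetric θ μ r y₁ y₂
      ≤ C * Real.pi * 2 ^ (d + d₀) * (Real.sin (r / 2) ^ d * Real.cos (r / 2) ^ d₀) := by
  obtain ⟨h0, h1⟩ := hr
  have hpi := Real.pi_pos
  have hC := h.const_nonneg
  have hs : 0 ≤ Real.sin (r / 2) := Real.sin_nonneg_of_nonneg_of_le_pi (by linarith) (by linarith)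
  have hc : 0 ≤ Real.cos (r / 2) :=
    Real.cos_nonneg_of_neg_pi_div_two_le_of_le (by linarith) (by linarith)
  have hk := h.kernel_le_min r y₁ y₂ y₁
  suffices hm : min (ballVolume θ μ r y₁) (1 - ballVolume θ μ r y₁)
      ≤ C * Real.pi * 2 ^ (d + d₀) * (Real.sin (r / 2) ^ d * Real.cos (r / 2) ^ d₀) from
    ⟨hk.1.trans hm, hk.2.trans hm⟩
  rcases le_total r (Real.pi / 2) with hr | hr
  · refine (min_le_left _ _).trans ((h.ballVolume_le h0 hr y₁).trans ?_)
    gcongr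
    · norm_num
    · omega
  · refine (min_le_right _ _).trans ((h.one_sub_ballVolume_le hr h1 y₁).trans ?_)
    gcongr
    · norm_num
    · omega

theorem symmDiffMetric_le {r : ℝ} (hr : r ∈ Set.Icc 0 Real.pi) (y₁ y₂ : X) :
    symmDiffMetric θ μ r y₁ y₂
      ≤ C * 2 ^ (d + d₀) * (Real.sin (r / 2) ^ (d - 1) * Real.cos (r / 2) ^ (d₀ - 1))
        * θ y₁ y₂ := by
  obtain ⟨h0, h1⟩ := hr
  have hpi := Real.pi_pos
  have hC := h.const_nonneg
  have ht := h.nonneg y₁ y₂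
  have hs : 0 ≤ Real.sin (r / 2) := Real.sin_nonneg_of_nonneg_of_le_pi (by linarith) (by linarith)
  have hc : 0 ≤ Real.cos (r / 2) :=
    Real.cos_nonneg_of_neg_pi_div_two_le_of_le (by linarith) (by linarith)
  have h12 : ∀ k ≤ d + d₀, (2 : ℝ) ^ k ≤ 2 ^ (d + d₀) := fun k hk =>
    pow_le_pow_right₀ (by norm_num) hk
  rcases le_total r (Real.pi / 2) with hr | hr
  · have h2 := h.near y₁ (max 0 (r - θ y₁ y₂)) r (le_max_left _ _) (max_le h0 (by linarith)) hr
    -- The near bound sees the outer radius, so the half of the symmetric difference inside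
    -- `B_r(y₁)` is taken: the shell then ends at `r`.
    have h3 : symmDiffMetric θ μ r y₁ y₂
        ≤ μ.real {x | max 0 (r - θ y₁ y₂) ≤ θ x y₁ ∧ θ x y₁ ≤ r} := by
      rw [h.symmDiffMetric_eq, ← h.measureReal_sdiff]
      refine measureReal_mono fun x hx => ⟨max_le (h.nonneg _ _) ?_, le_of_lt hx.1⟩
      have hx2 : r ≤ θ x y₂ := not_lt.1 hx.2
      linarith [h.triangle x y₁ y₂]
    have h4 := one_le_two_pow_mul_pow (half_le_cos_half h0 hr) (d₀ - 1)
    calc _ ≤ _ := h3.trans h2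
      _ ≤ C * (Real.sin (r / 2) ^ (d - 1) * θ y₁ y₂) := by
        gcongr
        linarith [le_max_right 0 (r - θ y₁ y₂)]
      _ ≤ C * (Real.sin (r / 2) ^ (d - 1) * θ y₁ y₂)
          * (2 ^ (d₀ - 1) * Real.cos (r / 2) ^ (d₀ - 1)) :=
        le_mul_of_one_le_right (by positivity) h4
      _ ≤ C * (Real.sin (r / 2) ^ (d - 1) * θ y₁ y₂)
          * (2 ^ (d + d₀) * Real.cos (r / 2) ^ (d₀ - 1)) := by
        gcongr
        · norm_num
        · omega
      _ = _ := by ring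
  · have h2 := h.far y₁ r (r + θ y₁ y₂) hr (by linarith) h1
    -- The far bound sees the inner radius, so the half outside `B_r(y₁)` is taken: the shell then
    -- begins at `r`.
    have h3 : symmDiffMetric θ μ r y₁ y₂
        ≤ μ.real {x | r ≤ θ x y₁ ∧ θ x y₁ ≤ r + θ y₁ y₂} := by
      rw [h.symmDiffMetric_eq, h.volume_eq r y₁ y₂, Set.inter_comm, ← h.measureReal_sdiff]
      refine measureReal_mono fun x hx => ⟨not_lt.1 hx.2, ?_⟩
      have hx1 : θ x y₂ < r := hx.1
      linarith [h.triangle x y₂ y₁, h.comm y₁ y₂]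
    have h4 := one_le_two_pow_mul_pow (half_le_sin_half hr h1) (d - 1)
    calc _ ≤ _ := h3.trans h2
      _ = C * (Real.cos (r / 2) ^ (d₀ - 1) * θ y₁ y₂) := by rw [add_sub_cancel_left]
      _ ≤ C * (Real.cos (r / 2) ^ (d₀ - 1) * θ y₁ y₂)
          * (2 ^ (d - 1) * Real.sin (r / 2) ^ (d - 1)) :=
        le_mul_of_one_le_right (by positivity) h4
      _ ≤ C * (Real.cos (r / 2) ^ (d₀ - 1) * θ y₁ y₂)
          * (2 ^ (d + d₀) * Real.sin (r / 2) ^ (d - 1)) := by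
        gcongr
        · norm_num
        · omega
      _ = _ := by ring

theorem measurable_ballVolume (y : X) : Measurable fun r => ballVolume θ μ r y :=
  Monotone.measurable fun _ _ hrs => measureReal_mono fun _ hx => lt_of_lt_of_le hx hrs

theorem measurable_inter (y₁ y₂ : X) :
    Measurable fun r => μ.real (thetaBall θ r y₁ ∩ thetaBall θ r y₂) :=
  Monotone.measurable fun _ _ hrs => measureReal_mono fun _ hx =>
    ⟨lt_of_lt_of_le hx.1 hrs, lt_of_lt_of_le hx.2 hrs⟩

theorem measurable_discKernel (y₁ y₂ : X) : Measurable fun r => discKernel θ μ r y₁ y₂ := by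
  simp only [h.discKernel_eq]
  exact (h.measurable_inter y₁ y₂).sub ((h.measurable_ballVolume y₁).pow_const 2)

theorem measurable_symmDiffMetric (y₁ y₂ : X) :
    Measurable fun r => symmDiffMetric θ μ r y₁ y₂ := by
  simp only [h.symmDiffMetric_eq]
  exact (h.measurable_ballVolume y₁).sub (h.measurable_inter y₁ y₂)

theorem measurable_symmDiffMetric_prod (y₁ : X) :
    Measurable fun q : X × ℝ => symmDiffMetric θ μ q.2 y₁ q.1 := by
  simp only [h.symmDiffMetric_eq]
  refine ((h.measurable_ballVolume y₁).comp measurable_snd).sub ?_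
  have hm : MeasurableSet {q : (X × ℝ) × X | θ q.2 y₁ < q.1.2 ∧ θ q.2 q.1.1 < q.1.2} := by
    refine (measurableSet_lt (h.measurable.comp (measurable_snd.prodMk measurable_const))
      measurable_fst.snd).inter (measurableSet_lt (h.measurable.comp
        (measurable_snd.prodMk measurable_fst.fst)) measurable_fst.snd)
  exact (measurable_measure_prodMk_left (ν := μ) hm).ennreal_toReal

theorem integral_symmDiffMetric (r : ℝ) (y₁ : X) : ∫ y₂, symmDiffMetric θ μ r y₁ y₂ ∂μ
    = ballVolume θ μ r y₁ - ballVolume θ μ r y₁ ^ 2 := by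
  have hm : MeasurableSet {q : X × X | θ q.2 y₁ < r ∧ θ q.2 q.1 < r} := by
    refine (measurableSet_lt (h.measurable.comp (measurable_snd.prodMk measurable_const))
      measurable_const).inter (measurableSet_lt (h.measurable.comp
        (measurable_snd.prodMk measurable_fst)) measurable_const)
  have hmeas : Measurable fun y₂ => μ (thetaBall θ r y₁ ∩ thetaBall θ r y₂) :=
    measurable_measure_prodMk_left (ν := μ) hm
  have hint : Integrable (fun y₂ => μ.real (thetaBall θ r y₁ ∩ thetaBall θ r y₂)) μ :=
    Integrable.of_bound hmeas.ennreal_toReal.aestronglyMeasurable 1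
      (Filter.Eventually.of_forall fun y₂ => by
        rw [Real.norm_of_nonneg measureReal_nonneg]
        exact measureReal_le_one)
  have hswap : ∫ y₂, μ.real (thetaBall θ r y₁ ∩ thetaBall θ r y₂) ∂μ
      = ballVolume θ μ r y₁ ^ 2 := by
    -- Tonelli: integrating first over `y₂` for fixed `x` in `B_r(y₁)` gives the volume of `B_r(x)`,
    -- which is that of `B_r(y₁)`.
    have h1 : ∫⁻ y₂, μ (thetaBall θ r y₁ ∩ thetaBall θ r y₂) ∂μ
        = ∫⁻ x, (thetaBall θ r y₁).indicator (fun _ => μ (thetaBall θ r y₁)) x ∂μ := by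
      calc _ = (μ.prod μ) {q : X × X | θ q.2 y₁ < r ∧ θ q.2 q.1 < r} :=
            (Measure.prod_apply hm).symm
        _ = _ := Measure.prod_apply_symm hm
        _ = _ := by
          refine lintegral_congr fun x => ?_
          by_cases hx : x ∈ thetaBall θ r y₁
          · have hx' : θ x y₁ < r := hx
            rw [Set.indicator_of_mem hx]
            have hv := h.volume_eq r y₁ x
            rw [ballVolume, ballVolume, measureReal_def, measureReal_def,
              ENNReal.toReal_eq_toReal_iff' (measure_ne_top _ _) (measure_ne_top _ _)] at hv
            rw [hv]
            congr 1
            ext y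
            simp [thetaBall, hx', h.comm x y]
          · have hx' : ¬ θ x y₁ < r := hx
            rw [Set.indicator_of_notMem hx]
            simp [hx']
    rw [lintegral_indicator_const (h.measurableSet_thetaBall r y₁)] at h1
    simp only [measureReal_def]
    rw [integral_toReal hmeas.aemeasurable
      (Filter.Eventually.of_forall fun _ => measure_lt_top _ _), h1, ENNReal.toReal_mul, ballVolume,
      sq]
    rfl
  simp only [h.symmDiffMetric_eq]
  rw [integral_sub (integrable_const _) hint, hswap, integral_const]
  simp

theorem averageValue_symmDiffMetric (r : ℝ) (y : X) :
    averageValue μ (symmDiffMetric θ μ r) = ballVolume θ μ r y - ballVolume θ μ r y ^ 2 := by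
  rw [averageValue]
  simp only [h.integral_symmDiffMetric, h.volume_eq r _ y]
  simp

section Weighted

variable {η : ℝ → ℝ}

theorem abs_kernel_le_weightDensity {r : ℝ} (hr : r ∈ Set.Icc 0 Real.pi) (y₁ y₂ : X) :
    |discKernel θ μ r y₁ y₂| ≤ C * Real.pi * 2 ^ (d + d₀) * weightDensity (d + 1) (d₀ + 1) r ∧
    |symmDiffMetric θ μ r y₁ y₂|
      ≤ C * Real.pi * 2 ^ (d + d₀) * weightDensity (d + 1) (d₀ + 1) r := by
  have := h.kernel_le hr y₁ y₂
  rw [abs_of_nonneg (h.symmDiffMetric_nonneg r y₁ y₂)]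
  simpa only [weightDensity, Nat.add_sub_cancel] using this

theorem intervalIntegrable_discKernel (hη : η ∈ WeightClass (d + 1) (d₀ + 1)) (y₁ y₂ : X) :
    IntervalIntegrable (fun r => discKernel θ μ r y₁ y₂ * η r) volume 0 Real.pi ∧
      |weightedDiscKernel θ μ η y₁ y₂|
        ≤ C * Real.pi * 2 ^ (d + d₀) * weightNorm (d + 1) (d₀ + 1) η :=
  intervalIntegrable_weight_mul hη (h.measurable_discKernel y₁ y₂) fun _ hr =>
    (h.abs_kernel_le_weightDensity hr y₁ y₂).1

theorem intervalIntegrable_symmDiffMetric (hη : η ∈ WeightClass (d + 1) (d₀ + 1)) (y₁ y₂ : X) :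
    IntervalIntegrable (fun r => symmDiffMetric θ μ r y₁ y₂ * η r) volume 0 Real.pi ∧
      |weightedSymmDiffMetric θ μ η y₁ y₂|
        ≤ C * Real.pi * 2 ^ (d + d₀) * weightNorm (d + 1) (d₀ + 1) η :=
  intervalIntegrable_weight_mul hη (h.measurable_symmDiffMetric y₁ y₂) fun _ hr =>
    (h.abs_kernel_le_weightDensity hr y₁ y₂).2

theorem intervalIntegrable_symmDiffMetric_lipschitz (hη : η ∈ WeightClass d d₀) (y₁ y₂ : X) :
    IntervalIntegrable (fun r => symmDiffMetric θ μ r y₁ y₂ * η r) volume 0 Real.pi ∧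
      |weightedSymmDiffMetric θ μ η y₁ y₂|
        ≤ C * 2 ^ (d + d₀) * θ y₁ y₂ * weightNorm d d₀ η :=
  intervalIntegrable_weight_mul hη (h.measurable_symmDiffMetric y₁ y₂) fun r hr => by
    rw [abs_of_nonneg (h.symmDiffMetric_nonneg r y₁ y₂)]
    exact (h.symmDiffMetric_le hr y₁ y₂).trans_eq (by rw [weightDensity]; ring)

theorem integral_weightedSymmDiffMetric (hη : η ∈ WeightClass (d + 1) (d₀ + 1)) (y₁ : X) :
    ∫ y₂, weightedSymmDiffMetric θ μ η y₁ y₂ ∂μ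
      = ∫ r in (0 : ℝ)..Real.pi, (ballVolume θ μ r y₁ - ballVolume θ μ r y₁ ^ 2) * η r := by
  simp only [weightedSymmDiffMetric, intervalIntegral.integral_of_le Real.pi_pos.le,
    integral_Ioc_eq_integral_Ioo]
  have hpos : ∀ r ∈ Set.Ioo 0 Real.pi, 0 < weightDensity (d + 1) (d₀ + 1) r := fun r hr =>
    mul_pos (pow_pos (Real.sin_pos_of_pos_of_lt_pi (by linarith [hr.1])
      (by linarith [hr.2, Real.pi_pos])) _)
      (pow_pos (Real.cos_pos_of_mem_Ioo ⟨by linarith [hr.1, Real.pi_pos], by linarith [hr.2]⟩) _)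
  have hw : Measurable (weightDensity (d + 1) (d₀ + 1)) := by
    unfold weightDensity
    fun_prop
  have hint := (intervalIntegrable_iff_integrableOn_Ioo_of_le Real.pi_pos.le).1 hη.2
  have hηm : AEStronglyMeasurable η (volume.restrict (Set.Ioo 0 Real.pi)) := by
    refine (hw.inv.aestronglyMeasurable.mul hint.aestronglyMeasurable).congr ?_
    filter_upwards [ae_restrict_mem measurableSet_Ioo] with r hr
    have := (hpos r hr).ne'
    simp only [Pi.mul_apply, Pi.inv_apply]
    field_simp
  have hprod : Integrable (Function.uncurry fun (y₂ : X) (r : ℝ) => symmDiffMetric θ μ r y₁ y₂ * η r)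
      (μ.prod (volume.restrict (Set.Ioo 0 Real.pi))) := by
    refine ((hint.comp_snd μ).const_mul (C * Real.pi * 2 ^ (d + d₀))).mono' ?_ ?_
    · exact (h.measurable_symmDiffMetric_prod y₁).aestronglyMeasurable.mul hηm.comp_snd
    · have hae : ∀ᵐ q ∂μ.prod (volume.restrict (Set.Ioo 0 Real.pi)), q.2 ∈ Set.Ioo 0 Real.pi :=
        Measure.quasiMeasurePreserving_snd.ae (ae_restrict_mem measurableSet_Ioo)
      filter_upwards [hae] with q hq
      have hq' := Set.Ioo_subset_Icc_self hq
      have h1 := (h.abs_kernel_le_weightDensity hq' y₁ q.1).2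
      rw [Function.uncurry, norm_mul, Real.norm_eq_abs, Real.norm_of_nonneg (hη.1 q.2 hq'),
        ← mul_assoc]
      exact mul_le_mul_of_nonneg_right h1 (hη.1 q.2 hq')
  rw [integral_integral_swap hprod]
  simp only [integral_mul_const, h.integral_symmDiffMetric]

theorem weightedDiscKernel_add (hη : η ∈ WeightClass (d + 1) (d₀ + 1)) (y₁ y₂ : X) :
    weightedDiscKernel θ μ η y₁ y₂ + weightedSymmDiffMetric θ μ η y₁ y₂
      = averageValue μ (weightedSymmDiffMetric θ μ η) := by
  rw [averageValue]
  simp only [h.integral_weightedSymmDiffMetric hη, h.volume_eq _ _ y₁]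
  rw [integral_const, probReal_univ, one_smul, weightedDiscKernel, weightedSymmDiffMetric,
    ← intervalIntegral.integral_add (h.intervalIntegrable_discKernel hη y₁ y₂).1
      (h.intervalIntegrable_symmDiffMetric hη y₁ y₂).1]
  simp only [← add_mul, h.discKernel_add_symmDiffMetric]

theorem intervalIntegrable_averageValue [Nonempty X] (hη : η ∈ WeightClass (d + 1) (d₀ + 1)) :
    IntervalIntegrable (fun r => averageValue μ (symmDiffMetric θ μ r) * η r)
      volume 0 Real.pi := by
  obtain ⟨y⟩ := ‹Nonempty X›
  have := (h.intervalIntegrable_discKernel hη y y).1.add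
    (h.intervalIntegrable_symmDiffMetric hη y y).1
  refine this.congr fun r _ => ?_
  simp only [← add_mul, h.discKernel_add_symmDiffMetric]
  rw [h.averageValue_symmDiffMetric r y]

theorem quadDiscrepancy_eq (r : ℝ) {N : ℕ} (D : Fin N → X) :
    quadDiscrepancy θ μ r D = ∑ i, ∑ j, discKernel θ μ r (D i) (D j) := by
  simp only [quadDiscrepancy, discKernel, sq, Finset.sum_mul_sum]
  rw [integral_finsetSum _ fun i _ => integrable_finsetSum _ fun j _ =>
    h.integrable_localDiscrepancy_mul r (D i) (D j)]
  exact Finset.sum_congr rfl fun i _ => integral_finsetSum _ fun j _ =>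
    h.integrable_localDiscrepancy_mul r (D i) (D j)

theorem intervalIntegrable_quadDiscrepancy (hη : η ∈ WeightClass (d + 1) (d₀ + 1)) {N : ℕ}
    (D : Fin N → X) :
    IntervalIntegrable (fun r => quadDiscrepancy θ μ r D * η r) volume 0 Real.pi := by
  simp only [h.quadDiscrepancy_eq, Finset.sum_mul]
  exact intervalIntegrable_sum fun i _ => intervalIntegrable_sum fun j _ =>
    (h.intervalIntegrable_discKernel hη (D i) (D j)).1

theorem weightedQuadDiscrepancy_add (hη : η ∈ WeightClass (d + 1) (d₀ + 1)) {N : ℕ}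
    (D : Fin N → X) :
    weightedQuadDiscrepancy θ μ η D + distanceSum (weightedSymmDiffMetric θ μ η) D
      = averageValue μ (weightedSymmDiffMetric θ μ η) * (N : ℝ) ^ 2 := by
  have h1 : weightedQuadDiscrepancy θ μ η D
      = ∑ i, ∑ j, weightedDiscKernel θ μ η (D i) (D j) := by
    simp only [weightedQuadDiscrepancy, weightedDiscKernel, h.quadDiscrepancy_eq, Finset.sum_mul]
    rw [intervalIntegral.integral_finsetSum fun i _ => intervalIntegrable_sum fun j _ =>
      (h.intervalIntegrable_discKernel hη (D i) (D j)).1]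
    exact Finset.sum_congr rfl fun i _ => intervalIntegral.integral_finsetSum fun j _ =>
      (h.intervalIntegrable_discKernel hη (D i) (D j)).1
  rw [h1, distanceSum, ← Finset.sum_add_distrib]
  simp only [← Finset.sum_add_distrib, h.weightedDiscKernel_add hη]
  simp
  ring

/-- For each `D` the discrepancy is a constant minus the sum of distances, so infimum and supremum
correspond. The uniform kernel bound is needed because real infima and suprema of unbounded sets
carry no information. -/
theorem extremalDiscrepancy_add [Nonempty X] (hη : η ∈ WeightClass (d + 1) (d₀ + 1)) (N : ℕ) :
    extremalDiscrepancy θ μ η N + extremalDistanceSum (weightedSymmDiffMetric θ μ η) N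
      = averageValue μ (weightedSymmDiffMetric θ μ η) * (N : ℝ) ^ 2 := by
  have hD := fun D : Fin N → X => h.weightedQuadDiscrepancy_add hη D
  have hA : BddAbove (Set.range fun D : Fin N → X =>
      distanceSum (weightedSymmDiffMetric θ μ η) D) := by
    refine ⟨∑ i : Fin N, ∑ j : Fin N,
      C * Real.pi * 2 ^ (d + d₀) * weightNorm (d + 1) (d₀ + 1) η, ?_⟩
    rintro _ ⟨D, rfl⟩
    exact Finset.sum_le_sum fun i _ => Finset.sum_le_sum fun j _ =>
      (le_abs_self _).trans (h.intervalIntegrable_symmDiffMetric hη (D i) (D j)).2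
  obtain ⟨M, hM⟩ := hA
  have hM' : ∀ D : Fin N → X, distanceSum (weightedSymmDiffMetric θ μ η) D ≤ M := fun D =>
    hM ⟨D, rfl⟩
  have hB : BddBelow (Set.range fun D : Fin N → X => weightedQuadDiscrepancy θ μ η D) := by
    refine ⟨averageValue μ (weightedSymmDiffMetric θ μ η) * (N : ℝ) ^ 2 - M, ?_⟩
    rintro _ ⟨D, rfl⟩
    have := hM' D
    have := hD D
    simp only
    linarith
  rw [extremalDiscrepancy, extremalDistanceSum]
  refine le_antisymm ?_ ?_
  · rw [← le_sub_iff_add_le']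
    refine ciSup_le fun D => ?_
    have := ciInf_le hB D
    have := hD D
    linarith
  · rw [← sub_le_iff_le_add]
    refine le_ciInf fun D => ?_
    have := le_ciSup ⟨M, hM⟩ D
    have := hD D
    linarith

end Weighted

end HasShellBounds

/-! ### Shell bounds about every point for the normalized measure -/

namespace IsTwoPointHomogeneous

variable {X : Type} [MetricSpace X] [MeasurableSpace X] [BorelSpace X] {θ : X → X → ℝ} {d d₀ : ℕ}

theorem hausdorffMeasure_univ_lt_top (h : IsTwoPointHomogeneous X θ d d₀) :
    Measure.hausdorffMeasure (d : ℝ) (Set.univ : Set X) < ⊤ := by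
  obtain ⟨o, ⟨C, -, h1⟩, ⟨C', -, h2⟩⟩ := h.shells
  have hpi := Real.pi_pos
  have hsub : (Set.univ : Set X) ⊆ {x | 0 ≤ θ x o ∧ θ x o ≤ Real.pi / 2} ∪
      {x | Real.pi / 2 ≤ θ x o ∧ θ x o ≤ Real.pi} := fun x _ =>
    (le_total (θ x o) (Real.pi / 2)).imp (fun hx => ⟨h.nonneg x o, hx⟩)
      fun hx => ⟨hx, h.le_pi x o⟩
  refine (measure_mono hsub).trans_lt ((measure_union_le _ _).trans_lt (ENNReal.add_lt_top.2
    ⟨(h1 _ _ le_rfl (by linarith) le_rfl).trans_lt ENNReal.ofReal_lt_top,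
      (h2 _ _ le_rfl (by linarith) (by linarith)).trans_lt ENNReal.ofReal_lt_top⟩))

theorem isProbabilityMeasure (h : IsTwoPointHomogeneous X θ d d₀) :
    IsProbabilityMeasure ((Measure.hausdorffMeasure (d : ℝ) (Set.univ : Set X))⁻¹ •
      (Measure.hausdorffMeasure (d : ℝ) : Measure X)) :=
  ⟨by rw [Measure.smul_apply, smul_eq_mul,
    ENNReal.inv_mul_cancel h.hausdorffMeasure_pos.ne' h.hausdorffMeasure_univ_lt_top.ne]⟩

theorem exists_hasShellBounds (h : IsTwoPointHomogeneous X θ d d₀) :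
    ∃ C, HasShellBounds θ ((Measure.hausdorffMeasure (d : ℝ) (Set.univ : Set X))⁻¹ •
      (Measure.hausdorffMeasure (d : ℝ) : Measure X)) d d₀ C := by
  obtain ⟨o, ⟨C, hC, h1⟩, ⟨C', hC', h2⟩⟩ := h.shells
  -- Second countability makes the Borel sets of `X × X` the product σ-algebra, so that the
  -- continuous `θ` is jointly measurable.
  have := h.secondCountable
  let m := Measure.hausdorffMeasure (d : ℝ) (Set.univ : Set X)
  have hm : m⁻¹ ≠ ⊤ := ENNReal.inv_ne_top.2 h.hausdorffMeasure_pos.ne'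
  -- A general condition `p` on the distance covers balls and shells at once; the isometry taking
  -- `y'` to `y` preserves both `θ` and the Hausdorff measure.
  have hmove : ∀ (p : ℝ → Prop) (y y' : X),
      (m⁻¹ • (Measure.hausdorffMeasure (d : ℝ) : Measure X)).real {x | p (θ x y)}
        = (m⁻¹ • (Measure.hausdorffMeasure (d : ℝ) : Measure X)).real {x | p (θ x y')} := by
    intro p y y'
    obtain ⟨e, he⟩ := h.homogeneous y' y
    have hp : {x | p (θ x y')} = e ⁻¹' {x | p (θ x y)} := by
      ext x
      have := h.theta_congr (e x) y x y' (by rw [← he, e.isometry.dist_eq])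
      simp [this]
    rw [hp]
    simp only [measureReal_def, Measure.smul_apply, e.hausdorffMeasure_preimage]
  have hreal : ∀ (S : Set X) (b : ℝ), 0 ≤ b →
      Measure.hausdorffMeasure (d : ℝ) S ≤ ENNReal.ofReal b →
      (m⁻¹ • (Measure.hausdorffMeasure (d : ℝ) : Measure X)).real S ≤ m⁻¹.toReal * b := by
    intro S b hb hS
    rw [measureReal_def, Measure.smul_apply, smul_eq_mul, ENNReal.toReal_mul]
    exact mul_le_mul_of_nonneg_left (ENNReal.toReal_le_of_le_ofReal hb hS) ENNReal.toReal_nonneg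
  have hpi := Real.pi_pos
  refine ⟨m⁻¹.toReal * (C + C'), h.one_le_dim, h.one_le_dim₀, by positivity,
    h.continuous_theta.measurable, h.nonneg, h.le_pi, h.comm, h.triangle,
    fun r y y' => hmove (· < r) y y', fun y a b ha hab hb => ?_, fun y a b ha hab ha' => ?_⟩
  · have hs : 0 ≤ Real.sin (b / 2) :=
      Real.sin_nonneg_of_nonneg_of_le_pi (by linarith) (by linarith)
    have hba := sub_nonneg.2 hab
    rw [hmove (fun t => a ≤ t ∧ t ≤ b) y o, mul_assoc]
    refine (hreal _ _ (by positivity) (h1 a b ha hab hb)).trans ?_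
    gcongr
    linarith
  · have hs : 0 ≤ Real.cos (a / 2) :=
      Real.cos_nonneg_of_neg_pi_div_two_le_of_le (by linarith) (by linarith)
    have hba := sub_nonneg.2 hab
    rw [hmove (fun t => a ≤ t ∧ t ≤ b) y o, mul_assoc]
    refine (hreal _ _ (by positivity) (h2 a b ha hab ha')).trans ?_
    gcongr
    linarith

end IsTwoPointHomogeneous

/-! ### Application to the list of spaces -/

namespace TwoPointSpace

theorem isTwoPointHomogeneous (Q : TwoPointSpace) :
    IsTwoPointHomogeneous Q Q.theta Q.dim Q.dim₀ := by
  cases Q with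
  | sphere d hd =>
    exact isTwoPointHomogeneous_sphere hd (V := EuclideanSpace ℝ (Fin (d + 1)))
      finrank_euclideanSpace_fin (X := sphere d hd)
      (ι := fun x : Metric.sphere (0 : EuclideanSpace ℝ (Fin (d + 1))) 1 => x.1)
      isometry_subtype_coe Subtype.range_coe
  | realProj n hn =>
    let : MeasurableSpace (ProjectiveSpaceModel ℝ n) := borel _
    have : BorelSpace (ProjectiveSpaceModel ℝ n) := ⟨rfl⟩
    have h := ProjectiveSpaceModel.isTwoPointHomogeneous (F := ℝ) (n := n) (by omega)
      (Or.inl mul_assoc) (Module.finrank_self ℝ)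
    rw [mul_one] at h
    exact h
  | complexProj n hn =>
    let : MeasurableSpace (ProjectiveSpaceModel ℂ n) := borel _
    have : BorelSpace (ProjectiveSpaceModel ℂ n) := ⟨rfl⟩
    exact ProjectiveSpaceModel.isTwoPointHomogeneous (F := ℂ) (n := n) (by omega)
      (Or.inl mul_assoc) Complex.finrank_real_complex
  | quaternionProj n hn =>
    let : MeasurableSpace (ProjectiveSpaceModel ℍ[ℝ] n) := borel _
    have : BorelSpace (ProjectiveSpaceModel ℍ[ℝ] n) := ⟨rfl⟩
    exact ProjectiveSpaceModel.isTwoPointHomogeneous (F := ℍ[ℝ]) (n := n) (by omega)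
      (Or.inl mul_assoc) Quaternion.finrank_eq_four
  | octonionPlane =>
    let : MeasurableSpace (ProjectiveSpaceModel Octonion 2) := borel _
    have : BorelSpace (ProjectiveSpaceModel Octonion 2) := ⟨rfl⟩
    exact ProjectiveSpaceModel.isTwoPointHomogeneous (F := Octonion) (n := 2) (by omega)
      (Or.inr rfl) Octonion.finrank_eq

/-- The space is determined by the numbers `d` and `d₀`. -/
theorem eq_of_dim_eq {Q Q' : TwoPointSpace} (h : Q.dim = Q'.dim) (h' : Q.dim₀ = Q'.dim₀) :
    Q = Q' := by
  cases Q <;> cases Q' <;> simp only [dim, dim₀] at h h' <;>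
    first
    | rfl
    | (exfalso; omega)
    | (congr 1; done)
    | (congr 1; omega)

instance (Q : TwoPointSpace) : IsProbabilityMeasure Q.mu :=
  Q.isTwoPointHomogeneous.isProbabilityMeasure

theorem exists_hasShellBounds (Q : TwoPointSpace) :
    ∃ C, HasShellBounds Q.theta Q.mu Q.dim Q.dim₀ C :=
  Q.isTwoPointHomogeneous.exists_hasShellBounds

theorem nonempty (Q : TwoPointSpace) : Nonempty Q :=
  let ⟨o, _⟩ := Q.isTwoPointHomogeneous.shells
  ⟨o⟩

end TwoPointSpace

theorem lemma2p1 (d d₀ : ℕ) :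
    ∃ C : ℝ, 0 < C ∧ ∀ Q : TwoPointSpace, Q.dim = d → Q.dim₀ = d₀ →
      -- (i), pointwise bounds
      (∀ r ∈ Set.Icc 0 Real.pi, ∀ y₁ y₂ : Q,
        |discKernel Q.theta Q.mu r y₁ y₂|
            ≤ C * (Real.sin (r / 2) ^ d * Real.cos (r / 2) ^ d₀) ∧
        symmDiffMetric Q.theta Q.mu r y₁ y₂
            ≤ C * (Real.sin (r / 2) ^ d * Real.cos (r / 2) ^ d₀)) ∧
      -- (i), integrated bounds, with convergence of the integrals
      (∀ η ∈ WeightClass (d + 1) (d₀ + 1), ∀ y₁ y₂ : Q,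
        IntervalIntegrable (fun r => discKernel Q.theta Q.mu r y₁ y₂ * η r) volume 0 Real.pi ∧
        IntervalIntegrable (fun r => symmDiffMetric Q.theta Q.mu r y₁ y₂ * η r)
          volume 0 Real.pi ∧
        |weightedDiscKernel Q.theta Q.mu η y₁ y₂| ≤ C * weightNorm (d + 1) (d₀ + 1) η ∧
        weightedSymmDiffMetric Q.theta Q.mu η y₁ y₂ ≤ C * weightNorm (d + 1) (d₀ + 1) η) ∧
      -- (ii), pointwise bound
      (∀ r ∈ Set.Icc 0 Real.pi, ∀ y₁ y₂ : Q,
        symmDiffMetric Q.theta Q.mu r y₁ y₂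
          ≤ C * (Real.sin (r / 2) ^ (d - 1) * Real.cos (r / 2) ^ (d₀ - 1))
            * Q.theta y₁ y₂) ∧
      -- (ii), the integrated (Lipschitz) bound, with convergence of the integral
      (∀ η ∈ WeightClass d d₀, ∀ y₁ y₂ : Q,
        IntervalIntegrable (fun r => symmDiffMetric Q.theta Q.mu r y₁ y₂ * η r)
          volume 0 Real.pi ∧
        weightedSymmDiffMetric Q.theta Q.mu η y₁ y₂
          ≤ C * weightNorm d d₀ η * Q.theta y₁ y₂) ∧
      -- the `L₁`-invariance principles
      (∀ η ∈ WeightClass (d + 1) (d₀ + 1),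
        IntervalIntegrable (fun r => averageValue Q.mu (symmDiffMetric Q.theta Q.mu r) * η r)
          volume 0 Real.pi ∧
        (∀ y₁ y₂ : Q,
          weightedDiscKernel Q.theta Q.mu η y₁ y₂ + weightedSymmDiffMetric Q.theta Q.mu η y₁ y₂
            = averageValue Q.mu (weightedSymmDiffMetric Q.theta Q.mu η)) ∧
        (∀ (N : ℕ) (D : Fin N → Q),
          IntervalIntegrable (fun r => quadDiscrepancy Q.theta Q.mu r D * η r)
            volume 0 Real.pi ∧
          weightedQuadDiscrepancy Q.theta Q.mu η D
              + distanceSum (weightedSymmDiffMetric Q.theta Q.mu η) D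
            = averageValue Q.mu (weightedSymmDiffMetric Q.theta Q.mu η) * (N : ℝ) ^ 2) ∧
        (∀ N : ℕ,
          extremalDiscrepancy Q.theta Q.mu η N
              + extremalDistanceSum (weightedSymmDiffMetric Q.theta Q.mu η) N
            = averageValue Q.mu (weightedSymmDiffMetric Q.theta Q.mu η) * (N : ℝ) ^ 2)) := by
  by_cases hQ : ∃ Q : TwoPointSpace, Q.dim = d ∧ Q.dim₀ = d₀
  swap
  -- For pairs `(d, d₀)` that no space realizes the claim is vacuous.
  · exact ⟨1, one_pos, fun Q h h' => (hQ ⟨Q, h, h'⟩).elim⟩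
  obtain ⟨Q₀, rfl, rfl⟩ := hQ
  obtain ⟨C, hs⟩ := Q₀.exists_hasShellBounds
  have : Nonempty Q₀ := Q₀.nonempty
  have hpi := Real.pi_pos
  have hC := hs.const_nonneg
  set c : ℝ := C * Real.pi * 2 ^ (Q₀.dim + Q₀.dim₀) with hc
  set c' : ℝ := C * 2 ^ (Q₀.dim + Q₀.dim₀) with hc'
  have hc0 : 0 ≤ c := by positivity
  have hc0' : 0 ≤ c' := by positivity
  have hle : c ≤ c + c' + 1 := by linarith
  have hle' : c' ≤ c + c' + 1 := by linarith
  -- `c` serves the bounds (i), `c'` the bounds (ii), and `1` ensures positivity. The constant was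
  -- chosen for `Q₀`; the next line identifies every admissible `Q` with it.
  refine ⟨c + c' + 1, by linarith, fun Q h h' => ?_⟩
  obtain rfl := TwoPointSpace.eq_of_dim_eq h h'
  have hsc : ∀ r ∈ Set.Icc 0 Real.pi, 0 ≤ Real.sin (r / 2) ∧ 0 ≤ Real.cos (r / 2) :=
    fun r hr => ⟨Real.sin_nonneg_of_nonneg_of_le_pi (by linarith [hr.1]) (by linarith [hr.2]),
      Real.cos_nonneg_of_neg_pi_div_two_le_of_le (by linarith [hr.1]) (by linarith [hr.2])⟩
  have hnorm : ∀ (a b : ℕ) (η : ℝ → ℝ), η ∈ WeightClass a b → 0 ≤ weightNorm a b η :=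
    fun a b η hη => intervalIntegral.integral_nonneg hpi.le fun r hr => by
      obtain ⟨h1, h2⟩ := hsc r hr
      have := hη.1 r hr
      unfold weightDensity
      positivity
  refine ⟨fun r hr y₁ y₂ => ?_, fun η hη y₁ y₂ => ?_, fun r hr y₁ y₂ => ?_,
    fun η hη y₁ y₂ => ?_, fun η hη => ⟨hs.intervalIntegrable_averageValue hη,
      hs.weightedDiscKernel_add hη, fun N D => ⟨hs.intervalIntegrable_quadDiscrepancy hη D,
        hs.weightedQuadDiscrepancy_add hη D⟩, hs.extremalDiscrepancy_add hη⟩⟩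
  · obtain ⟨h1, h2⟩ := hsc r hr
    have hk := hs.kernel_le hr y₁ y₂
    exact ⟨hk.1.trans (by gcongr), hk.2.trans (by gcongr)⟩
  · have h1 := hs.intervalIntegrable_discKernel hη y₁ y₂
    have h2 := hs.intervalIntegrable_symmDiffMetric hη y₁ y₂
    have h3 := hnorm _ _ η hη
    exact ⟨h1.1, h2.1, h1.2.trans (by gcongr),
      (le_abs_self _).trans (h2.2.trans (by gcongr))⟩
  · obtain ⟨h1, h2⟩ := hsc r hr
    have h3 := hs.nonneg y₁ y₂
    exact (hs.symmDiffMetric_le hr y₁ y₂).trans (by gcongr)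
  · have h1 := hs.intervalIntegrable_symmDiffMetric_lipschitz hη y₁ y₂
    have h2 := hs.nonneg y₁ y₂
    have h3 := hnorm _ _ η hη
    refine ⟨h1.1, (le_abs_self _).trans (h1.2.trans ?_)⟩
    calc _ = c' * weightNorm Q.dim Q.dim₀ η * Q.theta y₁ y₂ := by rw [hc']; ring
      _ ≤ _ := by gcongr
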